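/- **Setting.** Let $d\ge 1$, $T>0$. A *time-dependent domain* is a set $D=D'\cap([0,T]\times\mathbb R^d)$ with $D'\subset\mathbb R^{d+1}$ open and connected, whose time sections $D_t=\{z:(t,z)\in D\}$ are non-empty, bounded and connected for all $t\in[0,T]$. For $t\in[0,T]$ and $z\in\partial D_t$ let $\Gamma_t(z)\subset\mathbb R^d$ be a (non-empty) closed convex cone, and put $\Gamma^1_t(z)=\{\gamma\in\Gamma_t(z):|\gamma|=1\}$, $$G^\Gamma=\{(t,z,\gamma): t\in[0,T],\ z\in\partial D_t,\ \gamma\in\Gamma_t(z)\},\qquad G_T=\{(t,z,\gamma)\in G^\Gamma:|\gamma|=1\}.$$ For $z\in\partial D_s$ and $\rho,\eta>0$ let $$a_{s,z}(\rho,\eta)=\sup_{|u|=1}\ \inf\{\langle\gamma,u\rangle: s\le t\le s+\eta,\ t\le T,\ y\in\partial D_t,\ |y-z|\le\rho,\ \gamma\in\Gamma^1_t(y)\},$$ let $c_{s,z}(\rho,\eta)\ge 0$ be the supremum of $\frac{\langle\gamma,y-\hat z\rangle}{|y-\hat z|}\vee 0$ over the same $t,y,\gamma$ and all $\hat z\in\overline{D_t}$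 with $|\hat z-z|\le\rho$, $\hat z\ne y$ (with $\inf\emptyset=+\infty$, and $c=0$ if there is nothing to take the supremum over), and let $e_{s,z}=c_{s,z}/(a_{s,z}^2\vee a_{s,z}/2)$. Let $l_D(r)=\sup\{d(z,D_t): s,t\in[0,T],\ |s-t|\le r,\ z\in\overline{D_s}\}$. Unit vectors $n$ for which some $\rho>0$ satisfies $B_\rho(z-\rho n)\cap D_t=\emptyset$ are the unit inward normals at $z\in\partial D_t$. $D$ satisfies the *uniform exterior sphere condition in time* with radius $r_0$ if, for all $t\in[0,T]$ and $z\in\partial D_t$, there is at least one unit inward normal $n$ at $z$, and $B_{r_0}(z-r_0n)\cap D_t=\emptyset$ for every such $n$. $(D,\Gamma)$ has the *$(\delta_0,h_0)$-property of good projections* on $(0,T)$ if for all $t\in(0,T)$ and $y\notin\overline{D_t}$ with $d(y,D_t)<\delta_0$ there is $p\in\partial D_t$ with $p-y\in\Gamma_t(p)$ and $|y-p|\le h_0\,d(y,D_t)$. Let $\mathcal D([0,T],\mathbb R^d)$ be the set of càdlàg paths, with the Skorohod topology (given by increasing bijections of $[0,T]$ as time changes), and $\mathcal D^{\delta}$ its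 subset of paths with $\sup_{0<t\le T}|x_t-x_{t^-}|<\delta$. Given $w\in\mathcal D([0,T],\mathbb R^d)$ with $w_0\in\overline{D_0}$, a *solution to the Skorohod problem for $(D,\Gamma,w)$* is a pair $(x,\lambda)$ with $x\in\mathcal D([0,T],\mathbb R^d)$ and $\lambda$ of bounded variation on $[0,T]$, with total variation measure $d|\lambda|$, such that for all $t\in[0,T]$: $x_t=w_t+\lambda_t\in\overline{D_t}$; $\lambda_t=\int_{[0,t]}\gamma_s\,d|\lambda|_s$ for a Borel function $\gamma$ with $\gamma_s\in\Gamma^1_s(x_s)$ for $d|\lambda|$-a.e. $s$ with $x_s\in\partial D_s$; and $d|\lambda|(\{t\in[0,T]:(t,x_t)\in D\})=0$. **Theorem.** Let $D$ be a time-dependent domain with cones $\Gamma$ such that $G^\Gamma$ is closed and $\gamma_1\cdot\gamma_2>-1$ for all $\gamma_1,\gamma_2\in\Gamma^1_t(z)$, $z\in\partial D_t$, $t\in[0,T]$. Let $D^n$, $n\ge1$, be time-dependent domains with cones $\Gamma^n$, and let $0<\delta_0<\rho_0<r_0$, $\eta_0>0$, $h_0>1$ be independent of $n$. Write $a^n,e^n$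 for the quantities above formed with $(D^n,\Gamma^n)$. Assume that every $D^n$ satisfies the uniform exterior sphere condition in time with radius $r_0$, that every $(D^n,\Gamma^n)$ has the $(\delta_0,h_0)$-property of good projections on $(0,T)$, that $$\inf_n\inf_{s\in[0,T]}\inf_{z\in\partial D^n_s}a^n_{s,z}(\rho_0,\eta_0)>0,\qquad \sup_n\sup_{s\in[0,T]}\sup_{z\in\partial D^n_s}e^n_{s,z}(\rho_0,\eta_0)<1,\qquad \lim_{r\to0^+}\sup_n l_{D^n}(r)=0,$$ and that all $D^n_t$ and $D_t$ lie in one common ball. Assume that, with $h$ the Hausdorff distance, $$\lim_{n\to\infty}\sup_{t\in[0,T]}h(D^n_t,D_t)=0,\qquad \lim_{n\to\infty}\sup_{t\in[0,T]}h(\partial D^n_t,\partial D_t)=0,$$ and that $G^n_T\to G_T$ in the Hausdorff distance formed with $|s-\hat s|+|z-\hat z|+|\gamma-\hat\gamma|$. Let $w^n\in\mathcal D([0,T],\mathbb R^d)$ converge to $w\in\mathcal D([0,T],\mathbb R^d)$ in the Skorohod topology, and let $(x^n,\lambda^n)$ be solutions to the Skorohod problems for $(D^n,\Gamma^n,w^n)$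 (in particular $w^n_0\in\overline{D^n_0}$) with $x^n\in\mathcal D^{\rho_0}([0,T],\mathbb R^d)$ for all $n$. Then: 1. every subsequence of $\{(x^n,\lambda^n)\}$ has a further subsequence that converges in $\mathcal D([0,T],\mathbb R^d)\times\mathcal D([0,T],\mathbb R^d)$; 2. whenever a subsequence of $\{(x^n,\lambda^n)\}$ converges to some $(x,\lambda)$ in $\mathcal D([0,T],\mathbb R^d)\times\mathcal D([0,T],\mathbb R^d)$, then $w_0\in\overline{D_0}$, the path $\lambda$ is of bounded variation, $(x,\lambda)$ is a solution to the Skorohod problem for $(D,\Gamma,w)$, all jumps of $x$ are at most $\rho_0$, and $x\in\mathcal D^{\rho_0}([0,T],\mathbb R^d)$ if $\sup_n\sup_t|x^n_t-x^n_{t^-}|<\rho_0$. -/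

import Mathlib

open Set Filter Topology MeasureTheory
open scoped ENNReal

noncomputable section

/-- Euclidean `d`-space. -/
abbrev Euc (d : ℕ) : Type := EuclideanSpace ℝ (Fin d)

/-! ### Càdlàg paths on `[0, T]`

A path on `[0, T]` is represented by a function on `ℝ` of which only the values on `[0, T]` are
used. -/

/-- `x` is right continuous on `[0, T)` and has left limits on `(0, T]`. -/
def IsCadlag {d : ℕ} (T : ℝ) (x : ℝ → Euc d) : Prop :=
  (∀ t ∈ Ico 0 T, Tendsto x (𝓝[>] t) (𝓝 (x t))) ∧
  (∀ t ∈ Ioc 0 T, ∃ y : Euc d, Tendsto x (𝓝[<] t) (𝓝 y))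

/-- The supremum over `t` of the jump sizes `|x_t - x_{t-}|`. There is no jump at time `0`. -/
def jumpSup {d : ℕ} (T : ℝ) (x : ℝ → Euc d) : ℝ≥0∞ :=
  ⨆ t ∈ Ioc 0 T, ‖x t - Function.leftLim x t‖ₑ

/-- The class `𝒟^δ([0, T], ℝ^d)` of càdlàg paths with jumps smaller than `δ`. -/
def IsCadlagJumpLT {d : ℕ} (T δ : ℝ) (x : ℝ → Euc d) : Prop :=
  IsCadlag T x ∧ jumpSup T x < ENNReal.ofReal δ

/-- Convergence of `x n` to `x` in the Skorohod (J1) topology of càdlàg paths on `[0, T]`: there are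
increasing bijections `θ n` of `[0, T]` with `sup_t |θ n t - t| → 0` and
`sup_t |x n t - x (θ n t)| → 0`. -/
def SkorohodTendsto {d : ℕ} (T : ℝ) (xs : ℕ → ℝ → Euc d) (x : ℝ → Euc d) : Prop :=
  ∃ θ : ℕ → (Icc (0 : ℝ) T ≃o Icc (0 : ℝ) T),
    Tendsto (fun n => ⨆ t : Icc (0 : ℝ) T, edist (θ n t : ℝ) (t : ℝ)) atTop (𝓝 0) ∧
    Tendsto (fun n => ⨆ t : Icc (0 : ℝ) T, edist (xs n t) (x (θ n t))) atTop (𝓝 0)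

/-! ### Total variation -/

/-- The total variation `|lam|_t` of `lam` on `[0, t]`, frozen after time `T`. -/
def totalVar {d : ℕ} (T : ℝ) (lam : ℝ → Euc d) (t : ℝ) : ℝ :=
  (eVariationOn lam (Icc 0 (min t T))).toReal

theorem totalVar_mono {d : ℕ} {T : ℝ} {lam : ℝ → Euc d}
    (h : BoundedVariationOn lam (Icc 0 T)) : Monotone (totalVar T lam) := by
  intro s t hst
  refine ENNReal.toReal_mono ?_ ?_
  · exact ne_top_of_le_ne_top h
      (eVariationOn.mono lam (Icc_subset_Icc le_rfl (min_le_right _ _)))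
  · exact eVariationOn.mono lam (Icc_subset_Icc le_rfl (min_le_min_right _ hst))

/-- The Lebesgue-Stieltjes measure `d|lam|` of the total variation function of `lam`. -/
def variationMeasure {d : ℕ} (T : ℝ) (lam : ℝ → Euc d)
    (h : BoundedVariationOn lam (Icc 0 T)) : Measure ℝ :=
  (totalVar_mono h).stieltjesFunction.measure

/-! ### Time-dependent domains -/

/-- The time section `D_t`. -/
def timeSection {d : ℕ} (D : Set (ℝ × Euc d)) (t : ℝ) : Set (Euc d) := {z | (t, z) ∈ D}

/-- `D = D' ∩ ([0, T] × ℝ^d)` for an open connected `D'`, with non-empty, bounded and connected time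
sections. -/
structure IsTimeDependentDomain {d : ℕ} (T : ℝ) (D : Set (ℝ × Euc d)) : Prop where
  exists_open : ∃ D' : Set (ℝ × Euc d), IsOpen D' ∧ IsConnected D' ∧ D = D' ∩ (Icc 0 T ×ˢ univ)
  nonempty : ∀ t ∈ Icc 0 T, (timeSection D t).Nonempty
  bounded : ∀ t ∈ Icc 0 T, Bornology.IsBounded (timeSection D t)
  connected : ∀ t ∈ Icc 0 T, IsConnected (timeSection D t)

/-- The cone `N_t(z)` of inward normal vectors of the time section at `z`. -/
def normalCone {d : ℕ} (D : Set (ℝ × Euc d)) (t : ℝ) (z : Euc d) : Set (Euc d) :=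
  {0} ∪ {v | v ≠ 0 ∧ ∃ ρ > 0, Metric.ball (z - (ρ / ‖v‖) • v) ρ ⊆ (timeSection D t)ᶜ}

/-- Uniform exterior sphere condition in time with radius `r₀`: every boundary point of every time
section has a unit inward normal, and each such normal is realized by an exterior ball of radius
`r₀`. -/
def ExteriorSphere {d : ℕ} (T r₀ : ℝ) (D : Set (ℝ × Euc d)) : Prop :=
  ∀ t ∈ Icc 0 T, ∀ z ∈ frontier (timeSection D t),
    (normalCone D t z ∩ Metric.sphere 0 1).Nonempty ∧
    ∀ n ∈ normalCone D t z ∩ Metric.sphere 0 1,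
      Metric.ball (z - r₀ • n) r₀ ⊆ (timeSection D t)ᶜ

/-- The modulus of continuity `l(r)` of the variation of `D` in time. -/
def timeModulus {d : ℕ} (T : ℝ) (D : Set (ℝ × Euc d)) (r : ℝ) : ℝ≥0∞ :=
  ⨆ s ∈ Icc 0 T, ⨆ t ∈ Icc 0 T, ⨆ (_ : |s - t| ≤ r),
    ⨆ z ∈ closure (timeSection D s), Metric.infEDist z (timeSection D t)

/-! ### Cones of reflection -/

/-- A closed convex cone of vectors. -/
structure IsClosedConvexCone {d : ℕ} (C : Set (Euc d)) : Prop where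
  nonempty : C.Nonempty
  closed : IsClosed C
  combo : ∀ α β : ℝ, 0 ≤ α → 0 ≤ β → ∀ u ∈ C, ∀ v ∈ C, α • u + β • v ∈ C

/-- `Γ_t(z)` is a closed convex cone at every boundary point of every time section. -/
def IsConeField {d : ℕ} (T : ℝ) (D : Set (ℝ × Euc d)) (Γ : ℝ → Euc d → Set (Euc d)) : Prop :=
  ∀ t ∈ Icc 0 T, ∀ z ∈ frontier (timeSection D t), IsClosedConvexCone (Γ t z)

/-- The unit vectors `Γ¹_t(z)` of the cone `Γ_t(z)`. -/
def unitCone {d : ℕ} (Γ : ℝ → Euc d → Set (Euc d)) (t : ℝ) (z : Euc d) : Set (Euc d) :=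
  Γ t z ∩ Metric.sphere 0 1

/-- No two unit vectors of one cone are opposite. -/
def NoOppositeDirections {d : ℕ} (T : ℝ) (D : Set (ℝ × Euc d))
    (Γ : ℝ → Euc d → Set (Euc d)) : Prop :=
  ∀ t ∈ Icc 0 T, ∀ z ∈ frontier (timeSection D t),
    ∀ γ₁ ∈ unitCone Γ t z, ∀ γ₂ ∈ unitCone Γ t z, -1 < inner ℝ γ₁ γ₂

/-- The graph `{(t, z, γ) : γ ∈ Γ_t(z), z ∈ ∂D_t, t ∈ [0, T]}`. -/
def coneGraph {d : ℕ} (T : ℝ) (D : Set (ℝ × Euc d)) (Γ : ℝ → Euc d → Set (Euc d)) :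
    Set (ℝ × Euc d × Euc d) :=
  {p | p.1 ∈ Icc 0 T ∧ p.2.1 ∈ frontier (timeSection D p.1) ∧ p.2.2 ∈ Γ p.1 p.2.1}

/-- The part `G_T` of the graph that consists of unit vectors. -/
def unitGraph {d : ℕ} (T : ℝ) (D : Set (ℝ × Euc d)) (Γ : ℝ → Euc d → Set (Euc d)) :
    Set (ℝ × Euc d × Euc d) :=
  {p ∈ coneGraph T D Γ | ‖p.2.2‖ = 1}

/-- The distance `|s - s'| + |z - z'| + |γ - γ'|`. -/
def graphEDist {d : ℕ} (p q : ℝ × Euc d × Euc d) : ℝ≥0∞ :=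
  edist p.1 q.1 + edist p.2.1 q.2.1 + edist p.2.2 q.2.2

/-- The Hausdorff distance that belongs to `graphEDist`. -/
def graphHausdorff {d : ℕ} (F G : Set (ℝ × Euc d × Euc d)) : ℝ≥0∞ :=
  max (⨆ p ∈ F, ⨅ q ∈ G, graphEDist p q) (⨆ q ∈ G, ⨅ p ∈ F, graphEDist q p)

/-! ### Interaction between the domain and the cones

For `t > T` the time sections are empty, so that only `t ∈ [s, min (s + η) T]` matters. -/

/-- `a_{s,z}(ρ, η)`. -/
def aCoeff {d : ℕ} (D : Set (ℝ × Euc d)) (Γ : ℝ → Euc d → Set (Euc d)) (ρ η s : ℝ)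
    (z : Euc d) : EReal :=
  ⨆ u ∈ Metric.sphere (0 : Euc d) 1, ⨅ t ∈ Icc s (s + η),
    ⨅ y ∈ frontier (timeSection D t) ∩ Metric.closedBall z ρ,
      ⨅ γ ∈ unitCone Γ t y, ((inner ℝ γ u : ℝ) : EReal)

/-- `c_{s,z}(ρ, η)`. The outer maximum with `0` matters only if there is no index at all. -/
def cCoeff {d : ℕ} (D : Set (ℝ × Euc d)) (Γ : ℝ → Euc d → Set (Euc d)) (ρ η s : ℝ)
    (z : Euc d) : EReal :=
  max 0 (⨆ t ∈ Icc s (s + η), ⨆ y ∈ frontier (timeSection D t) ∩ Metric.closedBall z ρ,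
    ⨆ z' ∈ (closure (timeSection D t) ∩ Metric.closedBall z ρ) \ {y},
      ⨆ γ ∈ unitCone Γ t y, ((max (inner ℝ γ (y - z') / ‖y - z'‖) 0 : ℝ) : EReal))

/-- `e_{s,z}(ρ, η) = c / (a² ∨ a / 2)`. -/
def eCoeff {d : ℕ} (D : Set (ℝ × Euc d)) (Γ : ℝ → Euc d → Set (Euc d)) (ρ η s : ℝ)
    (z : Euc d) : EReal :=
  cCoeff D Γ ρ η s z / max (aCoeff D Γ ρ η s z ^ 2) (aCoeff D Γ ρ η s z / 2)

/-- The `(δ₀, h₀)`-property of good projections along `Γ` on the time interval `(0, T)`: every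
point `y` outside the closure of `D_t` with `d(y, D_t) < δ₀` has a projection `p ∈ ∂D_t` along
`Γ_t`, that is `p - y ∈ Γ_t(p)`, with `|y - p| ≤ h₀ d(y, D_t)`. -/
def GoodProjections {d : ℕ} (T δ₀ h₀ : ℝ) (D : Set (ℝ × Euc d))
    (Γ : ℝ → Euc d → Set (Euc d)) : Prop :=
  ∀ t ∈ Ioo 0 T, ∀ y ∉ closure (timeSection D t), Metric.infDist y (timeSection D t) < δ₀ →
    ∃ p ∈ frontier (timeSection D t), p - y ∈ Γ t p ∧
      ‖y - p‖ ≤ h₀ * Metric.infDist y (timeSection D t)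

/-! ### The Skorohod problem -/

/-- `(x, lam)` is a solution to the Skorohod problem for `(D, Γ, w)` on `[0, T]`. -/
structure IsSkorohodSolution {d : ℕ} (T : ℝ) (D : Set (ℝ × Euc d))
    (Γ : ℝ → Euc d → Set (Euc d)) (w x lam : ℝ → Euc d) : Prop where
  w_cadlag : IsCadlag T w
  w_zero_mem : w 0 ∈ closure (timeSection D 0)
  x_cadlag : IsCadlag T x
  lam_bv : BoundedVariationOn lam (Icc 0 T)
  decomp : ∀ t ∈ Icc 0 T, x t = w t + lam t
  mem_closure : ∀ t ∈ Icc 0 T, x t ∈ closure (timeSection D t)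
  direction : ∃ γ : ℝ → Euc d, Measurable γ ∧
    (∀ t ∈ Icc 0 T, lam t = ∫ s in Icc 0 t, γ s ∂(variationMeasure T lam lam_bv)) ∧
    (∀ᵐ s ∂(variationMeasure T lam lam_bv), s ∈ Icc 0 T →
      x s ∈ frontier (timeSection D s) → γ s ∈ unitCone Γ s (x s))
  support : variationMeasure T lam lam_bv {t | t ∈ Icc 0 T ∧ (t, x t) ∈ D} = 0

end

/-!
Let `x = w + λ` be a solution of the Skorohod problem, with `dλ = γ d|λ|`. The two conditions on the
direction and on the support say together that `(s, x s, γ s)` is in the graph of the unit cones for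
`d|λ|`-almost every `s`; this is the content of `IsReflection`. The theorem rests on an a priori
estimate for `|λ|` and on the identification of the direction of a limiting reflection.

**A priori estimate.** At a jump time `v` the left limit of `x` lies in the closure of `D_v`, because
the domain varies continuously in time, so the constant `c` makes the jump of `x` nearly tangential
and the jump of `λ` is bounded by the jump of `w` (`measureReal_singleton_le`). If `x` is on the
boundary at time `q` and stays near `x q` until `r`, integration by parts gives
`‖λ_r - λ_q‖² ≤ 2 ∫ ⟨γ, λ - λ_q⟩ d|λ|`. The integrand is at most `c ‖λ - λ_q‖`, up to an error
controlled by the oscillation of `w` and the variation of the domain, while `a |λ|(q, r]` is at most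
`‖λ_r - λ_q‖`. Since `c ≤ e max(a², a/2)` with `e < 1`, the quadratic inequality closes
(`measureReal_Ioc_le_of_mem_frontier`). Stopping `x` when it leaves a small ball turns this into a
bound for `|λ|` on every interval on which `w` oscillates little and the domain varies little
(`measureReal_Ioc_le`).

**Compactness.** Let `θ n` be time changes along which `w^n` converges uniformly to `w`. A partition
adapted to `w` serves for all large `n` at once, so the estimate bounds the masses of `|λ^n|` and
makes the time-changed `x^n` oscillate little on the pieces of a fixed partition
(`exists_measure_univ_le`, `exists_finset_measureReal_le`). A diagonal argument extracts a uniformly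
convergent subsequence (`exists_subseq_uniform`).

**The limit.** Limits in the Skorohod topology are unique, so every limit of a subsequence is a
uniform limit along the same time changes as for `w` (`SkorohodTendsto.convergesAlong`). The limit
`λ` is of bounded variation and has a polar decomposition `dλ = γ d|λ|` with `|γ| = 1`
(`exists_polar`). At an atom of `d|λ|` the direction `γ` is the limit of the directions of the jumps
of `λ^n`, which lies in the closed graph. At any other time `s`, up to countably many, `x` is
continuous. If `γ s` were not in the cone at `x s`, a vector `u` would separate it from the cone,
with `⟨·, u⟩ < 0` on all unit vectors of the cone, since these contain no opposite pair. By
compactness and the convergence of the graphs, the increments of `λ` near `s` would then have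
non-positive inner product with `u`, and so would `γ s`, by differentiation of measures
(`isReflection_of_convergesAlong`).
-/

/-! ### Oscillation of càdlàg paths -/

/-- The path `x` oscillates by at most `ε` on the pieces into which the points of `F` cut `[0, T]`:
`s < t` belong to one piece when no point of `F` lies in `(s, t]`. -/
def OscLE {E : Type*} [PseudoMetricSpace E] (T ε : ℝ) (F : Finset ℝ) (x : ℝ → E) : Prop :=
  ∀ s ∈ Icc 0 T, ∀ t ∈ Icc 0 T, s < t → (∀ f ∈ F, f ∉ Ioc s t) → dist (x s) (x t) ≤ ε

theorem OscLE.mono {E : Type*} [PseudoMetricSpace E] {T ε : ℝ} {F G : Finset ℝ} {x : ℝ → E}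
    (h : OscLE T ε F x) (hFG : F ⊆ G) : OscLE T ε G x :=
  fun s hs t ht hst hG => h s hs t ht hst fun f hf => hG f (hFG hf)

theorem exists_oscLE_of_tendsto {E : Type*} [PseudoMetricSpace E] {T : ℝ} {x : ℝ → E}
    (hr : ∀ t ∈ Ico 0 T, Tendsto x (𝓝[>] t) (𝓝 (x t)))
    (hl : ∀ t ∈ Ioc 0 T, ∃ y, Tendsto x (𝓝[<] t) (𝓝 y)) {ε : ℝ} (hε : 0 < ε) :
    ∃ F : Finset ℝ, OscLE T ε F x := by
  have key : ∀ c ∈ Icc 0 T, ∃ r > 0, ∀ s ∈ Icc 0 T, ∀ t ∈ Icc 0 T, s < t → c - r < s → t < c + r →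
      c ∉ Ioc s t → dist (x s) (x t) ≤ ε := by
    intro c hc
    have h1 : ∃ r > 0, ∀ s, c ≤ s → s ≤ T → s < c + r → dist (x s) (x c) < ε / 2 := by
      rcases hc.2.lt_or_eq with hcT | hcT
      · have := (hr c ⟨hc.1, hcT⟩) (Metric.ball_mem_nhds _ (half_pos hε))
        rw [mem_map, mem_nhdsGT_iff_exists_Ioo_subset] at this
        obtain ⟨u, hu, hsub⟩ := this
        refine ⟨u - c, sub_pos.2 hu, fun s hs _ hs' => ?_⟩
        rcases hs.eq_or_lt with rfl | hs
        · simpa using half_pos hε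
        · exact hsub ⟨hs, by linarith⟩
      · refine ⟨1, one_pos, fun s hs hs' _ => ?_⟩
        have : s = c := le_antisymm (hs'.trans hcT.ge) hs
        subst this
        simpa using half_pos hε
    have h2 : ∃ r > 0, ∃ y, ∀ s, 0 ≤ s → s < c → c - r < s → dist (x s) y < ε / 2 := by
      rcases hc.1.lt_or_eq with hc0 | hc0
      · obtain ⟨y, hy⟩ := hl c ⟨hc0, hc.2⟩
        have := hy (Metric.ball_mem_nhds _ (half_pos hε))
        rw [mem_map, mem_nhdsLT_iff_exists_Ioo_subset] at this
        obtain ⟨u, hu, hsub⟩ := this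
        exact ⟨c - u, sub_pos.2 hu, y, fun s _ hs hs' => hsub ⟨by linarith, hs⟩⟩
      · exact ⟨1, one_pos, x c, fun s hs hs' _ => absurd (hc0 ▸ hs') (not_lt.2 hs)⟩
    obtain ⟨r₁, hr₁, h1⟩ := h1
    obtain ⟨r₂, hr₂, y, h2⟩ := h2
    refine ⟨min r₁ r₂, lt_min hr₁ hr₂, fun s hs t ht hst hcs hct hcst => ?_⟩
    have m1 := min_le_left r₁ r₂
    have m2 := min_le_right r₁ r₂
    rcases le_or_gt c s with hcs' | hcs'
    · have a := h1 s hcs' hs.2 (by linarith)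
      have b := h1 t (hcs'.trans hst.le) ht.2 (by linarith)
      linarith [dist_triangle_right (x s) (x t) (x c)]
    · have htc : t < c := by
        by_contra h
        exact hcst ⟨hcs', not_lt.1 h⟩
      have a := h2 s hs.1 hcs' (by linarith)
      have b := h2 t ht.1 htc (by linarith)
      linarith [dist_triangle_right (x s) (x t) y]
  choose! r hr0 hr' using key
  obtain ⟨t, htT, hcov⟩ := isCompact_Icc.elim_nhds_subcover (fun c => Ioo (c - r c) (c + r c))
    fun c hc => Ioo_mem_nhds (by linarith [hr0 c hc]) (by linarith [hr0 c hc])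
  refine ⟨t ∪ t.image fun c => c + r c, fun a ha b hb hab hF => ?_⟩
  obtain ⟨c, hct, hac⟩ := mem_iUnion₂.1 (hcov ha)
  refine hr' c (htT c hct) a ha b hb hab hac.1 ?_ (hF c (by simp [hct]))
  by_contra h
  exact hF (c + r c) (Finset.mem_union_right _ (Finset.mem_image_of_mem _ hct)) ⟨hac.2, not_lt.1 h⟩

theorem IsCadlag.exists_oscLE {d : ℕ} {T : ℝ} {x : ℝ → Euc d} (hx : IsCadlag T x) {ε : ℝ}
    (hε : 0 < ε) : ∃ F : Finset ℝ, OscLE T ε F x :=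
  exists_oscLE_of_tendsto hx.1 hx.2 hε

/-- A finite set that cuts `[0, T]` into pieces of length at most `δ`. -/
theorem exists_oscLE_id (T : ℝ) {δ : ℝ} (hδ : 0 < δ) : ∃ F : Finset ℝ, OscLE T δ F (id : ℝ → ℝ) :=
  exists_oscLE_of_tendsto (fun _ _ => tendsto_nhdsWithin_of_tendsto_nhds tendsto_id)
    (fun t _ => ⟨t, tendsto_nhdsWithin_of_tendsto_nhds tendsto_id⟩) hδ

theorem exists_forall_notMem_Ioo_right (F : Finset ℝ) (t : ℝ) :
    ∃ u > t, ∀ f ∈ F, f ∉ Ioo t u := by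
  have h : ((F : Set ℝ) \ {t})ᶜ ∈ 𝓝 t :=
    (F.finite_toSet.subset sdiff_subset).isClosed.isOpen_compl.mem_nhds (by simp)
  obtain ⟨l, u, htlu, hsub⟩ := mem_nhds_iff_exists_Ioo_subset.1 h
  exact ⟨u, htlu.2, fun f hf hfu =>
    hsub ⟨htlu.1.trans hfu.1, hfu.2⟩ ⟨hf, fun h => hfu.1.ne' h⟩⟩

theorem exists_forall_notMem_Ioo_left (F : Finset ℝ) (t : ℝ) :
    ∃ l < t, ∀ f ∈ F, f ∉ Ioo l t := by
  have h : ((F : Set ℝ) \ {t})ᶜ ∈ 𝓝 t :=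
    (F.finite_toSet.subset sdiff_subset).isClosed.isOpen_compl.mem_nhds (by simp)
  obtain ⟨l, u, htlu, hsub⟩ := mem_nhds_iff_exists_Ioo_subset.1 h
  exact ⟨l, htlu.1, fun f hf hfu =>
    hsub ⟨hfu.1, hfu.2.trans htlu.2⟩ ⟨hf, fun h => hfu.2.ne h⟩⟩

theorem isCadlag_of_oscLE {d : ℕ} {T : ℝ} {x : ℝ → Euc d}
    (h : ∀ ε > 0, ∃ F : Finset ℝ, OscLE T ε F x) : IsCadlag T x := by
  constructor
  · intro t ht
    rw [Metric.tendsto_nhds]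
    intro ε hε
    obtain ⟨F, hF⟩ := h (ε / 2) (half_pos hε)
    obtain ⟨u, hu, hFu⟩ := exists_forall_notMem_Ioo_right F t
    filter_upwards [Ioo_mem_nhdsGT (lt_min hu ht.2)] with s hs
    have := hF t ⟨ht.1, ht.2.le⟩ s ⟨ht.1.trans hs.1.le, hs.2.le.trans (min_le_right _ _)⟩ hs.1
      fun f hf hfs => hFu f hf ⟨hfs.1, hfs.2.trans_lt (hs.2.trans_le (min_le_left _ _))⟩
    rw [dist_comm]
    linarith
  · intro t ht
    rw [← cauchy_map_iff_exists_tendsto, Metric.cauchy_iff]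
    refine ⟨inferInstance, fun ε hε => ?_⟩
    obtain ⟨F, hF⟩ := h (ε / 2) (half_pos hε)
    obtain ⟨l, hl, hFl⟩ := exists_forall_notMem_Ioo_left F t
    refine ⟨x '' Ioo (max l 0) t, image_mem_map (Ioo_mem_nhdsLT (max_lt hl ht.1)), ?_⟩
    have key : ∀ a ∈ Ioo (max l 0) t, ∀ b ∈ Ioo (max l 0) t, a < b → dist (x a) (x b) < ε := by
      intro a ha b hb hab
      have hm : ∀ c ∈ Ioo (max l 0) t, c ∈ Icc 0 T := fun c hc =>
        ⟨(le_max_right l 0).trans hc.1.le, hc.2.le.trans ht.2⟩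
      have := hF a (hm a ha) b (hm b hb) hab
        fun f hf hfs => hFl f hf
          ⟨(le_max_left l 0).trans_lt (ha.1.trans hfs.1), hfs.2.trans_lt hb.2⟩
      linarith
    rintro _ ⟨a, ha, rfl⟩ _ ⟨b, hb, rfl⟩
    rcases lt_trichotomy a b with hab | rfl | hab
    · exact key a ha b hb hab
    · simpa using hε
    · rw [dist_comm]
      exact key b hb a ha hab

/-- The last point of `F ∋ 0` up to time `t` lies in the same piece as `t`. -/
theorem exists_mem_finset_le {F : Finset ℝ} (h0 : (0 : ℝ) ∈ F) {t : ℝ} (ht : 0 ≤ t) :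
    ∃ f ∈ F, 0 ≤ f ∧ f ≤ t ∧ ∀ g ∈ F, g ∉ Ioc f t := by
  have hne : (F.filter (· ≤ t)).Nonempty := ⟨0, by simp [h0, ht]⟩
  have hm := Finset.max'_mem _ hne
  refine ⟨_, (Finset.mem_filter.1 hm).1, Finset.le_max' _ _ (by simp [h0, ht]),
    (Finset.mem_filter.1 hm).2, fun g hg hgt => ?_⟩
  exact absurd (Finset.le_max' _ g (Finset.mem_filter.2 ⟨hg, hgt.2⟩)) (not_le.2 hgt.1)

/-- Two paths that oscillate little on the pieces of `F` and are close on `F` are close. -/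
theorem dist_le_of_oscLE {E : Type*} [PseudoMetricSpace E] {T ε δ : ℝ} {F : Finset ℝ}
    {x y : ℝ → E} (h0 : (0 : ℝ) ∈ F) (hε : 0 ≤ ε) (hx : OscLE T ε F x) (hy : OscLE T ε F y)
    (hxy : ∀ f ∈ F, f ∈ Icc 0 T → dist (x f) (y f) ≤ δ) {t : ℝ} (ht : t ∈ Icc 0 T) :
    dist (x t) (y t) ≤ 2 * ε + δ := by
  obtain ⟨f, hf, hf0, hft, hfree⟩ := exists_mem_finset_le h0 ht.1
  have hfT : f ∈ Icc 0 T := ⟨hf0, hft.trans ht.2⟩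
  have hd := hxy f hf hfT
  rcases hft.eq_or_lt with rfl | hft
  · linarith
  · have a := hx f hfT t ht hft hfree
    have b := hy f hfT t ht hft hfree
    have := dist_triangle4 (x t) (x f) (y f) (y t)
    rw [dist_comm (x t) (x f)] at this
    linarith

theorem IsCadlag.exists_norm_le {d : ℕ} {T : ℝ} {x : ℝ → Euc d} (hx : IsCadlag T x) :
    ∃ R : ℝ, 0 ≤ R ∧ ∀ t ∈ Icc 0 T, ‖x t‖ ≤ R := by
  obtain ⟨F, hF⟩ := hx.exists_oscLE one_pos
  refine ⟨2 * 1 + ∑ f ∈ insert 0 F, ‖x f‖, by positivity, fun t ht => ?_⟩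
  have h := dist_le_of_oscLE (y := fun _ => (0 : Euc d)) (δ := ∑ f ∈ insert 0 F, ‖x f‖)
    (Finset.mem_insert_self 0 F) zero_le_one (hF.mono (Finset.subset_insert _ _))
    (fun _ _ _ _ _ _ => by simp) (fun f hf _ => by
      rw [dist_zero_right]
      exact Finset.single_le_sum (f := fun f => ‖x f‖) (fun _ _ => norm_nonneg _) hf) ht
  simpa using h

theorem IsCadlag.exists_countable_continuousAt {d : ℕ} {T : ℝ} {x : ℝ → Euc d}
    (hx : IsCadlag T x) : ∃ Q : Set ℝ, Q.Countable ∧ ∀ t ∈ Ioo 0 T \ Q, ContinuousAt x t := by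
  choose F hF using fun k : ℕ => hx.exists_oscLE (Nat.one_div_pos_of_nat (α := ℝ) (n := k))
  refine ⟨⋃ k, (F k : Set ℝ), countable_iUnion fun k => (F k).countable_toSet, ?_⟩
  rintro t ⟨ht, htQ⟩
  rw [Metric.continuousAt_iff']
  intro ε hε
  obtain ⟨k, hk⟩ := exists_nat_one_div_lt hε
  obtain ⟨u, hu, hFu⟩ := exists_forall_notMem_Ioo_right (F k) t
  obtain ⟨l, hl, hFl⟩ := exists_forall_notMem_Ioo_left (F k) t
  have htF : t ∉ F k := fun h => htQ (mem_iUnion.2 ⟨k, h⟩)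
  filter_upwards [Ioo_mem_nhds (max_lt hl ht.1) (lt_min hu ht.2)] with s hs
  have hs' := max_lt_iff.1 hs.1
  have hs'' := lt_min_iff.1 hs.2
  have hsT : s ∈ Icc 0 T := ⟨hs'.2.le, hs''.2.le⟩
  have htT : t ∈ Icc 0 T := ⟨ht.1.le, ht.2.le⟩
  refine lt_of_le_of_lt ?_ hk
  rcases lt_trichotomy s t with h | rfl | h
  · refine hF k s hsT t htT h fun f hf hft => ?_
    rcases hft.2.eq_or_lt with rfl | h'
    · exact htF hf
    · exact hFl f hf ⟨hs'.1.trans hft.1, h'⟩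
  · rw [dist_self]; positivity
  · rw [dist_comm]
    exact hF k t htT s hsT h fun f hf hft => hFu f hf ⟨hft.1, hft.2.trans_lt hs''.1⟩

/-! ### Finite measures on the line -/

/-- Fubini's theorem over the two halves of the square: the double integral of a symmetric kernel is
twice the integral over `{w ≤ v}` minus the integral over the diagonal. -/
theorem integral_prod_symm_eq {P : Measure ℝ} [IsFiniteMeasure P] {K : ℝ × ℝ → ℝ}
    (hK : Integrable K (P.prod P)) (hsymm : ∀ p, K p.swap = K p) :
    ∫ p, K p ∂(P.prod P) =
      2 * (∫ v, ∫ w in Iic v, K (v, w) ∂P ∂P) - ∫ v, P.real {v} * K (v, v) ∂P := by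
  have hmeas : ∀ S : Set (ℝ × ℝ), MeasurableSet S →
      ∫ p, S.indicator K p ∂(P.prod P) = ∫ v, ∫ w in Prod.mk v ⁻¹' S, K (v, w) ∂P ∂P := by
    intro S hS
    rw [integral_prod _ (hK.indicator hS)]
    refine integral_congr_ae (ae_of_all _ fun v => ?_)
    dsimp only
    rw [← integral_indicator (measurable_prodMk_left hS)]
    rfl
  have hA : MeasurableSet {p : ℝ × ℝ | p.2 ≤ p.1} := measurableSet_le measurable_snd measurable_fst
  have hB : MeasurableSet {p : ℝ × ℝ | p.1 ≤ p.2} := measurableSet_le measurable_fst measurable_snd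
  have hD : MeasurableSet {p : ℝ × ℝ | p.2 = p.1} :=
    measurableSet_eq_fun measurable_snd measurable_fst
  have hsum : ∀ p, K p = {p : ℝ × ℝ | p.2 ≤ p.1}.indicator K p +
      {p : ℝ × ℝ | p.1 ≤ p.2}.indicator K p - {p : ℝ × ℝ | p.2 = p.1}.indicator K p := by
    intro p
    simp only [indicator, mem_ofPred_eq]
    rcases lt_trichotomy p.2 p.1 with h | h | h
    · simp [h.le, not_le.2 h, h.ne]
    · simp [h]
    · simp [h.le, not_le.2 h, h.ne']
  have hswap : ∫ p, {p : ℝ × ℝ | p.1 ≤ p.2}.indicator K p ∂(P.prod P) =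
      ∫ p, {p : ℝ × ℝ | p.2 ≤ p.1}.indicator K p ∂(P.prod P) := by
    rw [← integral_prod_swap]
    refine integral_congr_ae (ae_of_all _ fun p => ?_)
    simp [indicator, hsymm]
  have e1 := hmeas _ hA
  have e2 := hmeas _ hD
  have e3 : ∀ v, ∫ w in Prod.mk v ⁻¹' {p : ℝ × ℝ | p.2 = p.1}, K (v, w) ∂P =
      P.real {v} * K (v, v) := by
    intro v
    have : Prod.mk v ⁻¹' {p : ℝ × ℝ | p.2 = p.1} = {v} := by ext; simp
    rw [this, integral_singleton, smul_eq_mul]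
  calc ∫ p, K p ∂(P.prod P) = ∫ p, ({p : ℝ × ℝ | p.2 ≤ p.1}.indicator K p +
      {p : ℝ × ℝ | p.1 ≤ p.2}.indicator K p - {p : ℝ × ℝ | p.2 = p.1}.indicator K p)
        ∂(P.prod P) := integral_congr_ae (ae_of_all _ hsum)
    _ = _ := by
      have hAB : Integrable (fun p => {p : ℝ × ℝ | p.2 ≤ p.1}.indicator K p +
          {p : ℝ × ℝ | p.1 ≤ p.2}.indicator K p) (P.prod P) :=
        (hK.indicator hA).add (hK.indicator hB)
      rw [integral_sub hAB (hK.indicator hD),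
        integral_add (hK.indicator hA) (hK.indicator hB), hswap, e1, e2, two_mul]
      simp_rw [e3]
      rfl

section InnerProduct

variable {E : Type*} [NormedAddCommGroup E] [InnerProductSpace ℝ E]

theorem integrable_inner_prod {P : Measure ℝ} [IsFiniteMeasure P] {γ : ℝ → E}
    (hγ : Integrable γ P) : Integrable (fun p : ℝ × ℝ => inner ℝ (γ p.1) (γ p.2)) (P.prod P) := by
  refine (hγ.norm.mul_prod hγ.norm).mono
    (hγ.aestronglyMeasurable.comp_fst.inner hγ.aestronglyMeasurable.comp_snd)
    (ae_of_all _ fun p => ?_)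
  rw [Real.norm_eq_abs, Real.norm_of_nonneg (by positivity)]
  exact abs_real_inner_le_norm _ _

/-- Integration by parts for `‖∫ γ‖²`; the jump terms have a favourable sign. -/
theorem norm_sq_integral_le [CompleteSpace E] {P : Measure ℝ} [IsFiniteMeasure P] {γ : ℝ → E}
    (hγ : Integrable γ P) :
    ‖∫ v, γ v ∂P‖ ^ 2 ≤ 2 * ∫ v, inner ℝ (γ v) (∫ w in Iic v, γ w ∂P) ∂P := by
  have hK := integrable_inner_prod hγ
  have h := integral_prod_symm_eq hK fun p => real_inner_comm _ _
  have h1 : ∫ p : ℝ × ℝ, inner ℝ (γ p.1) (γ p.2) ∂(P.prod P) = ‖∫ v, γ v ∂P‖ ^ 2 := by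
    rw [integral_prod _ hK, ← real_inner_self_eq_norm_sq]
    simp_rw [integral_inner hγ]
    simp_rw [real_inner_comm (∫ v, γ v ∂P)]
    rw [integral_inner hγ]
  have h2 : ∀ v, ∫ w in Iic v, inner ℝ (γ v) (γ w) ∂P = inner ℝ (γ v) (∫ w in Iic v, γ w ∂P) :=
    fun v => integral_inner hγ.integrableOn _
  simp only [h2] at h
  rw [h1] at h
  have h3 : 0 ≤ ∫ v, P.real {v} * inner ℝ (γ v) (γ v) ∂P :=
    integral_nonneg fun v => mul_nonneg measureReal_nonneg real_inner_self_nonneg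
  linarith

end InnerProduct

theorem measurable_measureReal_singleton (P : Measure ℝ) [IsFiniteMeasure P] :
    Measurable fun v => P.real {v} := by
  have hD : MeasurableSet {p : ℝ × ℝ | p.2 = p.1} :=
    measurableSet_eq_fun measurable_snd measurable_fst
  have := (measurable_measure_prodMk_left (ν := P) hD).ennreal_toReal
  convert this using 2 with v
  rw [measureReal_def]
  congr 2

/-- `2 ∫ P(-∞, v] dP = P(ℝ)² + ∑ P{v}²`, with the sum over the atoms bounded by the mass of the
largest atom. -/
theorem two_mul_integral_measureReal_Iic_le {P : Measure ℝ} [IsFiniteMeasure P] {J : ℝ}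
    (hJ : ∀ᵐ v ∂P, P.real {v} ≤ J) :
    2 * ∫ v, P.real (Iic v) ∂P ≤ P.real univ ^ 2 + J * P.real univ := by
  have h := integral_prod_symm_eq (P := P) (K := fun _ => 1) (integrable_const _) fun _ => rfl
  simp only [integral_const, smul_eq_mul, mul_one, measureReal_restrict_apply_univ] at h
  have h1 : (P.prod P).real univ = P.real univ ^ 2 := by
    rw [measureReal_def, ← univ_prod_univ, Measure.prod_prod, ENNReal.toReal_mul, sq]; rfl
  have h2 : ∫ v, P.real {v} ∂P ≤ ∫ _, J ∂P := by
    refine integral_mono_ae ?_ (integrable_const _) hJ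
    refine Integrable.of_bound (measurable_measureReal_singleton P).aestronglyMeasurable
      (P.real univ) (ae_of_all _ fun v => ?_)
    rw [Real.norm_of_nonneg measureReal_nonneg]
    exact measureReal_mono (subset_univ _)
  rw [integral_const, smul_eq_mul] at h2
  rw [h1] at h
  linarith

theorem measure_le_of_forall_inter_Iic_le {ν : Measure ℝ} [IsFiniteMeasure ν] {A : Set ℝ}
    (hA : MeasurableSet A) {K : ℝ≥0∞} (h : ∀ t ∈ A, ν (A ∩ Iic t) ≤ K) : ν A ≤ K := by
  rw [hA.measure_eq_iSup_isCompact]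
  refine iSup₂_le fun C hCA => iSup_le fun hC => ?_
  rcases C.eq_empty_or_nonempty with rfl | hne
  · simp
  · obtain ⟨m, hm⟩ := hC.exists_isGreatest hne
    exact (measure_mono (subset_inter hCA hm.2)).trans (h m (hCA hm.1))

/-- A measure on `[0, T]` that charges by at most `K` every piece cut out by `F`, and by at most `J`
every point, has mass at most `|F| (J + K)`. -/
theorem measure_univ_le_of_pieces {ν : Measure ℝ} [IsFiniteMeasure ν] {T : ℝ} {F : Finset ℝ}
    (h0 : (0 : ℝ) ∈ F) (hν : ν (Icc 0 T)ᶜ = 0) {J K : ℝ≥0∞} (hJ : ∀ t ∈ Icc 0 T, ν {t} ≤ J)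
    (hK : ∀ s ∈ Icc 0 T, ∀ t ∈ Icc 0 T, s < t → (∀ f ∈ F, f ∉ Ioc s t) → ν (Ioc s t) ≤ K) :
    ν univ ≤ F.card * (J + K) := by
  set A : ℝ → Set ℝ := fun f => {t | t ∈ Icc 0 T ∧ f ∈ Icc 0 T ∧ f < t ∧ ∀ g ∈ F, g ∉ Ioc f t}
    with hA
  have hAconn : ∀ f, (A f).OrdConnected := by
    intro f
    refine ⟨fun a ha b hb c hc => ⟨⟨ha.1.1.trans hc.1, hc.2.trans hb.1.2⟩, ha.2.1,
      ha.2.2.1.trans_le hc.1, fun g hg hgc => hb.2.2.2 g hg ⟨hgc.1, hgc.2.trans hc.2⟩⟩⟩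
  have hAK : ∀ f, ν (A f) ≤ K := by
    intro f
    refine measure_le_of_forall_inter_Iic_le (hAconn f).measurableSet fun t ht => ?_
    refine (measure_mono ?_).trans (hK f ht.2.1 t ht.1 ht.2.2.1 ht.2.2.2)
    exact fun s hs => ⟨hs.1.2.2.1, hs.2⟩
  have hfJ : ∀ f, ν ({f} ∩ Icc 0 T) ≤ J := by
    intro f
    by_cases hf : f ∈ Icc 0 T
    · exact (measure_mono inter_subset_left).trans (hJ f hf)
    · rw [singleton_inter_eq_empty.2 hf]; simp
  have hcov : (univ : Set ℝ) ⊆ (Icc 0 T)ᶜ ∪ ⋃ f ∈ F, (({f} ∩ Icc 0 T) ∪ A f) := by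
    intro t _
    by_cases ht : t ∈ Icc 0 T
    · obtain ⟨f, hf, hf0, hft, hfree⟩ := exists_mem_finset_le h0 ht.1
      refine Or.inr (mem_iUnion₂.2 ⟨f, hf, ?_⟩)
      rcases hft.eq_or_lt with rfl | hlt
      · exact Or.inl ⟨rfl, ht⟩
      · exact Or.inr ⟨ht, ⟨hf0, hft.trans ht.2⟩, hlt, hfree⟩
    · exact Or.inl ht
  calc ν univ ≤ ν ((Icc 0 T)ᶜ ∪ ⋃ f ∈ F, (({f} ∩ Icc 0 T) ∪ A f)) := measure_mono hcov
    _ ≤ ν (Icc 0 T)ᶜ + ν (⋃ f ∈ F, (({f} ∩ Icc 0 T) ∪ A f)) := measure_union_le _ _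
    _ ≤ 0 + ∑ f ∈ F, (J + K) := by
      refine add_le_add hν.le ((measure_biUnion_finset_le _ _).trans
        (Finset.sum_le_sum fun f _ => (measure_union_le _ _).trans (add_le_add (hfJ f) (hAK f))))
    _ = F.card * (J + K) := by rw [Finset.sum_const, nsmul_eq_mul, zero_add]

/-- Lebesgue differentiation in terms of half-open intervals: a linear bound for the integrals of `γ`
over all small intervals `(a, b]` near `s` is inherited by `γ s`. -/
theorem ae_inner_le {E : Type*} [NormedAddCommGroup E] [InnerProductSpace ℝ E] [CompleteSpace E]
    {ν : Measure ℝ} [IsFiniteMeasure ν] {γ : ℝ → E} (hγ : Integrable γ ν) :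
    ∀ᵐ s ∂ν, ∀ (u : E) (c p q : ℝ), s ∈ Ioo p q →
      (∀ a b, p < a → a < b → b < q →
        inner ℝ (∫ v in Ioc a b, γ v ∂ν) u ≤ c * ν.real (Ioc a b)) → inner ℝ (γ s) u ≤ c := by
  filter_upwards [(Besicovitch.vitaliFamily ν).ae_tendsto_average hγ.locallyIntegrable,
    (Besicovitch.vitaliFamily ν).ae_eventually_measure_pos] with s hs hpos u c p q hspq h
  have hs' := hs.comp (Besicovitch.tendsto_filterAt ν s)
  have hpos' := (Besicovitch.tendsto_filterAt ν s).eventually hpos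
  have hsu : Tendsto (fun _ : ℝ => u) (𝓝[>] 0) (𝓝 u) := tendsto_const_nhds
  refine le_of_tendsto (hs'.inner hsu) ?_
  have hsmall : ∀ᶠ r in 𝓝[>] (0 : ℝ), r < min (s - p) (q - s) :=
    nhdsWithin_le_nhds (gt_mem_nhds (lt_min (sub_pos.2 hspq.1) (sub_pos.2 hspq.2)))
  filter_upwards [hpos', hsmall, self_mem_nhdsWithin] with r hr hr' hr0
  have hr0 : 0 < r := hr0
  have hrp := hr'.trans_le (min_le_left _ _)
  have hrq := hr'.trans_le (min_le_right _ _)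
  -- the closed ball is a decreasing limit of half-open intervals
  have hball : ⋂ n : ℕ, Ioc (s - r - 1 / ((n : ℝ) + 1)) (s + r) = Metric.closedBall s r := by
    rw [Real.closedBall_eq_Icc]
    ext y
    simp only [mem_iInter, mem_Ioc, mem_Icc]
    refine ⟨fun hy => ⟨?_, (hy 0).2⟩, fun hy n => ⟨?_, hy.2⟩⟩
    · refine le_of_tendsto' (x := atTop) (f := fun n : ℕ => s - r - 1 / ((n : ℝ) + 1)) ?_
        fun n => (hy n).1.le
      simpa using tendsto_const_nhds.sub (tendsto_one_div_add_atTop_nhds_zero_nat (𝕜 := ℝ))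
    · have : (0 : ℝ) < 1 / ((n : ℝ) + 1) := Nat.one_div_pos_of_nat
      linarith [hy.1]
  have hanti : Antitone fun n : ℕ => Ioc (s - r - 1 / ((n : ℝ) + 1)) (s + r) := by
    intro m n hmn
    refine Ioc_subset_Ioc_left ?_
    have : 1 / ((n : ℝ) + 1) ≤ 1 / ((m : ℝ) + 1) := Nat.one_div_le_one_div hmn
    linarith
  have t1 := tendsto_setIntegral_of_antitone (μ := ν) (f := γ) (fun n => measurableSet_Ioc) hanti
    ⟨0, hγ.integrableOn⟩
  have t2 := tendsto_measure_iInter_atTop (μ := ν)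
    (fun n : ℕ => (measurableSet_Ioc (a := s - r - 1 / ((n : ℝ) + 1)) (b := s + r)).nullMeasurableSet)
    hanti ⟨0, measure_ne_top _ _⟩
  rw [hball] at t1 t2
  have t3 := (ENNReal.tendsto_toReal (measure_ne_top ν (Metric.closedBall s r))).comp t2
  have key : inner ℝ (∫ v in Metric.closedBall s r, γ v ∂ν) u
      ≤ c * ν.real (Metric.closedBall s r) := by
    refine le_of_tendsto_of_tendsto (t1.inner tendsto_const_nhds) (t3.const_mul c) ?_
    have hev : ∀ᶠ n : ℕ in atTop, 1 / ((n : ℝ) + 1) < s - p - r :=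
      (tendsto_one_div_add_atTop_nhds_zero_nat (𝕜 := ℝ)).eventually (gt_mem_nhds (by linarith))
    filter_upwards [hev] with n hn
    have : (0 : ℝ) < 1 / ((n : ℝ) + 1) := Nat.one_div_pos_of_nat
    exact h _ _ (by linarith) (by linarith) (by linarith)
  have hm : 0 < ν.real (Metric.closedBall s r) := by
    rw [measureReal_def]
    exact ENNReal.toReal_pos hr.ne' (measure_ne_top _ _)
  simp only [Function.comp_apply]
  rw [setAverage_eq, real_inner_smul_left, inv_mul_le_iff₀ hm, mul_comm]
  exact key

/-! ### The polar decomposition of a right continuous path of bounded variation -/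

theorem IsCadlag.continuousWithinAt {d : ℕ} {T : ℝ} {x : ℝ → Euc d} (hx : IsCadlag T x) {t : ℝ}
    (ht : t ∈ Ico 0 T) : ContinuousWithinAt x (Ici t) t := by
  rw [← continuousWithinAt_Ioi_iff_Ici]
  exact hx.1 t ht

section totalVar

variable {d : ℕ} {T : ℝ} {lam : ℝ → Euc d}

theorem totalVar_of_nonpos {t : ℝ} (ht : t ≤ 0) : totalVar T lam t = 0 := by
  rw [totalVar, eVariationOn.subsingleton]
  · simp
  · intro a ha b hb
    have h := (min_le_left t T).trans ht
    rw [mem_Icc] at ha hb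
    linarith [ha.1, ha.2, hb.1, hb.2]

theorem totalVar_sub {s t : ℝ} (h : BoundedVariationOn lam (Icc 0 T)) (hs : 0 ≤ s) (hst : s ≤ t)
    (htT : t ≤ T) : totalVar T lam t - totalVar T lam s = (eVariationOn lam (Icc s t)).toReal := by
  have hsT := hst.trans htT
  have hfin : ∀ {a b}, 0 ≤ a → b ≤ T → eVariationOn lam (Icc a b) ≠ ⊤ := fun ha hb =>
    ne_top_of_le_ne_top h (eVariationOn.mono _ (Icc_subset_Icc ha hb))
  have key := eVariationOn.Icc_add_Icc lam (s := univ) hs hst (mem_univ _)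
  simp only [univ_inter] at key
  rw [totalVar, totalVar, min_eq_left htT, min_eq_left hsT, ← key,
    ENNReal.toReal_add (hfin le_rfl hsT) (hfin hs htT)]
  ring

theorem totalVar_rightCont (h : BoundedVariationOn lam (Icc 0 T)) (hlam : IsCadlag T lam) (t : ℝ) :
    ContinuousWithinAt (totalVar T lam) (Ioi t) t := by
  rcases lt_or_ge t 0 with ht | ht
  · have : totalVar T lam =ᶠ[𝓝 t] fun _ => 0 := by
      filter_upwards [gt_mem_nhds ht] with s hs using totalVar_of_nonpos hs.le
    exact (continuousAt_const.congr this.symm).continuousWithinAt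
  rcases lt_or_ge t T with htT | htT
  · have h1 := h.tendsto_eVariationOn_Icc_zero_right t
      ((hlam.continuousWithinAt ⟨ht, htT⟩).mono inter_subset_right)
    have h2 : Tendsto (fun y => (eVariationOn lam (Icc 0 T ∩ Icc t y)).toReal) (𝓝[>] t) (𝓝 0) := by
      have h3 : 𝓝[>] t ≤ 𝓝[Icc 0 T] t := by
        rw [← nhdsWithin_Ioo_eq_nhdsGT htT]
        exact nhdsWithin_mono _ fun y hy => ⟨ht.trans hy.1.le, hy.2.le⟩
      exact (ENNReal.tendsto_toReal ENNReal.zero_ne_top).comp (h1.mono_left h3)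
    have h4 := h2.add_const (totalVar T lam t)
    rw [zero_add] at h4
    refine h4.congr' ?_
    filter_upwards [Ioo_mem_nhdsGT htT] with y hy
    have : Icc 0 T ∩ Icc t y = Icc t y :=
      inter_eq_right.2 (Icc_subset_Icc ht hy.2.le)
    rw [this, ← totalVar_sub h ht hy.1.le hy.2.le]
    ring
  · have : EqOn (totalVar T lam) (fun _ => totalVar T lam t) (Ioi t) := by
      intro s hs
      have hs : t < s := hs
      simp only [totalVar, min_eq_right (htT.trans hs.le), min_eq_right htT]
    exact continuousWithinAt_const.congr this rfl

theorem stieltjes_totalVar_apply (h : BoundedVariationOn lam (Icc 0 T)) (hlam : IsCadlag T lam)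
    (t : ℝ) : (totalVar_mono h).stieltjesFunction t = totalVar T lam t := by
  rw [Monotone.stieltjesFunction_eq]
  exact ContinuousWithinAt.rightLim_eq (continuousWithinAt_Ioi_iff_Ici.1 (totalVar_rightCont h hlam t))

theorem totalVar_nonneg (t : ℝ) : 0 ≤ totalVar T lam t := ENNReal.toReal_nonneg

theorem totalVar_le (h : BoundedVariationOn lam (Icc 0 T)) (t : ℝ) :
    totalVar T lam t ≤ (eVariationOn lam (Icc 0 T)).toReal :=
  ENNReal.toReal_mono h (eVariationOn.mono _ (Icc_subset_Icc le_rfl (min_le_right _ _)))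

theorem isFiniteMeasure_variationMeasure (h : BoundedVariationOn lam (Icc 0 T))
    (hlam : IsCadlag T lam) : IsFiniteMeasure (variationMeasure T lam h) := by
  refine StieltjesFunction.isFiniteMeasure_of_forall_abs_le _
    (C := (eVariationOn lam (Icc 0 T)).toReal) fun t => ?_
  rw [stieltjes_totalVar_apply h hlam, abs_of_nonneg (totalVar_nonneg t)]
  exact totalVar_le h t

theorem variationMeasure_Ioc (h : BoundedVariationOn lam (Icc 0 T)) (hlam : IsCadlag T lam)
    (a b : ℝ) : variationMeasure T lam h (Ioc a b) =
      ENNReal.ofReal (totalVar T lam b - totalVar T lam a) := by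
  rw [variationMeasure, StieltjesFunction.measure_Ioc, stieltjes_totalVar_apply h hlam,
    stieltjes_totalVar_apply h hlam]

theorem variationMeasure_real_Ioc (h : BoundedVariationOn lam (Icc 0 T)) (hlam : IsCadlag T lam)
    {a b : ℝ} (hab : a ≤ b) : (variationMeasure T lam h).real (Ioc a b) =
      totalVar T lam b - totalVar T lam a := by
  rw [measureReal_def, variationMeasure_Ioc h hlam,
    ENNReal.toReal_ofReal (sub_nonneg.2 (totalVar_mono h hab))]

theorem variationMeasure_compl_Ioc (h : BoundedVariationOn lam (Icc 0 T)) (hlam : IsCadlag T lam) :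
    variationMeasure T lam h (Ioc 0 T)ᶜ = 0 := by
  have hcov : (Ioc 0 T)ᶜ ⊆ ⋃ n : ℕ, (Ioc (-(n : ℝ)) 0 ∪ Ioc T n) := by
    intro t ht
    obtain ⟨n, hn⟩ := exists_nat_gt |t|
    refine mem_iUnion.2 ⟨n, ?_⟩
    rcases le_or_gt t 0 with h0 | h0
    · exact Or.inl ⟨by linarith [neg_abs_le t], h0⟩
    · exact Or.inr ⟨not_le.1 fun hT => ht ⟨h0, hT⟩, by linarith [le_abs_self t]⟩
  refine measure_mono_null hcov (measure_iUnion_null fun n => measure_union_null ?_ ?_)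
  · rw [variationMeasure_Ioc h hlam, totalVar_of_nonpos le_rfl,
      totalVar_of_nonpos (neg_nonpos.2 n.cast_nonneg)]
    simp
  · rw [variationMeasure_Ioc h hlam, ENNReal.ofReal_eq_zero, sub_nonpos]
    simp only [totalVar, min_self]
    exact ENNReal.toReal_mono h (eVariationOn.mono _ (Icc_subset_Icc le_rfl (min_le_right _ _)))

end totalVar

/-- The point of `[0, T]` closest to `t`, for `0 ≤ T`. -/
def clip (T t : ℝ) : ℝ := max 0 (min t T)

theorem clip_mono (T : ℝ) : Monotone (clip T) := fun _ _ h =>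
  max_le_max le_rfl (min_le_min h le_rfl)

theorem clip_mem {T : ℝ} (hT : 0 ≤ T) (t : ℝ) : clip T t ∈ Icc 0 T :=
  ⟨le_max_left _ _, max_le hT (min_le_right _ _)⟩

theorem clip_of_mem {T t : ℝ} (ht : t ∈ Icc 0 T) : clip T t = t := by
  rw [clip, min_eq_left ht.2, max_eq_right ht.1]

theorem totalVar_clip {d : ℕ} {T : ℝ} {lam : ℝ → Euc d} (t : ℝ) :
    totalVar T lam (clip T t) = totalVar T lam t := by
  rcases le_total t 0 with h | h
  · rw [totalVar_of_nonpos h]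
    rcases le_total 0 T with hT | hT
    · rw [clip, max_eq_left ((min_le_left _ _).trans h), totalVar_of_nonpos le_rfl]
    · rw [clip, max_eq_left ((min_le_left _ _).trans h), totalVar_of_nonpos le_rfl]
  · rcases le_total 0 T with hT | hT
    · rw [clip, max_eq_right (le_min h hT)]
      simp [totalVar]
    · rw [clip, max_eq_left ((min_le_right _ _).trans hT)]
      simp [totalVar, min_eq_right (hT.trans h), min_eq_right hT]

section clip

variable {d : ℕ} {T : ℝ} {lam : ℝ → Euc d}

theorem norm_sub_clip_le (h : BoundedVariationOn lam (Icc 0 T)) (hT : 0 ≤ T) {s t : ℝ}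
    (hst : s ≤ t) : ‖lam (clip T t) - lam (clip T s)‖ ≤ totalVar T lam t - totalVar T lam s := by
  rw [← totalVar_clip t, ← totalVar_clip s]
  have hs := clip_mem hT s
  have ht := clip_mem hT t
  have hst := clip_mono T hst
  rw [totalVar_sub h hs.1 hst ht.2, ← dist_eq_norm, dist_edist]
  refine ENNReal.toReal_mono ?_ (eVariationOn.edist_le _ ⟨hst, le_rfl⟩ ⟨le_rfl, hst⟩)
  exact ne_top_of_le_ne_top h (eVariationOn.mono _ (Icc_subset_Icc hs.1 ht.2))

theorem clip_rightCont (hlam : IsCadlag T lam) (hT : 0 ≤ T) (t : ℝ) :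
    ContinuousWithinAt (fun t => lam (clip T t)) (Ici t) t := by
  rcases lt_or_ge t 0 with ht | ht
  · have : (fun t => lam (clip T t)) =ᶠ[𝓝 t] fun _ => lam 0 := by
      filter_upwards [gt_mem_nhds ht] with s hs
      rw [clip, max_eq_left ((min_le_left _ _).trans hs.le)]
    exact (continuousAt_const.congr this.symm).continuousWithinAt
  rcases lt_or_ge t T with htT | htT
  · refine (hlam.continuousWithinAt ⟨ht, htT⟩).congr_of_eventuallyEq ?_
      (by rw [clip_of_mem ⟨ht, htT.le⟩])
    filter_upwards [Ico_mem_nhdsGE htT] with s hs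
    rw [clip_of_mem ⟨ht.trans hs.1, hs.2.le⟩]
  · have hc : ∀ s ∈ Ici t, lam (clip T s) = lam T := fun s hs => by
      rw [clip, min_eq_right (htT.trans hs), max_eq_right hT]
    exact continuousWithinAt_const.congr hc (hc t (mem_Ici.2 le_rfl))

end clip

/-- A right continuous function dominated by a Stieltjes function `S` has a density with respect to
the measure of `S`: both `S + g` and `S - g` are Stieltjes functions, so that their measures are
dominated by twice that of `S`. -/
theorem exists_density_of_abs_sub_le (S : StieltjesFunction ℝ) [IsFiniteMeasure S.measure]
    {g : ℝ → ℝ} (hg : ∀ t, ContinuousWithinAt g (Ici t) t)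
    (hS : ∀ s t, s ≤ t → |g t - g s| ≤ S t - S s) :
    ∃ f : ℝ → ℝ, Measurable f ∧ Integrable f S.measure ∧
      ∀ s t, s ≤ t → g t - g s = ∫ v in Ioc s t, f v ∂S.measure := by
  let G : StieltjesFunction ℝ :=
    { toFun := fun t => S t + g t
      mono' := fun s t hst => by linarith [neg_abs_le (g t - g s), hS s t hst]
      right_continuous' := fun t => (S.right_continuous t).add (hg t) }
  let H : StieltjesFunction ℝ :=
    { toFun := fun t => S t - g t
      mono' := fun s t hst => by linarith [le_abs_self (g t - g s), hS s t hst]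
      right_continuous' := fun t => (S.right_continuous t).sub (hg t) }
  have hGH : G.measure + H.measure = S.measure + S.measure := by
    rw [← StieltjesFunction.measure_add, ← StieltjesFunction.measure_add]
    congr 1
    ext t
    change (S t + g t) + (S t - g t) = S t + S t
    ring
  have hle : G.measure ≤ S.measure + S.measure := hGH ▸ Measure.le_add_right le_rfl
  have hfin : IsFiniteMeasure G.measure := isFiniteMeasure_of_le _ hle
  have hac : G.measure ≪ S.measure := by
    refine Measure.AbsolutelyContinuous.mk fun s _ hs => le_antisymm ((hle s).trans ?_) zero_le
    simp [hs]
  have hint : Integrable (fun v => (G.measure.rnDeriv S.measure v).toReal) S.measure :=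
    Measure.integrable_toReal_rnDeriv
  refine ⟨fun v => (G.measure.rnDeriv S.measure v).toReal - 1,
    (Measure.measurable_rnDeriv _ _).ennreal_toReal.sub_const _, hint.sub (integrable_const _),
    fun s t hst => ?_⟩
  rw [integral_sub hint.integrableOn (integrable_const _),
    Measure.setIntegral_toReal_rnDeriv hac, integral_const, smul_eq_mul, mul_one,
    measureReal_restrict_apply_univ, measureReal_def, measureReal_def,
    StieltjesFunction.measure_Ioc, StieltjesFunction.measure_Ioc,
    ENNReal.toReal_ofReal (sub_nonneg.2 (G.mono hst)),
    ENNReal.toReal_ofReal (sub_nonneg.2 (S.mono hst))]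
  change _ = (S t + g t) - (S s + g s) - _
  ring

/-- The variation of `lam` over `[a, b]` is at most the integral of the norm of a density. -/
theorem eVariationOn_le_of_increments {d : ℕ} {ν : Measure ℝ} {γ : ℝ → Euc d}
    (hγ : Integrable γ ν) {lam : ℝ → Euc d} {a b : ℝ}
    (h : ∀ s ∈ Icc a b, ∀ t ∈ Icc a b, s ≤ t → lam t - lam s = ∫ v in Ioc s t, γ v ∂ν) :
    eVariationOn lam (Icc a b) ≤ ENNReal.ofReal (∫ v in Ioc a b, ‖γ v‖ ∂ν) := by
  set m : ℝ → ℝ := fun t => ∫ v in Ioc a t, ‖γ v‖ ∂ν with hm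
  have hsub : ∀ s ∈ Icc a b, ∀ t ∈ Icc a b, s ≤ t → m t - m s = ∫ v in Ioc s t, ‖γ v‖ ∂ν := by
    intro s hs t ht hst
    rw [hm]
    dsimp only
    rw [← Ioc_union_Ioc_eq_Ioc hs.1 hst, setIntegral_union (Ioc_disjoint_Ioc_of_le le_rfl)
      measurableSet_Ioc hγ.norm.integrableOn hγ.norm.integrableOn]
    ring
  refine iSup_le fun p => ?_
  have hp : ∀ i, (p.2 : ℕ → ℝ) i ∈ Icc a b := fun i => p.2.2.2 i
  have hpm : ∀ i, (p.2 : ℕ → ℝ) i ≤ (p.2 : ℕ → ℝ) (i + 1) := fun i => p.2.2.1 (Nat.le_succ i)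
  calc ∑ i ∈ Finset.range p.1, edist (lam ((p.2 : ℕ → ℝ) (i + 1))) (lam ((p.2 : ℕ → ℝ) i))
      ≤ ∑ i ∈ Finset.range p.1,
        ENNReal.ofReal (m ((p.2 : ℕ → ℝ) (i + 1)) - m ((p.2 : ℕ → ℝ) i)) := by
        refine Finset.sum_le_sum fun i _ => ?_
        rw [edist_dist, dist_eq_norm, h _ (hp i) _ (hp (i + 1)) (hpm i),
          hsub _ (hp i) _ (hp (i + 1)) (hpm i)]
        exact ENNReal.ofReal_le_ofReal (norm_integral_le_integral_norm _)
    _ = ENNReal.ofReal (m ((p.2 : ℕ → ℝ) p.1) - m ((p.2 : ℕ → ℝ) 0)) := by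
        rw [← ENNReal.ofReal_sum_of_nonneg fun i _ => ?_,
          Finset.sum_range_sub (fun i => m ((p.2 : ℕ → ℝ) i))]
        rw [hsub _ (hp i) _ (hp (i + 1)) (hpm i)]
        exact integral_nonneg fun _ => norm_nonneg _
    _ ≤ ENNReal.ofReal (∫ v in Ioc a b, ‖γ v‖ ∂ν) := by
        refine ENNReal.ofReal_le_ofReal ?_
        rw [hsub _ (hp 0) _ (hp p.1) (p.2.2.1 (Nat.zero_le _))]
        exact setIntegral_mono_set hγ.norm.integrableOn (ae_of_all _ fun _ => norm_nonneg _)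
          (Ioc_subset_Ioc (hp 0).1 (hp p.1).2).eventuallyLE

/-- Polar decomposition: `lam` is the integral of a unit vector field with respect to its total
variation measure. -/
theorem exists_polar {d : ℕ} {T : ℝ} (hT : 0 ≤ T) {lam : ℝ → Euc d}
    (h : BoundedVariationOn lam (Icc 0 T)) (hlam : IsCadlag T lam) :
    ∃ γ : ℝ → Euc d, Measurable γ ∧ (∀ᵐ v ∂(variationMeasure T lam h), ‖γ v‖ = 1) ∧
      ∀ s ∈ Icc 0 T, ∀ t ∈ Icc 0 T, s ≤ t →
        lam t - lam s = ∫ v in Ioc s t, γ v ∂(variationMeasure T lam h) := by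
  have hfin := isFiniteMeasure_variationMeasure h hlam
  set ν := variationMeasure T lam h with hν
  have hreal : ∀ a b, a ≤ b → ν.real (Ioc a b) = totalVar T lam b - totalVar T lam a :=
    fun a b hab => variationMeasure_real_Ioc h hlam hab
  have hdens : ∀ i : Fin d, ∃ f : ℝ → ℝ, Measurable f ∧ Integrable f ν ∧
      ∀ s t, s ≤ t → lam (clip T t) i - lam (clip T s) i = ∫ v in Ioc s t, f v ∂ν := by
    intro i
    have : IsFiniteMeasure (totalVar_mono h).stieltjesFunction.measure := hfin
    refine exists_density_of_abs_sub_le (totalVar_mono h).stieltjesFunction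
      (g := fun t => lam (clip T t) i) (fun t => ?_) fun s t hst => ?_
    · exact (EuclideanSpace.proj (𝕜 := ℝ) i).continuous.continuousAt.comp_continuousWithinAt
        (clip_rightCont hlam hT t)
    · rw [stieltjes_totalVar_apply h hlam, stieltjes_totalVar_apply h hlam]
      refine le_trans ?_ (norm_sub_clip_le h hT hst)
      have := PiLp.norm_apply_le (lam (clip T t) - lam (clip T s)) i
      simpa using this
  choose f hfm hfi hf using hdens
  set γ : ℝ → Euc d := fun v => WithLp.toLp 2 fun i => f i v with hγdef
  have hγm : Measurable γ := by
    refine (WithLp.measurable_toLp 2 _).comp (measurable_pi_lambda _ fun i => hfm i)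
  have hγi : Integrable γ ν := by
    have : γ = fun v => ∑ i, f i v • EuclideanSpace.single i (1 : ℝ) := by
      ext v j
      simp [hγdef, Finset.sum_apply, Pi.single_apply]
    rw [this]
    exact integrable_finsetSum _ fun i _ => (hfi i).smul_const _
  have hinc : ∀ s t, s ≤ t → lam (clip T t) - lam (clip T s) = ∫ v in Ioc s t, γ v ∂ν := by
    intro s t hst
    ext i
    rw [PiLp.sub_apply, hf i s t hst]
    exact (EuclideanSpace.proj (𝕜 := ℝ) i).integral_comp_comm (hγi.integrableOn (s := Ioc s t))
  refine ⟨γ, hγm, ?_, fun s hs t ht hst => ?_⟩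
  · filter_upwards [ae_inner_le hγi, ae_inner_le hγi.norm] with s h1 h2
    refine le_antisymm ?_ ?_
    · -- `‖∫_{(a, b]} γ‖ ≤ ν (a, b]` bounds the norm of `γ` from above
      rcases eq_or_ne (γ s) 0 with h0 | h0
      · simp [h0]
      have := h1 ((‖γ s‖)⁻¹ • γ s) 1 (s - 1) (s + 1) (by simp) fun a b _ hab _ => by
        refine (real_inner_le_norm _ _).trans ?_
        rw [norm_smul, norm_inv, norm_norm, inv_mul_cancel₀ (norm_ne_zero_iff.2 h0), mul_one,
          one_mul, ← hinc a b hab.le, hreal a b hab.le]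
        exact norm_sub_clip_le h hT hab.le
      rwa [real_inner_smul_right, real_inner_self_eq_norm_sq, sq, ← mul_assoc,
        inv_mul_cancel₀ (norm_ne_zero_iff.2 h0), one_mul] at this
    · -- `ν (a, b] ≤ ∫_{(a, b]} ‖γ‖` bounds it from below
      have := h2 (-1) (-1) (s - 1) (s + 1) (by simp) fun a b _ hab _ => by
        have hv : totalVar T lam b - totalVar T lam a ≤ ∫ v in Ioc a b, ‖γ v‖ ∂ν := by
          rw [← totalVar_clip b, ← totalVar_clip a]
          have ha := clip_mem hT a
          have hb := clip_mem hT b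
          have hab' := clip_mono T hab.le
          have hincl : Ioc (clip T a) (clip T b) ⊆ Ioc a b := by
            intro y hy
            simp only [clip, mem_Ioc, max_lt_iff, le_max_iff, min_lt_iff, le_min_iff] at hy ⊢
            rcases hy with ⟨⟨hy0, hy1⟩, hy2⟩
            rcases hy2 with hy2 | hy2
            · linarith
            · refine ⟨?_, hy2.1⟩
              rcases hy1 with hy1 | hy1
              · exact hy1
              · linarith
          rw [totalVar_sub h ha.1 hab' hb.2]
          refine (ENNReal.toReal_mono ENNReal.ofReal_ne_top
            (eVariationOn_le_of_increments hγi fun s hs t ht hst => ?_)).trans ?_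
          · rw [← hinc s t hst, clip_of_mem ⟨ha.1.trans ht.1, ht.2.trans hb.2⟩,
              clip_of_mem ⟨ha.1.trans hs.1, hs.2.trans hb.2⟩]
          · rw [ENNReal.toReal_ofReal (integral_nonneg fun _ => norm_nonneg _)]
            exact setIntegral_mono_set hγi.norm.integrableOn (ae_of_all _ fun _ => norm_nonneg _)
              hincl.eventuallyLE
        rw [hreal a b hab.le]
        simpa [add_comm] using hv
      simpa using this
  · rw [← hinc s t hst, clip_of_mem hs, clip_of_mem ht]

/-! ### Reflected paths -/

theorem IsCadlag.congr {d : ℕ} {T : ℝ} {x y : ℝ → Euc d} (hx : IsCadlag T x)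
    (h : EqOn x y (Icc 0 T)) : IsCadlag T y := by
  refine isCadlag_of_oscLE fun ε hε => ?_
  obtain ⟨F, hF⟩ := hx.exists_oscLE hε
  exact ⟨F, fun s hs t ht hst hfree => by rw [← h hs, ← h ht]; exact hF s hs t ht hst hfree⟩

theorem IsCadlag.sub {d : ℕ} {T : ℝ} {x y : ℝ → Euc d} (hx : IsCadlag T x) (hy : IsCadlag T y) :
    IsCadlag T fun t => x t - y t := by
  refine ⟨fun t ht => (hx.1 t ht).sub (hy.1 t ht), fun t ht => ?_⟩
  obtain ⟨a, ha⟩ := hx.2 t ht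
  obtain ⟨b, hb⟩ := hy.2 t ht
  exact ⟨a - b, ha.sub hb⟩

theorem IsTimeDependentDomain.isOpen_timeSection {d : ℕ} {T : ℝ} {D : Set (ℝ × Euc d)}
    (hD : IsTimeDependentDomain T D) {t : ℝ} (ht : t ∈ Icc 0 T) : IsOpen (timeSection D t) := by
  obtain ⟨D', hD', -, rfl⟩ := hD.exists_open
  have : timeSection (D' ∩ Icc 0 T ×ˢ univ) t = (fun z => (t, z)) ⁻¹' D' := by
    ext z
    simp only [timeSection, mem_ofPred_eq, mem_inter_iff, mem_prod, mem_univ, and_true,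
      mem_preimage]
    exact ⟨fun h => h.1, fun h => ⟨h, ht⟩⟩
  rw [this]
  exact hD'.preimage (by fun_prop)

theorem infEDist_le_timeModulus {d : ℕ} {T : ℝ} {D : Set (ℝ × Euc d)} {s t r : ℝ}
    (hs : s ∈ Icc 0 T) (ht : t ∈ Icc 0 T) (hr : |s - t| ≤ r) {z : Euc d}
    (hz : z ∈ closure (timeSection D s)) :
    Metric.infEDist z (timeSection D t) ≤ timeModulus T D r :=
  le_iSup₂_of_le s hs <| le_iSup₂_of_le t ht <| le_iSup_of_le hr <| le_iSup₂_of_le z hz le_rfl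

theorem tendsto_setIntegral_Ioc_left {E : Type*} [NormedAddCommGroup E] [NormedSpace ℝ E]
    [CompleteSpace E] {ν : Measure ℝ} {γ : ℝ → E} (hγ : Integrable γ ν) (v : ℝ) :
    Tendsto (fun s => ∫ r in Ioc s v, γ r ∂ν) (𝓝[<] v) (𝓝 (ν.real {v} • γ v)) := by
  rw [← integral_singleton, ← integral_indicator (measurableSet_singleton v)]
  simp_rw [← integral_indicator (measurableSet_Ioc (b := v))]
  refine tendsto_integral_filter_of_dominated_convergence (fun r => ‖γ r‖)
    (Eventually.of_forall fun s => (hγ.indicator measurableSet_Ioc).aestronglyMeasurable)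
    (Eventually.of_forall fun s => ae_of_all _ fun r => norm_indicator_le_norm_self _ _) hγ.norm
    (ae_of_all _ fun r => ?_)
  rcases lt_trichotomy r v with h | rfl | h
  · refine tendsto_const_nhds.congr' ?_
    filter_upwards [Ioo_mem_nhdsLT h] with s hs
    rw [indicator_of_notMem (by simpa using h.ne), indicator_of_notMem fun hr => ?_]
    exact absurd hr.1 (not_lt.2 hs.1.le)
  · refine tendsto_const_nhds.congr' ?_
    filter_upwards [self_mem_nhdsWithin] with s hs
    rw [indicator_of_mem (mem_singleton r), indicator_of_mem (show r ∈ Ioc s r from ⟨hs, le_rfl⟩)]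
  · refine tendsto_const_nhds.congr fun s => ?_
    rw [indicator_of_notMem (by simpa using h.ne'), indicator_of_notMem fun hr => ?_]
    exact absurd hr.2 (not_le.2 h)

/-- `ν` is a finite measure on `(0, T]` such that `γ dν` is the measure `d lam`, and `γ` is a unit
vector of the cone at the boundary point `x`. -/
structure IsReflection {d : ℕ} (T : ℝ) (D : Set (ℝ × Euc d)) (Γ : ℝ → Euc d → Set (Euc d))
    (x lam : ℝ → Euc d) (ν : Measure ℝ) (γ : ℝ → Euc d) : Prop where
  finite : IsFiniteMeasure ν
  compl : ν (Ioc 0 T)ᶜ = 0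
  meas : Measurable γ
  graph : ∀ᵐ v ∂ν, (v, x v, γ v) ∈ unitGraph T D Γ
  incr : ∀ s ∈ Icc 0 T, ∀ t ∈ Icc 0 T, s ≤ t → lam t - lam s = ∫ v in Ioc s t, γ v ∂ν

namespace IsReflection

variable {d : ℕ} {T : ℝ} {D : Set (ℝ × Euc d)} {Γ : ℝ → Euc d → Set (Euc d)}
  {x lam : ℝ → Euc d} {ν : Measure ℝ} {γ : ℝ → Euc d}

theorem integrable (h : IsReflection T D Γ x lam ν γ) : Integrable γ ν := by
  have := h.finite
  exact Integrable.of_bound h.meas.aestronglyMeasurable 1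
    (h.graph.mono fun v hv => hv.2.le)

theorem norm_incr_le (h : IsReflection T D Γ x lam ν γ) {s t : ℝ} (hs : s ∈ Icc 0 T)
    (ht : t ∈ Icc 0 T) (hst : s ≤ t) : ‖lam t - lam s‖ ≤ ν.real (Ioc s t) := by
  have := h.finite
  rw [h.incr s hs t ht hst]
  have := norm_setIntegral_le_of_norm_le_const_ae' (μ := ν) (s := Ioc s t) (C := 1)
    (measure_lt_top _ _) (f := γ) (h.graph.mono fun v hv _ => hv.2.le)
  simpa using this

theorem graph_of_atom (h : IsReflection T D Γ x lam ν γ) {v : ℝ} (hv : ν {v} ≠ 0) :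
    (v, x v, γ v) ∈ unitGraph T D Γ := by
  by_contra hn
  refine hv (measure_mono_null ?_ h.graph)
  rintro _ rfl
  exact hn

theorem tendsto_incr (h : IsReflection T D Γ x lam ν γ) {v : ℝ} (hv : v ∈ Ioc 0 T) :
    Tendsto (fun s => lam v - lam s) (𝓝[<] v) (𝓝 (ν.real {v} • γ v)) := by
  refine (tendsto_setIntegral_Ioc_left h.integrable v).congr' ?_
  filter_upwards [Ioo_mem_nhdsLT hv.1] with s hs
  rw [h.incr s ⟨hs.1.le, hs.2.le.trans hv.2⟩ v ⟨hv.1.le, hv.2⟩ hs.2.le]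

end IsReflection

/-- Every solution of the Skorohod problem has a reflection field; the two conditions on its
direction and its support combine to membership in the graph of the unit cones. -/
theorem IsSkorohodSolution.exists_isReflection {d : ℕ} {T : ℝ} (hT : 0 ≤ T)
    {D : Set (ℝ × Euc d)} (hD : IsTimeDependentDomain T D) {Γ : ℝ → Euc d → Set (Euc d)}
    {w x lam : ℝ → Euc d} (h : IsSkorohodSolution T D Γ w x lam) :
    lam 0 = 0 ∧ ∃ (ν : Measure ℝ) (γ : ℝ → Euc d), IsReflection T D Γ x lam ν γ := by
  have hlam : IsCadlag T lam := (h.x_cadlag.sub h.w_cadlag).congr fun t ht => by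
    simp [h.decomp t ht]
  obtain ⟨γ, hγm, hγ, hdir⟩ := h.direction
  set ν := variationMeasure T lam h.lam_bv with hν
  have hfin : IsFiniteMeasure ν := isFiniteMeasure_variationMeasure h.lam_bv hlam
  have hcompl : ν (Ioc 0 T)ᶜ = 0 := variationMeasure_compl_Ioc h.lam_bv hlam
  have hgraph : ∀ᵐ v ∂ν, (v, x v, γ v) ∈ unitGraph T D Γ := by
    have h1 : ∀ᵐ v ∂ν, v ∈ Ioc 0 T := by rw [ae_iff]; exact hcompl
    have h2 := measure_eq_zero_iff_ae_notMem.1 h.support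
    filter_upwards [h1, h2, hdir] with v hv hv2 hv3
    have hvT : v ∈ Icc 0 T := ⟨hv.1.le, hv.2⟩
    have hx : x v ∈ frontier (timeSection D v) := by
      rw [(hD.isOpen_timeSection hvT).frontier_eq]
      exact ⟨h.mem_closure v hvT, fun hx => hv2 ⟨hvT, hx⟩⟩
    have := hv3 hvT hx
    exact ⟨⟨hvT, hx, this.1⟩, by simpa using this.2⟩
  have hint : Integrable γ ν := Integrable.of_bound hγm.aestronglyMeasurable 1
    (hgraph.mono fun v hv => hv.2.le)
  have h0 : lam 0 = 0 := by
    rw [hγ 0 ⟨le_rfl, hT⟩, Icc_self]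
    refine setIntegral_measure_zero _ (measure_mono_null ?_ hcompl)
    rintro _ rfl
    simp
  refine ⟨h0, ν, γ, hfin, hcompl, hγm, hgraph, fun s hs t ht hst => ?_⟩
  rw [hγ t ht, hγ s hs, sub_eq_iff_eq_add', ← Icc_union_Ioc_eq_Icc hs.1 hst,
    setIntegral_union ?_ measurableSet_Ioc hint.integrableOn hint.integrableOn]
  exact disjoint_left.2 fun v hv hv' => absurd hv'.1 (not_lt.2 hv.2)

/-- Quantitative form of the lower bound on `a` and the upper bound on `e`, with a vector `u` that
nearly attains the supremum in `aCoeff`. If there are no unit vectors of cones near `z`, then `u = 0`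
qualifies, which is why `u` need not be a unit vector. -/
def CoeffBound {d : ℕ} (T ρ η a₀ e₀ : ℝ) (D : Set (ℝ × Euc d)) (Γ : ℝ → Euc d → Set (Euc d)) :
    Prop :=
  ∀ s ∈ Icc 0 T, ∀ z ∈ frontier (timeSection D s), ∃ (u : Euc d) (a c : ℝ), ‖u‖ ≤ 1 ∧
    a₀ ≤ a ∧ a ≤ 1 ∧ 0 ≤ c ∧ c ≤ e₀ * max (a ^ 2) (a / 2) ∧
    ∀ t ∈ Icc s (s + η), ∀ y ∈ frontier (timeSection D t) ∩ Metric.closedBall z ρ,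
      ∀ g ∈ unitCone Γ t y, a ≤ inner ℝ g u ∧
        ∀ z' ∈ closure (timeSection D t) ∩ Metric.closedBall z ρ,
          inner ℝ g (y - z') ≤ c * ‖y - z'‖

/-- A reflected path `x = w + lam` in a time-dependent domain that satisfies the quantitative
assumptions on the coefficients and on the jumps. -/
structure IsReflectedPath {d : ℕ} (T ρ η a₀ e₀ : ℝ) (D : Set (ℝ × Euc d))
    (Γ : ℝ → Euc d → Set (Euc d)) (w x lam : ℝ → Euc d) (ν : Measure ℝ) (γ : ℝ → Euc d) : Prop
    extends IsReflection T D Γ x lam ν γ where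
  domain : IsTimeDependentDomain T D
  x_cadlag : IsCadlag T x
  decomp : ∀ t ∈ Icc 0 T, x t = w t + lam t
  mem_closure : ∀ t ∈ Icc 0 T, x t ∈ closure (timeSection D t)
  jump : jumpSup T x < ENNReal.ofReal ρ
  coeff : CoeffBound T ρ η a₀ e₀ D Γ
  modulus : Tendsto (timeModulus T D) (𝓝[>] 0) (𝓝 0)

namespace IsReflectedPath

variable {d : ℕ} {T ρ η a₀ e₀ : ℝ} {D : Set (ℝ × Euc d)} {Γ : ℝ → Euc d → Set (Euc d)}
  {w x lam : ℝ → Euc d} {ν : Measure ℝ} {γ : ℝ → Euc d}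

theorem leftLim_mem_closure (h : IsReflectedPath T ρ η a₀ e₀ D Γ w x lam ν γ) {v : ℝ}
    (hv : v ∈ Ioc 0 T) {y : Euc d} (hy : Tendsto x (𝓝[<] v) (𝓝 y)) :
    y ∈ closure (timeSection D v) := by
  rw [Metric.mem_closure_iff_infEDist_zero]
  have h1 : Tendsto (fun s => timeModulus T D (v - s)) (𝓝[<] v) (𝓝 0) := by
    refine h.modulus.comp (tendsto_nhdsWithin_iff.2 ⟨?_, ?_⟩)
    · have : Tendsto (fun s => v - s) (𝓝 v) (𝓝 (v - v)) := tendsto_const_nhds.sub tendsto_id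
      rw [sub_self] at this
      exact this.mono_left nhdsWithin_le_nhds
    · filter_upwards [self_mem_nhdsWithin] with s hs
      exact sub_pos.2 (mem_Iio.1 hs)
  have h2 : Tendsto (fun s => Metric.infEDist (x s) (timeSection D v)) (𝓝[<] v)
      (𝓝 (Metric.infEDist y (timeSection D v))) :=
    (Metric.continuous_infEDist.tendsto y).comp hy
  refine le_antisymm (le_of_tendsto_of_tendsto h2 h1 ?_) zero_le
  filter_upwards [Ioo_mem_nhdsLT hv.1] with s hs
  have hsT : s ∈ Icc 0 T := ⟨hs.1.le, hs.2.le.trans hv.2⟩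
  refine infEDist_le_timeModulus hsT ⟨hv.1.le, hv.2⟩ ?_ (h.mem_closure s hsT)
  rw [abs_sub_comm, abs_of_pos (sub_pos.2 hs.2)]

/-- A jump of the reflection term is bounded by the jump of the driving path. The left limit of `x`
lies in the closed section, so that the jump of `x` is nearly tangential. -/
theorem measureReal_singleton_le (h : IsReflectedPath T ρ η a₀ e₀ D Γ w x lam ν γ)
    (hρ : 0 < ρ) (hη : 0 < η) (ha₀ : 0 < a₀) (he₀ : 0 ≤ e₀) (he₁ : e₀ < 1) {v W : ℝ}
    (hv : v ∈ Ioc 0 T) (hW : ∀ᶠ s in 𝓝[<] v, ‖w v - w s‖ ≤ W) :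
    ν.real {v} ≤ 2 * W / (1 - e₀) := by
  have hfin := h.finite
  have hvT : v ∈ Icc 0 T := ⟨hv.1.le, hv.2⟩
  have hW0 : 0 ≤ W := by
    obtain ⟨s, hs⟩ := hW.exists
    exact (norm_nonneg _).trans hs
  have he : 0 < 1 - e₀ := sub_pos.2 he₁
  by_cases hatom : ν {v} = 0
  · rw [measureReal_def, hatom]
    simp only [ENNReal.toReal_zero]
    positivity
  have hg := h.graph_of_atom hatom
  obtain ⟨y, hy⟩ := h.x_cadlag.2 v hv
  have hycl := h.leftLim_mem_closure hv hy
  have hjump : ‖x v - y‖ ≤ ρ := by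
    have h1 : ‖x v - Function.leftLim x v‖ₑ < ENNReal.ofReal ρ :=
      lt_of_le_of_lt (le_iSup₂ (f := fun t (_ : t ∈ Ioc 0 T) => ‖x t - Function.leftLim x t‖ₑ)
        v hv) h.jump
    rw [leftLim_eq_of_tendsto hy, ← ofReal_norm, ENNReal.ofReal_lt_ofReal_iff hρ] at h1
    exact h1.le
  obtain ⟨u, a, c, hu, ha, ha1, hc0, hce, hcoeff⟩ := h.coeff v hvT (x v) hg.1.2.1
  have hgc : γ v ∈ unitCone Γ v (x v) := ⟨hg.1.2.2, by simpa using hg.2⟩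
  have hgn : ‖γ v‖ = 1 := hg.2
  have hc := (hcoeff v ⟨le_rfl, by linarith⟩ (x v) ⟨hg.1.2.1, by simp [hρ.le]⟩ _ hgc).2 y
    ⟨hycl, by rw [mem_closedBall_iff_norm, norm_sub_rev]; exact hjump⟩
  have hc1 : c ≤ e₀ := by
    have : max (a ^ 2) (a / 2) ≤ 1 := max_le (by nlinarith) (by linarith)
    nlinarith
  set m := ν.real {v} with hm
  have hm0 : 0 ≤ m := measureReal_nonneg
  have hΔ : ‖(x v - y) - m • γ v‖ ≤ W := by
    refine le_of_tendsto (((tendsto_const_nhds (x := x v)).sub hy).sub (h.tendsto_incr hv)).norm ?_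
    filter_upwards [hW, Ioo_mem_nhdsLT hv.1] with s hs hs'
    have e : x v - x s - (lam v - lam s) = w v - w s := by
      rw [h.decomp v hvT, h.decomp s ⟨hs'.1.le, hs'.2.le.trans hv.2⟩]
      abel
    rw [e]
    exact hs
  have e1 : m = inner ℝ (γ v) (x v - y) - inner ℝ (γ v) ((x v - y) - m • γ v) := by
    rw [← inner_sub_right, sub_sub_cancel, real_inner_smul_right, real_inner_self_eq_norm_sq, hgn]
    ring
  have e2 : -inner ℝ (γ v) ((x v - y) - m • γ v) ≤ W := by
    have := abs_real_inner_le_norm (γ v) ((x v - y) - m • γ v)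
    rw [hgn, one_mul] at this
    linarith [neg_abs_le (inner ℝ (γ v) ((x v - y) - m • γ v))]
  have e3 : ‖x v - y‖ ≤ W + m := by
    calc ‖x v - y‖ = ‖((x v - y) - m • γ v) + m • γ v‖ := by rw [sub_add_cancel]
      _ ≤ W + m := (norm_add_le _ _).trans (add_le_add hΔ (by
        rw [norm_smul, hgn, mul_one, Real.norm_of_nonneg hm0]))
  have e4 : m ≤ e₀ * (W + m) + W := by
    have := mul_le_mul_of_nonneg_left e3 hc0
    have := mul_le_mul_of_nonneg_right hc1 (add_nonneg hW0 hm0)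
    linarith
  rw [le_div_iff₀ he]
  nlinarith

end IsReflectedPath

/-! ### The modulus of continuity of the reflection term -/

theorem csInf_mem_of_eventually_notMem {A : Set ℝ} (hne : A.Nonempty) (hb : BddBelow A)
    (h : sInf A ∉ A → ∀ᶠ v in 𝓝[>] sInf A, v ∉ A) : sInf A ∈ A := by
  by_contra hn
  obtain ⟨u, hu, hsub⟩ := mem_nhdsGT_iff_exists_Ioo_subset.1 (h hn)
  obtain ⟨v, hv, hvu⟩ := exists_lt_of_csInf_lt hne hu
  exact hsub ⟨lt_of_le_of_ne (csInf_le hb hv) fun e => hn (e ▸ hv), hvu⟩ hv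

/-- The algebra behind the local estimate. A fraction `a` of the mass `m` bounds the displacement from
below, and integration by parts bounds the square of the displacement in two ways: `h1` through the
square of the mass, which closes the argument if `c ≤ e₀ a²`, and `h2` through the supremum `M` of the
displacement, which does so if `c ≤ e₀ a / 2`. -/
theorem mass_le_of_quadratic {a₀ a c e₀ κ J m M : ℝ} (ha₀ : 0 < a₀) (ha : a₀ ≤ a)
    (he₀ : 0 ≤ e₀) (he₁ : e₀ < 1) (hce : c ≤ e₀ * max (a ^ 2) (a / 2)) (hc1 : c ≤ 1)
    (hκ : 0 ≤ κ) (hJ : 0 ≤ J) (hm : 0 ≤ m) (hM : a * m ≤ M)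
    (h1 : (a * m) ^ 2 ≤ c * (m ^ 2 + J * m) + 2 * κ * m)
    (h2 : M ^ 2 ≤ 2 * (c * M + κ) * m) :
    (1 - e₀) * a₀ ^ 2 * m ≤ J + 2 * κ := by
  have ha' : 0 < a := ha₀.trans_le ha
  have haa : a₀ ^ 2 ≤ a ^ 2 := by gcongr
  rcases hm.eq_or_lt with rfl | hm
  · simp; positivity
  have key : (1 - e₀) * a ^ 2 * m ≤ J + 2 * κ := by
    rcases le_total (a / 2) (a ^ 2) with hmax | hmax
    · rw [max_eq_left hmax] at hce
      have h3 : a ^ 2 * m ≤ c * (m + J) + 2 * κ := by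
        refine le_of_mul_le_mul_right ?_ hm
        nlinarith
      nlinarith
    · rw [max_eq_right hmax] at hce
      have hM0 : 0 < M := (mul_pos ha' hm).trans_le hM
      have h3 : 2 * c * m ≤ e₀ * M := by nlinarith
      have h4 : (1 - e₀) * M ^ 2 ≤ 2 * κ * m := by nlinarith
      have h5 : (1 - e₀) * a ^ 2 * m ^ 2 ≤ 2 * κ * m := by
        have : (a * m) ^ 2 ≤ M ^ 2 := by gcongr
        nlinarith
      have : (1 - e₀) * a ^ 2 * m ≤ 2 * κ := by
        refine le_of_mul_le_mul_right ?_ hm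
        nlinarith
      linarith
  have : (1 - e₀) * a₀ ^ 2 * m ≤ (1 - e₀) * a ^ 2 * m := by
    have := sub_pos.2 he₁
    gcongr
  linarith

namespace IsReflectedPath

variable {d : ℕ} {T ρ η a₀ e₀ : ℝ} {D : Set (ℝ × Euc d)} {Γ : ℝ → Euc d → Set (Euc d)}
  {w x lam : ℝ → Euc d} {ν : Measure ℝ} {γ : ℝ → Euc d}

/-- The local estimate: if `x` is on the boundary at time `q` and stays close to `x q` until `r`,
then the mass of the reflection on `(q, r]` is bounded by the oscillation of the driving path and
the variation of the domain. -/
theorem measureReal_Ioc_le_of_mem_frontier (h : IsReflectedPath T ρ η a₀ e₀ D Γ w x lam ν γ)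
    (ha₀ : 0 < a₀) (he₀ : 0 ≤ e₀) (he₁ : e₀ < 1) {q r W L J : ℝ}
    (hq : q ∈ Icc 0 T) (hr : r ∈ Icc 0 T) (hqr : q ≤ r) (hrη : r - q ≤ η)
    (hxq : x q ∈ frontier (timeSection D q)) (hx : ∀ v ∈ Ioc q r, ‖x v - x q‖ ≤ ρ)
    (hW0 : 0 ≤ W) (hL0 : 0 ≤ L) (hJ0 : 0 ≤ J)
    (hW : ∀ v ∈ Ioc q r, ‖w v - w q‖ ≤ W) (hL : timeModulus T D (r - q) < ENNReal.ofReal L)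
    (hLρ : L ≤ ρ) (hJ : ∀ v ∈ Ioc q r, ν.real {v} ≤ J) :
    (1 - e₀) * a₀ ^ 2 * ν.real (Ioc q r) ≤ J + 4 * (W + L) := by
  have hfin := h.finite
  obtain ⟨u, a, c, hu, ha, ha1, hc0, hce, hcoeff⟩ := h.coeff q hq (x q) hxq
  have ha' : 0 < a := ha₀.trans_le ha
  have hc1 : c ≤ 1 := by
    have : max (a ^ 2) (a / 2) ≤ 1 := max_le (by nlinarith) (by linarith)
    nlinarith
  have hvT : ∀ v ∈ Icc q r, v ∈ Icc 0 T := fun v hv => ⟨hq.1.trans hv.1, hv.2.trans hr.2⟩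
  set m := ν.real (Ioc q r) with hm
  set κ := 2 * (W + L) with hκ
  have hκ0 : 0 ≤ κ := by positivity
  -- the reflection directions met on `(q, r]`
  have hdir : ∀ᵐ v ∂ν, v ∈ Ioc q r → a ≤ inner ℝ (γ v) u ∧
      inner ℝ (γ v) (lam v - lam q) ≤ c * ‖lam v - lam q‖ + κ := by
    filter_upwards [h.graph] with v hg hv
    have hv' : v ∈ Icc 0 T := hg.1.1
    have hgc : γ v ∈ unitCone Γ v (x v) := ⟨hg.1.2.2, by simpa using hg.2⟩
    have hgn : ‖γ v‖ = 1 := hg.2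
    have hvη : v ∈ Icc q (q + η) := ⟨hv.1.le, by linarith [hv.2]⟩
    obtain ⟨h1, h2⟩ := hcoeff v hvη (x v) ⟨hg.1.2.1, mem_closedBall_iff_norm.2 (hx v hv)⟩ _ hgc
    refine ⟨h1, ?_⟩
    have hlt : Metric.infEDist (x q) (timeSection D v) < ENNReal.ofReal L := by
      refine lt_of_le_of_lt (infEDist_le_timeModulus hq hv' ?_ (h.mem_closure q hq)) hL
      rw [abs_sub_comm, abs_of_pos (sub_pos.2 hv.1)]
      linarith [hv.2]
    obtain ⟨z, hz, hzL⟩ := Metric.infEDist_lt_iff.1 hlt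
    rw [edist_dist, ENNReal.ofReal_lt_ofReal_iff', dist_eq_norm] at hzL
    have hzL := hzL.1.le
    have h3 := h2 z ⟨subset_closure hz, by
      rw [mem_closedBall_iff_norm, norm_sub_rev]; exact hzL.trans hLρ⟩
    have ew := hW v hv
    have e1 : inner ℝ (γ v) (lam v - lam q) = inner ℝ (γ v) (x v - z) - inner ℝ (γ v) (x q - z) -
        inner ℝ (γ v) (w v - w q) := by
      rw [← inner_sub_right, ← inner_sub_right, h.decomp v hv', h.decomp q hq]
      congr 1
      abel
    have e2 : ∀ y : Euc d, -inner ℝ (γ v) y ≤ ‖y‖ := fun y => by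
      have := abs_real_inner_le_norm (γ v) y
      rw [hgn, one_mul] at this
      linarith [neg_abs_le (inner ℝ (γ v) y)]
    have e3 : ‖x v - z‖ ≤ ‖lam v - lam q‖ + W + L := by
      have : x v - z = (lam v - lam q) + (w v - w q) + (x q - z) := by
        rw [h.decomp v hv', h.decomp q hq]; abel
      rw [this]
      exact (norm_add₃_le).trans (by gcongr)
    have e4 := e2 (x q - z)
    have e5 := e2 (w v - w q)
    have e6 := mul_le_mul_of_nonneg_left e3 hc0
    have e7 : c * (W + L) ≤ W + L := mul_le_of_le_one_left (by positivity) hc1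
    rw [e1]
    linarith
  have hint := h.integrable
  -- lower bound for the displacement
  have hlow : ∀ t ∈ Icc q r, a * ν.real (Ioc q t) ≤ ‖lam t - lam q‖ := by
    intro t ht
    have e1 : inner ℝ u (lam t - lam q) = ∫ v in Ioc q t, inner ℝ u (γ v) ∂ν := by
      rw [h.incr q hq t (hvT t ht) ht.1, integral_inner hint.integrableOn]
    have e2 : ∫ _ in Ioc q t, a ∂ν ≤ ∫ v in Ioc q t, inner ℝ u (γ v) ∂ν := by
      refine setIntegral_mono_ae_restrict integrableOn_const (hint.const_inner u).integrableOn ?_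
      rw [EventuallyLE, ae_restrict_iff' measurableSet_Ioc]
      filter_upwards [hdir] with v hv hvt
      rw [real_inner_comm]
      exact (hv ⟨hvt.1, hvt.2.trans ht.2⟩).1
    rw [setIntegral_const, smul_eq_mul, ← e1] at e2
    calc a * ν.real (Ioc q t) ≤ inner ℝ u (lam t - lam q) := by linarith
      _ ≤ ‖u‖ * ‖lam t - lam q‖ := real_inner_le_norm _ _
      _ ≤ ‖lam t - lam q‖ := mul_le_of_le_one_left (norm_nonneg _) hu
  -- integration by parts
  have hparts : ∀ t ∈ Icc q r, ∀ G : ℝ → ℝ, IntegrableOn G (Ioc q t) ν →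
      (∀ v ∈ Ioc q t, c * ‖lam v - lam q‖ + κ ≤ G v) →
      ‖lam t - lam q‖ ^ 2 ≤ 2 * ∫ v in Ioc q t, G v ∂ν := by
    intro t ht G hG hle
    have e1 := norm_sq_integral_le (P := ν.restrict (Ioc q t)) hint.integrableOn
    rw [← h.incr q hq t (hvT t ht) ht.1] at e1
    refine e1.trans (mul_le_mul_of_nonneg_left ?_ zero_le_two)
    have e2 : ∀ᵐ v ∂ν.restrict (Ioc q t),
        inner ℝ (γ v) (∫ s in Iic v, γ s ∂ν.restrict (Ioc q t)) ≤ G v ∧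
        |inner ℝ (γ v) (∫ s in Iic v, γ s ∂ν.restrict (Ioc q t))| ≤ m := by
      rw [ae_restrict_iff' measurableSet_Ioc]
      filter_upwards [hdir, h.graph] with v hv hg hvt
      have hgn : ‖γ v‖ = 1 := hg.2
      have hvr : v ∈ Icc q r := ⟨hvt.1.le, hvt.2.trans ht.2⟩
      have e3 : ∫ s in Iic v, γ s ∂ν.restrict (Ioc q t) = lam v - lam q := by
        rw [Measure.restrict_restrict measurableSet_Iic, inter_comm, Ioc_inter_Iic,
          min_eq_right hvt.2, ← h.incr q hq v (hvT v hvr) hvt.1.le]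
      rw [e3]
      refine ⟨(hv ⟨hvt.1, hvr.2⟩).2.trans (hle v hvt), ?_⟩
      refine (abs_real_inner_le_norm _ _).trans ?_
      rw [hgn, one_mul]
      exact (h.norm_incr_le hq (hvT v hvr) hvt.1.le).trans
        (measureReal_mono (Ioc_subset_Ioc_right hvr.2))
    by_cases hI : Integrable (fun v => inner ℝ (γ v) (∫ s in Iic v, γ s ∂ν.restrict (Ioc q t)))
        (ν.restrict (Ioc q t))
    · exact integral_mono_ae hI hG (e2.mono fun v hv => hv.1)
    · rw [integral_undef hI]
      refine setIntegral_nonneg measurableSet_Ioc fun v hv => le_trans ?_ (hle v hv)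
      positivity
  have hbd : ∀ v ∈ Icc q r, ‖lam v - lam q‖ ≤ m := fun v hv =>
    (h.norm_incr_le hq (hvT v hv) hv.1).trans (measureReal_mono (Ioc_subset_Ioc_right hv.2))
  have hrmem : r ∈ Icc q r := ⟨hqr, le_rfl⟩
  set S : Set ℝ := (fun v => ‖lam v - lam q‖) '' Icc q r with hS
  have hSne : S.Nonempty := ⟨_, mem_image_of_mem _ hrmem⟩
  have hSb : BddAbove S := ⟨m, by rintro _ ⟨v, hv, rfl⟩; exact hbd v hv⟩
  have hM : ∀ v ∈ Icc q r, ‖lam v - lam q‖ ≤ sSup S := fun v hv =>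
    le_csSup hSb (mem_image_of_mem _ hv)
  have hM0 : 0 ≤ sSup S := (norm_nonneg _).trans (hM r hrmem)
  have hfinal := mass_le_of_quadratic (M := sSup S) ha₀ ha he₀ he₁ hce hc1 hκ0 hJ0
    (measureReal_nonneg : 0 ≤ m) ((hlow r hrmem).trans (hM r hrmem)) ?_ ?_
  · rw [hκ] at hfinal
    linarith
  · -- the square of the mass
    have hmono : Measurable fun v => ν.real (Ioc q v) :=
      Monotone.measurable fun s t hst => measureReal_mono (Ioc_subset_Ioc_right hst)
    have hI : IntegrableOn (fun v => ν.real (Ioc q v)) (Ioc q r) ν := by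
      refine Integrable.of_bound hmono.aestronglyMeasurable (ν.real univ) (ae_of_all _ fun v => ?_)
      rw [Real.norm_of_nonneg measureReal_nonneg]
      exact measureReal_mono (subset_univ _)
    have e1 := hparts r hrmem (fun v => c * ν.real (Ioc q v) + κ)
      ((hI.const_mul c).add integrableOn_const) fun v hv => by
        have := h.norm_incr_le hq (hvT v ⟨hv.1.le, hv.2⟩) hv.1.le
        gcongr
    have e2 := two_mul_integral_measureReal_Iic_le (P := ν.restrict (Ioc q r)) (J := J) (by
      rw [ae_restrict_iff' measurableSet_Ioc]
      refine ae_of_all _ fun v hv => le_trans ?_ (hJ v hv)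
      rw [measureReal_restrict_apply (measurableSet_singleton v)]
      exact measureReal_mono inter_subset_left)
    have e3 : ∫ v in Ioc q r, (ν.restrict (Ioc q r)).real (Iic v) ∂ν =
        ∫ v in Ioc q r, ν.real (Ioc q v) ∂ν := by
      refine setIntegral_congr_fun measurableSet_Ioc fun v hv => ?_
      rw [measureReal_restrict_apply measurableSet_Iic, inter_comm, Ioc_inter_Iic,
        min_eq_right hv.2]
    rw [e3, measureReal_restrict_apply_univ] at e2
    rw [integral_add (hI.const_mul c) integrableOn_const, integral_const_mul, setIntegral_const,
      smul_eq_mul] at e1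
    have e4 : (a * m) ^ 2 ≤ ‖lam r - lam q‖ ^ 2 :=
      pow_le_pow_left₀ (mul_nonneg ha'.le measureReal_nonneg) (hlow r hrmem) 2
    have e5 := mul_le_mul_of_nonneg_left e2 hc0
    linarith
  · -- the supremum of the displacement
    have hle : ∀ t ∈ Icc q r, ‖lam t - lam q‖ ^ 2 ≤ 2 * (c * sSup S + κ) * m := by
      intro t ht
      have e1 := hparts t ht (fun _ => c * sSup S + κ) integrableOn_const fun v hv => by
        have := hM v ⟨hv.1.le, hv.2.trans ht.2⟩
        gcongr
      rw [setIntegral_const, smul_eq_mul] at e1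
      have e2 : ν.real (Ioc q t) ≤ m := measureReal_mono (Ioc_subset_Ioc_right ht.2)
      have e3 : 0 ≤ c * sSup S + κ := by positivity
      have e4 := mul_le_mul_of_nonneg_right e2 e3
      linarith
    rw [← Real.le_sqrt hM0 (by positivity)]
    refine csSup_le hSne ?_
    rintro _ ⟨t, ht, rfl⟩
    exact Real.le_sqrt_of_sq_le (hle t ht)

end IsReflectedPath

/-- The constant of the modulus estimate: one local estimate, and a jump at either end. -/
noncomputable def modulusConst (a₀ e₀ : ℝ) : ℝ := 6 / ((1 - e₀) ^ 2 * a₀ ^ 2) + 4 / (1 - e₀)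

theorem modulusConst_nonneg {a₀ e₀ : ℝ} (he₁ : e₀ < 1) : 0 ≤ modulusConst a₀ e₀ := by
  have := sub_pos.2 he₁
  unfold modulusConst
  positivity

namespace IsReflectedPath

variable {d : ℕ} {T ρ η a₀ e₀ : ℝ} {D : Set (ℝ × Euc d)} {Γ : ℝ → Euc d → Set (Euc d)}
  {w x lam : ℝ → Euc d} {ν : Measure ℝ} {γ : ℝ → Euc d}

/-- Being on the boundary is closed from the right, since the domain is relatively open. -/
theorem eventually_notMem_frontier (h : IsReflectedPath T ρ η a₀ e₀ D Γ w x lam ν γ) {q : ℝ}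
    (hq : q ∈ Ico 0 T) (hx : x q ∉ frontier (timeSection D q)) :
    ∀ᶠ v in 𝓝[>] q, x v ∉ frontier (timeSection D v) := by
  have hqT : q ∈ Icc 0 T := ⟨hq.1, hq.2.le⟩
  have hmem : x q ∈ timeSection D q := by
    by_contra hn
    refine hx ?_
    rw [(h.domain.isOpen_timeSection hqT).frontier_eq]
    exact ⟨h.mem_closure q hqT, hn⟩
  obtain ⟨D', hD', -, hDD'⟩ := h.domain.exists_open
  have hmem' : (q, x q) ∈ D' := by
    have : (q, x q) ∈ D := hmem
    rw [hDD'] at this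
    exact this.1
  have ht : Tendsto (fun v => (v, x v)) (𝓝[>] q) (𝓝 (q, x q)) :=
    (tendsto_nhdsWithin_of_tendsto_nhds tendsto_id).prodMk_nhds (h.x_cadlag.1 q hq)
  filter_upwards [ht (hD'.mem_nhds hmem'), Ioo_mem_nhdsGT hq.2] with v hv hvT
  have hvT' : v ∈ Icc 0 T := ⟨hq.1.trans hvT.1.le, hvT.2.le⟩
  rw [(h.domain.isOpen_timeSection hvT').frontier_eq]
  intro hv'
  refine hv'.2 (show (v, x v) ∈ D from ?_)
  rw [hDD']
  exact ⟨hv, hvT', mem_univ _⟩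

/-- The modulus estimate: on an interval on which the driving path oscillates little and the domain
varies little, the mass of the reflection is small. -/
theorem measureReal_Ioc_le (h : IsReflectedPath T ρ η a₀ e₀ D Γ w x lam ν γ)
    (hρ : 0 < ρ) (hη : 0 < η) (ha₀ : 0 < a₀) (he₀ : 0 ≤ e₀) (he₁ : e₀ < 1) {s t W L : ℝ}
    (hs : s ∈ Icc 0 T) (ht : t ∈ Icc 0 T) (hst : s ≤ t) (htη : t - s ≤ η)
    (hW0 : 0 ≤ W) (hL0 : 0 ≤ L)
    (hW : ∀ p ∈ Icc s t, ∀ q ∈ Icc s t, ‖w p - w q‖ ≤ W)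
    (hL : timeModulus T D (t - s) < ENNReal.ofReal L)
    (hsmall : (modulusConst a₀ e₀ + 1) * (W + L) < ρ / 2) :
    ν.real (Ioc s t) ≤ modulusConst a₀ e₀ * (W + L) := by
  have hfin := h.finite
  have he := sub_pos.2 he₁
  set C := modulusConst a₀ e₀ with hC
  have hC0 : 0 ≤ C := modulusConst_nonneg he₁
  set J := 2 * W / (1 - e₀) with hJdef
  have hJ0 : 0 ≤ J := by positivity
  set K := 6 * (W + L) / ((1 - e₀) ^ 2 * a₀ ^ 2) with hKdef
  have hK0 : 0 ≤ K := by positivity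
  have hCJK : 2 * J + K ≤ C * (W + L) := by
    have : C * (W + L) = K + 4 * (W + L) / (1 - e₀) := by
      rw [hC, hKdef, modulusConst]; ring
    rw [this]
    have : 2 * J ≤ 4 * (W + L) / (1 - e₀) := by
      rw [hJdef, ← mul_div_assoc]
      exact div_le_div_of_nonneg_right (by linarith) he.le
    linarith
  have hstT : ∀ v ∈ Icc s t, v ∈ Icc 0 T := fun v hv => ⟨hs.1.trans hv.1, hv.2.trans ht.2⟩
  have hLρ : L ≤ ρ := by nlinarith
  have hJ : ∀ v ∈ Ioc s t, ν.real {v} ≤ J := by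
    intro v hv
    refine h.measureReal_singleton_le hρ hη ha₀ he₀ he₁
      ⟨hs.1.trans_lt hv.1, hv.2.trans ht.2⟩ ?_
    filter_upwards [Ioo_mem_nhdsLT hv.1] with p hp
    exact hW v ⟨hv.1.le, hv.2⟩ p ⟨hp.1.le, hp.2.le.trans hv.2⟩
  -- intervals without visits to the boundary carry no mass
  have hzero : ∀ q ∈ Icc s t, (∀ v ∈ Ioo s q, x v ∉ frontier (timeSection D v)) →
      ν (Ioo s q) = 0 := by
    intro q _ hv
    refine measure_mono_null (fun v hvq => ?_) h.graph
    exact fun hg => hv v hvq hg.1.2.1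
  -- the estimate up to a time before which `x` stays close to `x s`
  have hclaim : ∀ r ∈ Icc s t, (∀ v ∈ Ico s r, ‖x v - x s‖ < ρ / 2) →
      ν.real (Ioc s r) ≤ C * (W + L) := by
    intro r hr hxr
    refine le_trans ?_ hCJK
    rcases hr.1.eq_or_lt with rfl | hsr
    · simp only [Ioc_self, measureReal_empty]; positivity
    have hJr := hJ r ⟨hsr, hr.2⟩
    set Q : Set ℝ := {v | v ∈ Ico s r ∧ x v ∈ frontier (timeSection D v)} with hQ
    rcases Q.eq_empty_or_nonempty with hQe | hQne
    · have h0 := hzero r hr fun v hv hxv =>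
        (hQe ▸ (show v ∈ Q from ⟨⟨hv.1.le, hv.2⟩, hxv⟩) : v ∈ (∅ : Set ℝ))
      have h1 : ν.real (Ioc s r) ≤ ν.real (Ioo s r) + ν.real {r} := by
        rw [← Ioo_union_right hsr]
        exact measureReal_union_le _ _
      rw [measureReal_def ν (Ioo s r), h0, ENNReal.toReal_zero] at h1
      linarith
    have hQb : BddBelow Q := ⟨s, fun v hv => hv.1.1⟩
    set q := sInf Q with hqdef
    have hsq : s ≤ q := le_csInf hQne fun v hv => hv.1.1
    have hqr : q < r := by
      obtain ⟨v, hv⟩ := hQne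
      exact (csInf_le hQb hv).trans_lt hv.1.2
    have hqT : q ∈ Ico 0 T := ⟨hs.1.trans hsq, hqr.trans_le (hr.2.trans ht.2)⟩
    have hqQ : q ∈ Q := by
      refine csInf_mem_of_eventually_notMem hQne hQb fun hn => ?_
      have := h.eventually_notMem_frontier hqT fun hx => hn ⟨⟨hsq, hqr⟩, hx⟩
      exact this.mono fun v hv hvQ => hv hvQ.2
    have hqst : q ∈ Icc s t := ⟨hsq, hqr.le.trans hr.2⟩
    have h0 : ν (Ioo s q) = 0 := hzero q hqst fun v hv hxv =>
      absurd (csInf_le hQb ⟨⟨hv.1.le, hv.2.trans hqr⟩, hxv⟩) (not_le.2 hv.2)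
    have h1 : ν.real ({q} ∩ Ioi s) ≤ J := by
      by_cases hqs : s < q
      · exact (measureReal_mono inter_subset_left).trans (hJ q ⟨hqs, hqst.2⟩)
      · have : {q} ∩ Ioi s = ∅ := by
          rw [singleton_inter_eq_empty]; exact hqs
        rw [this, measureReal_empty]
        exact hJ0
    have h2 : ν.real (Ioo q r) ≤ K := by
      have : ν (Ioo q r) ≤ ENNReal.ofReal K := by
        refine measure_le_of_forall_inter_Iic_le measurableSet_Ioo fun v hv => ?_
        have hvst : v ∈ Icc s t := ⟨hsq.trans hv.1.le, hv.2.le.trans hr.2⟩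
        have hloc := h.measureReal_Ioc_le_of_mem_frontier ha₀ he₀ he₁ (q := q) (r := v)
          (W := W) (L := L) (J := J) (hstT q hqst) (hstT v hvst) hv.1.le
          (by linarith [hvst.2]) hqQ.2 (fun p hp => ?_) hW0 hL0 hJ0
          (fun p hp => hW p ⟨hsq.trans hp.1.le, hp.2.trans hvst.2⟩ q hqst) ?_ hLρ
          (fun p hp => hJ p ⟨hsq.trans_lt hp.1, hp.2.trans hvst.2⟩)
        · have hsub : Ioo q r ∩ Iic v ⊆ Ioc q v := fun p hp => ⟨hp.1.1, hp.2⟩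
          refine (measure_mono hsub).trans ?_
          rw [← ofReal_measureReal]
          refine ENNReal.ofReal_le_ofReal ?_
          rw [hKdef, le_div_iff₀ (by positivity)]
          have h6 : J * (1 - e₀) = 2 * W := by
            rw [hJdef]; field_simp
          calc ν.real (Ioc q v) * ((1 - e₀) ^ 2 * a₀ ^ 2)
              = (1 - e₀) * ((1 - e₀) * a₀ ^ 2 * ν.real (Ioc q v)) := by ring
            _ ≤ (1 - e₀) * (J + 4 * (W + L)) := by gcongr
            _ ≤ 6 * (W + L) := by nlinarith [mul_nonneg he₀ hW0, mul_nonneg he₀ hL0]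
        · have e1 := hxr p ⟨hsq.trans hp.1.le, hp.2.trans_lt hv.2⟩
          have e2 := hxr q ⟨hsq, hqr⟩
          have e3 := norm_sub_le_norm_sub_add_norm_sub (x p) (x s) (x q)
          rw [norm_sub_rev (x s)] at e3
          linarith
        · refine lt_of_le_of_lt ?_ hL
          exact iSup₂_mono fun _ _ => iSup₂_mono fun _ _ => iSup_mono' fun hle =>
            ⟨hle.trans (by linarith [hvst.2]), le_rfl⟩
      exact ENNReal.toReal_le_of_le_ofReal hK0 this
    have hcov : Ioc s r ⊆ Ioo s q ∪ ({q} ∩ Ioi s) ∪ Ioo q r ∪ {r} := by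
      intro v hv
      rcases lt_trichotomy v q with hvq | rfl | hvq
      · exact Or.inl (Or.inl (Or.inl ⟨hv.1, hvq⟩))
      · exact Or.inl (Or.inl (Or.inr ⟨rfl, hv.1⟩))
      · rcases hv.2.eq_or_lt with rfl | hvr
        · exact Or.inr rfl
        · exact Or.inl (Or.inr ⟨hvq, hvr⟩)
    have h3 : ν.real (Ioc s r) ≤
        ν.real (Ioo s q) + ν.real ({q} ∩ Ioi s) + ν.real (Ioo q r) + ν.real {r} := by
      refine (measureReal_mono hcov).trans ((measureReal_union_le _ _).trans ?_)
      gcongr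
      refine (measureReal_union_le _ _).trans ?_
      gcongr
      exact measureReal_union_le _ _
    rw [measureReal_def ν (Ioo s q), h0, ENNReal.toReal_zero] at h3
    linarith
  -- `x` cannot leave the neighbourhood of `x s`
  have hstay : ∀ v ∈ Icc s t, ‖x v - x s‖ < ρ / 2 := by
    by_contra hn
    push Not at hn
    set A : Set ℝ := {v | v ∈ Icc s t ∧ ρ / 2 ≤ ‖x v - x s‖} with hA
    have hAne : A.Nonempty := hn
    have hAb : BddBelow A := ⟨s, fun v hv => hv.1.1⟩
    have hsσ : s ≤ sInf A := le_csInf hAne fun v hv => hv.1.1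
    have hσA : sInf A ∈ A := by
      refine csInf_mem_of_eventually_notMem hAne hAb fun hn => ?_
      obtain ⟨v, hv⟩ := hAne
      have hlt : sInf A < v := lt_of_le_of_ne (csInf_le hAb hv) fun e => hn (e ▸ hv)
      have hσ : ‖x (sInf A) - x s‖ < ρ / 2 := by
        by_contra hge
        exact hn ⟨⟨hsσ, hlt.le.trans hv.1.2⟩, not_lt.1 hge⟩
      have hc := ((h.x_cadlag.1 (sInf A) ⟨hs.1.trans hsσ,
        hlt.trans_le (hv.1.2.trans ht.2)⟩).sub_const (x s)).norm
      exact (hc.eventually (gt_mem_nhds hσ)).mono fun p hp hpA => absurd hpA.2 (not_le.2 hp)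
    have hσ := hclaim _ hσA.1 fun v hv => by
      by_contra hge
      exact absurd (csInf_le hAb ⟨⟨hv.1, hv.2.le.trans hσA.1.2⟩, not_lt.1 hge⟩) (not_le.2 hv.2)
    have hσT := hstT _ hσA.1
    have e1 : x (sInf A) - x s = (w (sInf A) - w s) + (lam (sInf A) - lam s) := by
      rw [h.decomp _ hσT, h.decomp s hs]; abel
    have e2 : ‖x (sInf A) - x s‖ ≤ W + C * (W + L) := by
      rw [e1]
      refine (norm_add_le _ _).trans (add_le_add (hW _ hσA.1 s ⟨le_rfl, hst⟩) ?_)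
      exact (h.norm_incr_le hs hσT hσA.1.1).trans hσ
    have := hσA.2
    linarith
  exact hclaim t ⟨hst, le_rfl⟩ fun v hv => hstay v ⟨hv.1, hv.2.le⟩

end IsReflectedPath

/-! ### Uniform coefficient bounds -/

/-- The choice of constants: the supremum over `u` in `aCoeff` need not be attained, and the room
between `e₁` and `1` pays for a direction `u` that attains it up to a factor. -/
theorem coeffBound_of_aCoeff_eCoeff {d : ℕ} {T ρ η α e₁ : ℝ} {D : Set (ℝ × Euc d)}
    {Γ : ℝ → Euc d → Set (Euc d)} (hα : 0 < α) (hα1 : α ≤ 1) (he₁ : 0 ≤ e₁) (he₁' : e₁ < 1)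
    (ha : ∀ s ∈ Icc 0 T, ∀ z ∈ frontier (timeSection D s), (α : EReal) ≤ aCoeff D Γ ρ η s z)
    (he : ∀ s ∈ Icc 0 T, ∀ z ∈ frontier (timeSection D s), eCoeff D Γ ρ η s z ≤ (e₁ : EReal)) :
    CoeffBound T ρ η ((1 - (1 - e₁) / 4) * α) ((1 + e₁) / 2) D Γ := by
  intro s hs z hz
  set θ := 1 - (1 - e₁) / 4 with hθ
  have hθ0 : 0 < θ := by linarith
  have hθ1 : θ < 1 := by linarith
  by_cases hidx : ∃ t ∈ Icc s (s + η), ∃ y ∈ frontier (timeSection D t) ∩ Metric.closedBall z ρ,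
      (unitCone Γ t y).Nonempty
  swap
  · refine ⟨0, 1, 0, by simp, by nlinarith, le_rfl, le_rfl, by positivity, fun t ht y hy g hg => ?_⟩
    exact absurd ⟨t, ht, y, hy, g, hg⟩ hidx
  set A := aCoeff D Γ ρ η s z with hA
  have hαA : (α : EReal) ≤ A := ha s hs z hz
  have hA1 : A ≤ 1 := by
    obtain ⟨t, ht, y, hy, g, hg⟩ := hidx
    refine iSup₂_le fun u hu => ?_
    refine (iInf₂_le_of_le t ht <| iInf₂_le_of_le y hy <| iInf₂_le g hg).trans ?_
    have h1 := real_inner_le_norm g u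
    have hg1 : ‖g‖ = 1 := by simpa using hg.2
    have hu1 : ‖u‖ = 1 := by simpa using hu
    rw [hg1, hu1, one_mul] at h1
    exact_mod_cast h1
  obtain ⟨A', hA'⟩ : ∃ A' : ℝ, A = (A' : EReal) := by
    refine ⟨A.toReal, (EReal.coe_toReal ?_ ?_).symm⟩
    · intro h
      rw [h, top_le_iff] at hA1
      exact EReal.coe_ne_top 1 (by rw [EReal.coe_one]; exact hA1)
    · exact fun h => by simp [h] at hαA
  rw [hA'] at hαA hA1
  have hαA' : α ≤ A' := by exact_mod_cast hαA
  have hA1' : A' ≤ 1 := by exact_mod_cast hA1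
  have hA0 : 0 < A' := hα.trans_le hαA'
  set M := max (A' ^ 2) (A' / 2) with hM
  have hM0 : 0 < M := lt_max_of_lt_right (by positivity)
  have hMcast : max (A ^ 2) (A / 2) = (M : EReal) := by
    have h2 : A / 2 = ((A' / 2 : ℝ) : EReal) := by
      rw [hA', EReal.coe_div]; rfl
    rw [h2, hA', hM, EReal.coe_strictMono.monotone.map_max, EReal.coe_pow]
  have hC : cCoeff D Γ ρ η s z ≤ ((e₁ * M : ℝ) : EReal) := by
    have h1 := he s hs z hz
    rw [eCoeff, ← hA, hMcast, EReal.div_le_iff_le_mul (by exact_mod_cast hM0)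
      (EReal.coe_ne_top _)] at h1
    rw [mul_comm, EReal.coe_mul]
    exact h1
  have hlt : ((θ * A' : ℝ) : EReal) < A := by
    rw [hA']
    exact_mod_cast mul_lt_of_lt_one_left hA0 hθ1
  rw [hA, aCoeff] at hlt
  obtain ⟨u, hlt⟩ := lt_iSup_iff.1 hlt
  obtain ⟨hu, hlt⟩ := lt_iSup_iff.1 hlt
  refine ⟨u, θ * A', e₁ * M, by simpa using hu.le, by gcongr, ?_, by positivity, ?_,
    fun t ht y hy g hg => ⟨?_, fun z' hz' => ?_⟩⟩
  · exact (mul_le_of_le_one_left hA0.le hθ1.le).trans hA1'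
  · have h1 : θ ^ 2 * M ≤ max ((θ * A') ^ 2) (θ * A' / 2) := by
      rcases max_choice (A' ^ 2) (A' / 2) with h | h
      · rw [hM, h]
        exact le_max_of_le_left (by rw [mul_pow])
      · rw [hM, h]
        refine le_max_of_le_right ?_
        nlinarith [mul_pos (mul_pos hθ0 hA0) (sub_pos.2 hθ1)]
    have h2 : e₁ ≤ (1 + e₁) / 2 * θ ^ 2 := by
      rw [hθ]
      nlinarith [sq_nonneg (1 - e₁)]
    calc e₁ * M ≤ ((1 + e₁) / 2 * θ ^ 2) * M := by gcongr
      _ = (1 + e₁) / 2 * (θ ^ 2 * M) := by ring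
      _ ≤ _ := by gcongr
  · have h1 : ((θ * A' : ℝ) : EReal) ≤ ((inner ℝ g u : ℝ) : EReal) :=
      hlt.le.trans (iInf₂_le_of_le t ht <| iInf₂_le_of_le y hy <| iInf₂_le g hg)
    exact_mod_cast h1
  · rcases eq_or_ne z' y with rfl | hne
    · simp
    have hn : 0 < ‖y - z'‖ := norm_pos_iff.2 (sub_ne_zero.2 hne.symm)
    have h1 : ((max (inner ℝ g (y - z') / ‖y - z'‖) 0 : ℝ) : EReal) ≤ ((e₁ * M : ℝ) : EReal) := by
      refine le_trans ?_ hC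
      refine le_max_of_le_right ?_
      exact le_iSup₂_of_le t ht <| le_iSup₂_of_le y hy <| le_iSup₂_of_le z' ⟨hz', hne⟩ <|
        le_iSup₂ (f := fun γ (_ : γ ∈ unitCone Γ t y) =>
          ((max (inner ℝ γ (y - z') / ‖y - z'‖) 0 : ℝ) : EReal)) g hg
    have h2 : max (inner ℝ g (y - z') / ‖y - z'‖) 0 ≤ e₁ * M := by exact_mod_cast h1
    exact (div_le_iff₀ hn).1 ((le_max_left _ _).trans h2)

theorem exists_coeffBound {d : ℕ} {T ρ η : ℝ} {Dn : ℕ → Set (ℝ × Euc d)}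
    {Γn : ℕ → ℝ → Euc d → Set (Euc d)}
    (ha : 0 < ⨅ n, ⨅ s ∈ Icc 0 T, ⨅ z ∈ frontier (timeSection (Dn n) s),
      aCoeff (Dn n) (Γn n) ρ η s z)
    (he : (⨆ n, ⨆ s ∈ Icc 0 T, ⨆ z ∈ frontier (timeSection (Dn n) s),
      eCoeff (Dn n) (Γn n) ρ η s z) < 1) :
    ∃ a₀ e₀ : ℝ, 0 < a₀ ∧ 0 ≤ e₀ ∧ e₀ < 1 ∧ ∀ n, CoeffBound T ρ η a₀ e₀ (Dn n) (Γn n) := by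
  obtain ⟨α, hα0, hα⟩ := EReal.lt_iff_exists_real_btwn.1 ha
  obtain ⟨e, he0, he1⟩ := EReal.lt_iff_exists_real_btwn.1 he
  have hα0 : 0 < α := by exact_mod_cast hα0
  have he1 : e < 1 := by exact_mod_cast he1
  have hmax : max e 0 < 1 := max_lt he1 one_pos
  have hmax0 : 0 ≤ max e 0 := le_max_right _ _
  have hm : 0 < min α 1 := lt_min hα0 one_pos
  refine ⟨_, _, ?_, ?_, ?_, fun n => coeffBound_of_aCoeff_eCoeff (α := min α 1) (e₁ := max e 0)
    hm (min_le_right _ _) hmax0 hmax (fun s hs z hz => ?_) fun s hs z hz => ?_⟩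
  · exact mul_pos (by linarith) hm
  · linarith
  · linarith
  · refine le_trans ?_ (hα.le.trans (iInf_le_of_le n <| iInf₂_le_of_le s hs <| iInf₂_le z hz))
    exact_mod_cast min_le_left _ _
  · refine le_trans ((le_iSup_of_le n <| le_iSup₂_of_le s hs <| le_iSup₂
      (f := fun z (_ : z ∈ frontier (timeSection (Dn n) s)) => eCoeff (Dn n) (Γn n) ρ η s z)
      z hz).trans he0.le) ?_
    exact_mod_cast le_max_left _ _

/-! ### Time changes and uniform convergence -/

/-- The inverse of a time change, as a function on the line. -/
noncomputable def invTime {T : ℝ} (θ : Icc (0 : ℝ) T ≃o Icc (0 : ℝ) T) (t : ℝ) : ℝ :=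
  open Classical in if ht : t ∈ Icc 0 T then (θ.symm ⟨t, ht⟩ : ℝ) else t

section invTime

variable {T : ℝ} (θ : Icc (0 : ℝ) T ≃o Icc (0 : ℝ) T)

theorem invTime_of_mem {t : ℝ} (ht : t ∈ Icc 0 T) : invTime θ t = θ.symm ⟨t, ht⟩ := dif_pos ht

theorem invTime_apply (s : Icc (0 : ℝ) T) : invTime θ (θ s) = s := by
  rw [invTime_of_mem θ (θ s).2]
  simp

theorem apply_invTime {t : ℝ} (ht : t ∈ Icc 0 T) (h : invTime θ t ∈ Icc 0 T) :
    (θ ⟨invTime θ t, h⟩ : ℝ) = t := by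
  simp [invTime_of_mem θ ht]

theorem invTime_mem {t : ℝ} (ht : t ∈ Icc 0 T) : invTime θ t ∈ Icc 0 T := by
  rw [invTime_of_mem θ ht]
  exact Subtype.coe_prop _

theorem strictMonoOn_invTime : StrictMonoOn (invTime θ) (Icc 0 T) := by
  intro s hs t ht hst
  rw [invTime_of_mem θ hs, invTime_of_mem θ ht]
  exact θ.symm.strictMono (show (⟨s, hs⟩ : Icc (0 : ℝ) T) < ⟨t, ht⟩ from hst)

theorem exists_invTime_eq {s : ℝ} (hs : s ∈ Icc 0 T) : ∃ t ∈ Icc 0 T, invTime θ t = s :=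
  ⟨θ ⟨s, hs⟩, (θ ⟨s, hs⟩).2, invTime_apply θ ⟨s, hs⟩⟩

theorem invTime_zero (hT : 0 ≤ T) : invTime θ 0 = 0 := by
  obtain ⟨t, ht, h0⟩ := exists_invTime_eq θ (⟨le_rfl, hT⟩ : (0 : ℝ) ∈ Icc 0 T)
  have h1 := (strictMonoOn_invTime θ).monotoneOn ⟨le_rfl, hT⟩ ht ht.1
  exact le_antisymm (h1.trans h0.le) (invTime_mem θ ⟨le_rfl, hT⟩).1

theorem invTime_T (hT : 0 ≤ T) : invTime θ T = T := by
  obtain ⟨t, ht, h0⟩ := exists_invTime_eq θ (⟨hT, le_rfl⟩ : T ∈ Icc 0 T)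
  have h1 := (strictMonoOn_invTime θ).monotoneOn ht ⟨hT, le_rfl⟩ ht.2
  exact le_antisymm (invTime_mem θ ⟨hT, le_rfl⟩).2 (h0.symm.le.trans h1)

end invTime

/-- The paths `xs n`, run with the inverse time changes, converge to `x` uniformly on `[0, T]`. -/
def ConvergesAlong {E : Type*} [PseudoMetricSpace E] (T : ℝ)
    (θ : ℕ → (Icc (0 : ℝ) T ≃o Icc (0 : ℝ) T)) (xs : ℕ → ℝ → E) (x : ℝ → E) : Prop :=
  ∀ ε > 0, ∀ᶠ n in atTop, ∀ t ∈ Icc 0 T, dist (xs n (invTime (θ n) t)) (x t) ≤ ε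

theorem convergesAlong_iff {E : Type*} [PseudoMetricSpace E] {T : ℝ}
    {θ : ℕ → (Icc (0 : ℝ) T ≃o Icc (0 : ℝ) T)} {xs : ℕ → ℝ → E} {x : ℝ → E} :
    ConvergesAlong T θ xs x ↔
      Tendsto (fun n => ⨆ t : Icc (0 : ℝ) T, edist (xs n t) (x (θ n t))) atTop (𝓝 0) := by
  rw [ENNReal.tendsto_nhds_zero]
  constructor
  · intro h ε hε
    rcases eq_or_ne ε ⊤ with rfl | hε'
    · exact Eventually.of_forall fun _ => le_top
    filter_upwards [h ε.toReal (ENNReal.toReal_pos hε.ne' hε')] with n hn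
    refine iSup_le fun t => ?_
    have := hn (θ n t) (θ n t).2
    rw [invTime_apply] at this
    rw [edist_dist]
    exact ENNReal.ofReal_le_of_le_toReal this
  · intro h ε hε
    filter_upwards [h (ENNReal.ofReal ε) (ENNReal.ofReal_pos.2 hε)] with n hn t ht
    have := (le_iSup (fun t : Icc (0 : ℝ) T => edist (xs n t) (x (θ n t)))
      ⟨invTime (θ n) t, invTime_mem (θ n) ht⟩).trans hn
    rw [apply_invTime (θ n) ht, edist_dist, ENNReal.ofReal_le_ofReal_iff hε.le] at this
    exact this

theorem skorohodTendsto_iff {d : ℕ} {T : ℝ} {xs : ℕ → ℝ → Euc d} {x : ℝ → Euc d} :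
    SkorohodTendsto T xs x ↔ ∃ θ : ℕ → (Icc (0 : ℝ) T ≃o Icc (0 : ℝ) T),
      ConvergesAlong T θ (fun _ => id) (id : ℝ → ℝ) ∧ ConvergesAlong T θ xs x := by
  refine exists_congr fun θ => and_congr ?_ convergesAlong_iff.symm
  rw [convergesAlong_iff]
  simp only [id, edist_comm]

namespace ConvergesAlong

variable {E : Type*} {T : ℝ} {θ : ℕ → (Icc (0 : ℝ) T ≃o Icc (0 : ℝ) T)}

theorem tendsto [PseudoMetricSpace E] {xs : ℕ → ℝ → E} {x : ℝ → E}
    (h : ConvergesAlong T θ xs x) {t : ℝ} (ht : t ∈ Icc 0 T) :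
    Tendsto (fun n => xs n (invTime (θ n) t)) atTop (𝓝 (x t)) := by
  rw [Metric.tendsto_nhds]
  intro ε hε
  filter_upwards [h (ε / 2) (half_pos hε)] with n hn
  linarith [hn t ht]

theorem sub [SeminormedAddCommGroup E] {xs ys : ℕ → ℝ → E} {x y : ℝ → E}
    (hx : ConvergesAlong T θ xs x) (hy : ConvergesAlong T θ ys y) :
    ConvergesAlong T θ (fun n t => xs n t - ys n t) fun t => x t - y t := by
  intro ε hε
  filter_upwards [hx (ε / 2) (half_pos hε), hy (ε / 2) (half_pos hε)] with n h1 h2 t ht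
  refine (dist_sub_sub_le _ _ _ _).trans ?_
  linarith [h1 t ht, h2 t ht]

theorem congr [PseudoMetricSpace E] {xs ys : ℕ → ℝ → E} {x y : ℝ → E}
    (hx : ConvergesAlong T θ xs x) (hxy : ∀ n, EqOn (xs n) (ys n) (Icc 0 T))
    (h : EqOn x y (Icc 0 T)) : ConvergesAlong T θ ys y := by
  intro ε hε
  filter_upwards [hx ε hε] with n hn t ht
  rw [← hxy n (invTime_mem (θ n) ht), ← h ht]
  exact hn t ht

theorem comp_strictMono [PseudoMetricSpace E] {xs : ℕ → ℝ → E} {x : ℝ → E}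
    (h : ConvergesAlong T θ xs x) {ψ : ℕ → ℕ} (hψ : StrictMono ψ) :
    ConvergesAlong T (fun k => θ (ψ k)) (fun k => xs (ψ k)) x :=
  fun ε hε => hψ.tendsto_atTop.eventually (h ε hε)

end ConvergesAlong

/-- Limits in the Skorohod topology are unique. -/
theorem eqOn_of_convergesAlong {d : ℕ} {T : ℝ} (hT : 0 ≤ T)
    {θ θ' : ℕ → (Icc (0 : ℝ) T ≃o Icc (0 : ℝ) T)}
    {xs : ℕ → ℝ → Euc d} {x y : ℝ → Euc d} (hx : IsCadlag T x) (hy : IsCadlag T y)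
    (hid : ConvergesAlong T θ (fun _ => id) (id : ℝ → ℝ))
    (hid' : ConvergesAlong T θ' (fun _ => id) (id : ℝ → ℝ))
    (h : ConvergesAlong T θ xs x) (h' : ConvergesAlong T θ' xs y) : EqOn x y (Icc 0 T) := by
  -- transport the time `t` of `x` to the time `σ n t` of `y`
  set σ : ℕ → ℝ → ℝ := fun n t =>
    open Classical in
    if ht : t ∈ Icc 0 T then θ' n ⟨invTime (θ n) t, invTime_mem (θ n) ht⟩ else t with hσ
  have hσ1 : ∀ n, ∀ t ∈ Icc 0 T, σ n t ∈ Icc 0 T ∧ invTime (θ' n) (σ n t) = invTime (θ n) t := by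
    intro n t ht
    simp only [hσ, dif_pos ht]
    exact ⟨Subtype.coe_prop _, invTime_apply (θ' n) _⟩
  have hσt : ∀ t ∈ Icc 0 T, Tendsto (fun n => σ n t) atTop (𝓝 t) := by
    intro t ht
    rw [Metric.tendsto_nhds]
    intro ε hε
    filter_upwards [hid (ε / 3) (by positivity), hid' (ε / 3) (by positivity)] with n h1 h2
    have e1 := h1 t ht
    have e2 := h2 _ (hσ1 n t ht).1
    rw [(hσ1 n t ht).2] at e2
    simp only [id] at e1 e2
    have := dist_triangle_left (σ n t) t (invTime (θ n) t)
    linarith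
  have hclose : ∀ t ∈ Icc 0 T, Tendsto (fun n => dist (x t) (y (σ n t))) atTop (𝓝 0) := by
    intro t ht
    rw [Metric.tendsto_nhds]
    intro ε hε
    filter_upwards [h (ε / 3) (by positivity), h' (ε / 3) (by positivity)] with n h1 h2
    have e1 := h1 t ht
    have e2 := h2 _ (hσ1 n t ht).1
    rw [(hσ1 n t ht).2] at e2
    rw [Real.dist_eq, sub_zero, abs_of_nonneg dist_nonneg]
    have := dist_triangle_left (x t) (y (σ n t)) (xs n (invTime (θ n) t))
    linarith
  intro t ht
  rcases ht.2.eq_or_lt with rfl | htT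
  · have e1 := h.tendsto ht
    have e2 := h'.tendsto ht
    simp only [invTime_T _ hT] at e1 e2
    exact tendsto_nhds_unique e1 e2
  · refine eq_of_forall_dist_le fun ε hε => ?_
    -- compare at times slightly to the right of `t`
    have hyt := (hy.1 t ⟨ht.1, htT⟩).eventually (Metric.ball_mem_nhds _ hε)
    obtain ⟨u, hu, hsub⟩ := mem_nhdsGT_iff_exists_Ioo_subset.1 hyt
    have key : ∀ s ∈ Ioo t (min u T), dist (x s) (y t) ≤ ε := by
      intro s hs
      have hsT : s ∈ Icc 0 T := ⟨ht.1.trans hs.1.le, hs.2.le.trans (min_le_right _ _)⟩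
      have e1 := (hclose s hsT).add_const ε
      rw [zero_add] at e1
      refine ge_of_tendsto e1 ?_
      filter_upwards [(hσt s hsT).eventually
        (Ioo_mem_nhds hs.1 (hs.2.trans_le (min_le_left _ _)))] with n hn
      have e2 : dist (y (σ n s)) (y t) < ε := hsub hn
      linarith [dist_triangle (x s) (y (σ n s)) (y t)]
    refine le_of_tendsto ((hx.1 t ⟨ht.1, htT⟩).dist tendsto_const_nhds) ?_
    filter_upwards [Ioo_mem_nhdsGT (lt_min hu htT)] with s hs using key s hs

theorem oscLE_of_dist_le {E : Type*} [PseudoMetricSpace E] {T ε δ : ℝ} {F : Finset ℝ}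
    {x y : ℝ → E} (hx : OscLE T ε F x) (hxy : ∀ t ∈ Icc 0 T, dist (x t) (y t) ≤ δ) :
    OscLE T (ε + 2 * δ) F y := by
  intro s hs t ht hst hfree
  have e1 := hx s hs t ht hst hfree
  have e2 := hxy s hs
  have e3 := hxy t ht
  have e4 := dist_triangle4 (y s) (x s) (x t) (y t)
  rw [dist_comm (y s) (x s)] at e4
  linarith

/-- A bounded sequence of paths that eventually oscillate little on the pieces of one and the same
partition has a uniformly convergent subsequence: a diagonal subsequence converges at all partition
points, and there the paths are determined up to the oscillation. -/
theorem exists_subseq_uniform {d : ℕ} {T R : ℝ} {ys : ℕ → ℝ → Euc d}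
    (hR : ∀ n, ∀ t ∈ Icc 0 T, ‖ys n t‖ ≤ R)
    (hosc : ∀ ε > 0, ∃ F : Finset ℝ, ∀ᶠ n in atTop, OscLE T ε F (ys n)) :
    ∃ ψ : ℕ → ℕ, StrictMono ψ ∧ ∃ x : ℝ → Euc d, IsCadlag T x ∧
      ∀ ε > 0, ∀ᶠ k in atTop, ∀ t ∈ Icc 0 T, dist (ys (ψ k) t) (x t) ≤ ε := by
  classical
  choose F hF using fun k : ℕ => hosc _ (Nat.one_div_pos_of_nat (α := ℝ) (n := k))
  set Q : Set ℝ := (⋃ k, (F k : Set ℝ)) ∪ {0} with hQ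
  have hQc : Q.Countable :=
    (countable_iUnion fun k => (F k).countable_toSet).union (countable_singleton 0)
  have : Countable Q := hQc.to_subtype
  set a : ℕ → Q → Euc d := fun n q => if (q : ℝ) ∈ Icc 0 T then ys n q else 0 with ha
  have hcomp : IsCompact (Set.pi univ fun _ : Q => Metric.closedBall (0 : Euc d) (max R 0)) :=
    isCompact_univ_pi fun _ => isCompact_closedBall _ _
  obtain ⟨b, -, ψ, hψ, hlim⟩ := hcomp.tendsto_subseq (x := a) fun n q _ => by
    rw [mem_closedBall_zero_iff, ha]
    dsimp only
    split_ifs with hq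
    · exact (hR n q hq).trans (le_max_left _ _)
    · simp
  have hCauchy : UniformCauchySeqOn (fun k => ys (ψ k)) atTop (Icc 0 T) := by
    rw [Metric.uniformCauchySeqOn_iff]
    intro ε hε
    obtain ⟨k, hk⟩ := exists_nat_one_div_lt (by positivity : 0 < ε / 8)
    set G : Finset ℝ := insert 0 (F k) with hG
    have hGQ : ∀ q ∈ G, q ∈ Q := by
      intro q hq
      rcases Finset.mem_insert.1 hq with rfl | hq
      · exact Or.inr rfl
      · exact Or.inl (mem_iUnion.2 ⟨k, hq⟩)
    have e1 : ∀ᶠ j in atTop, ∀ q ∈ G, q ∈ Icc 0 T → ∀ hq : q ∈ Q,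
        dist (ys (ψ j) q) (b ⟨q, hq⟩) ≤ ε / 8 := by
      rw [Filter.eventually_all_finset]
      intro q hq
      have := (tendsto_pi_nhds.1 hlim) ⟨q, hGQ q hq⟩
      filter_upwards [this.eventually (Metric.closedBall_mem_nhds _ (by positivity : 0 < ε / 8))]
        with j hj hqT hqQ
      have hj' : dist (a (ψ j) ⟨q, hGQ q hq⟩) (b ⟨q, hGQ q hq⟩) ≤ ε / 8 := hj
      rw [ha] at hj'
      simpa [hqT.1, hqT.2] using hj'
    have e2 := hψ.tendsto_atTop.eventually (hF k)
    obtain ⟨N, hN⟩ := eventually_atTop.1 (e1.and e2)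
    refine ⟨N, fun m hm n hn t ht => ?_⟩
    have h3 := dist_le_of_oscLE (δ := ε / 8 + ε / 8) (Finset.mem_insert_self 0 (F k))
      (by positivity) ((hN m hm).2.mono (Finset.subset_insert _ _))
      ((hN n hn).2.mono (Finset.subset_insert _ _)) (fun q hq hqT => ?_) ht
    · linarith
    · have := (hN m hm).1 q hq hqT (hGQ q hq)
      have h4 := (hN n hn).1 q hq hqT (hGQ q hq)
      linarith [dist_triangle_right (ys (ψ m) q) (ys (ψ n) q) (b ⟨q, hGQ q hq⟩)]
  have hpt : ∀ t, ∃ y, t ∈ Icc 0 T → Tendsto (fun k => ys (ψ k) t) atTop (𝓝 y) := by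
    intro t
    by_cases ht : t ∈ Icc 0 T
    · obtain ⟨y, hy⟩ := cauchySeq_tendsto_of_complete (hCauchy.cauchySeq ht)
      exact ⟨y, fun _ => hy⟩
    · exact ⟨0, fun h => absurd h ht⟩
  choose x hx using hpt
  have hunif := hCauchy.tendstoUniformlyOn_of_tendsto (f := x) fun t ht => hx t ht
  have hconv : ∀ ε > 0, ∀ᶠ k in atTop, ∀ t ∈ Icc 0 T, dist (ys (ψ k) t) (x t) ≤ ε := by
    intro ε hε
    filter_upwards [Metric.tendstoUniformlyOn_iff.1 hunif ε hε] with k hk t ht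
    rw [dist_comm]
    exact (hk t ht).le
  refine ⟨ψ, hψ, x, isCadlag_of_oscLE fun ε hε => ?_, hconv⟩
  obtain ⟨G, hG⟩ := hosc (ε / 3) (by positivity)
  obtain ⟨k, hk1, hk2⟩ := ((hψ.tendsto_atTop.eventually hG).and
    (hconv (ε / 3) (by positivity))).exists
  refine ⟨G, ?_⟩
  have := oscLE_of_dist_le hk1 hk2
  convert this using 1
  ring

/-! ### Estimates that are uniform along a sequence of reflected paths -/

section Sequence

variable {d : ℕ} {T ρ η a₀ e₀ : ℝ} {Dn : ℕ → Set (ℝ × Euc d)} {Γn : ℕ → ℝ → Euc d → Set (Euc d)}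
  {wn xn lamn : ℕ → ℝ → Euc d} {νn : ℕ → Measure ℝ} {γn : ℕ → ℝ → Euc d}
  {θ : ℕ → (Icc (0 : ℝ) T ≃o Icc (0 : ℝ) T)} {w : ℝ → Euc d}

/-- Seen through the time changes of the driving paths, the reflections have little mass on the
pieces of one and the same partition. -/
theorem exists_finset_measureReal_le
    (h : ∀ n, IsReflectedPath T ρ η a₀ e₀ (Dn n) (Γn n) (wn n) (xn n) (lamn n) (νn n) (γn n))
    (hρ : 0 < ρ) (hη : 0 < η) (ha₀ : 0 < a₀) (he₀ : 0 ≤ e₀) (he₁ : e₀ < 1)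
    (hmod : Tendsto (fun r : ℝ => ⨆ n, timeModulus T (Dn n) r) (𝓝[>] 0) (𝓝 0))
    (hw : IsCadlag T w) (hid : ConvergesAlong T θ (fun _ => id) (id : ℝ → ℝ))
    (hwn : ConvergesAlong T θ wn w) {ε : ℝ} (hε : 0 < ε) :
    ∃ F : Finset ℝ, (0 : ℝ) ∈ F ∧ ∀ᶠ n in atTop, ∀ s ∈ Icc 0 T, ∀ t ∈ Icc 0 T, s < t →
      (∀ f ∈ F, f ∉ Ioc s t) →
      (νn n).real (Ioc (invTime (θ n) s) (invTime (θ n) t)) ≤ ε ∧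
      dist (xn n (invTime (θ n) s)) (xn n (invTime (θ n) t)) ≤ ε := by
  set C := modulusConst a₀ e₀ with hC
  have hC0 : 0 ≤ C := modulusConst_nonneg he₁
  obtain ⟨β, hβ0, hβρ, hβε⟩ : ∃ β > 0, (C + 1) * (β + β) < ρ / 2 ∧ (C + 1) * (β + β) ≤ ε := by
    have hm : 0 < min ρ ε := lt_min hρ hε
    refine ⟨min ρ ε / (8 * (C + 1)), by positivity, ?_, ?_⟩
    · have : (C + 1) * (min ρ ε / (8 * (C + 1)) + min ρ ε / (8 * (C + 1))) = min ρ ε / 4 := by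
        field_simp; ring
      rw [this]
      linarith [min_le_left ρ ε]
    · have : (C + 1) * (min ρ ε / (8 * (C + 1)) + min ρ ε / (8 * (C + 1))) = min ρ ε / 4 := by
        field_simp; ring
      rw [this]
      linarith [min_le_right ρ ε]
  have hmod' := hmod.eventually (gt_mem_nhds (ENNReal.ofReal_pos.2 hβ0))
  obtain ⟨r₀, hr₀, hsub⟩ := mem_nhdsGT_iff_exists_Ioo_subset.1 hmod'
  have hr₀ : 0 < r₀ := hr₀
  set δ := min η r₀ / 4 with hδ
  have hδ0 : 0 < δ := by
    have := lt_min hη hr₀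
    positivity
  obtain ⟨F₁, hF₁⟩ := hw.exists_oscLE (by positivity : 0 < β / 3)
  obtain ⟨F₂, hF₂⟩ := exists_oscLE_id T hδ0
  refine ⟨insert 0 (F₁ ∪ F₂), Finset.mem_insert_self _ _, ?_⟩
  filter_upwards [hid δ hδ0, hwn (β / 3) (by positivity)] with n hn1 hn2 s hs t ht hst hfree
  have hτ := strictMonoOn_invTime (θ n)
  set τ := invTime (θ n) with hτdef
  have hτs : τ s ∈ Icc 0 T := invTime_mem _ hs
  have hτt : τ t ∈ Icc 0 T := invTime_mem _ ht
  have hlt : τ s < τ t := hτ hs ht hst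
  have hlen : τ t - τ s < min η r₀ := by
    have e1 := hn1 s hs
    have e2 := hn1 t ht
    have e3 := hF₂ s hs t ht hst fun f hf => hfree f (by simp [hf])
    simp only [id, Real.dist_eq, abs_le] at e1 e2 e3
    have : min η r₀ = 4 * δ := by rw [hδ]; ring
    linarith [e1.1, e2.2, e3.1]
  have hoscw : ∀ p ∈ Icc s t, ∀ q ∈ Icc s t, dist (w p) (w q) ≤ β / 3 := by
    have key : ∀ p ∈ Icc s t, ∀ q ∈ Icc s t, p < q → dist (w p) (w q) ≤ β / 3 := by
      intro p hp q hq hpq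
      refine hF₁ p ⟨hs.1.trans hp.1, hp.2.trans ht.2⟩ q ⟨hs.1.trans hq.1, hq.2.trans ht.2⟩ hpq ?_
      exact fun f hf hfpq => hfree f (by simp [hf]) ⟨hp.1.trans_lt hfpq.1, hfpq.2.trans hq.2⟩
    intro p hp q hq
    rcases lt_trichotomy p q with hpq | rfl | hpq
    · exact key p hp q hq hpq
    · rw [dist_self]; positivity
    · rw [dist_comm]; exact key q hq p hp hpq
  have hpull : ∀ p ∈ Icc (τ s) (τ t), ∃ p' ∈ Icc s t, τ p' = p := by
    intro p hp
    obtain ⟨p', hp', rfl⟩ := exists_invTime_eq (θ n)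
      (⟨hτs.1.trans hp.1, hp.2.trans hτt.2⟩ : p ∈ Icc 0 T)
    exact ⟨p', ⟨(hτ.le_iff_le hs hp').1 hp.1, (hτ.le_iff_le hp' ht).1 hp.2⟩, rfl⟩
  have hoscwn : ∀ p ∈ Icc (τ s) (τ t), ∀ q ∈ Icc (τ s) (τ t), ‖wn n p - wn n q‖ ≤ β := by
    intro p hp q hq
    obtain ⟨p, hp', rfl⟩ := hpull p hp
    obtain ⟨q, hq', rfl⟩ := hpull q hq
    have e1 := hn2 p ⟨hs.1.trans hp'.1, hp'.2.trans ht.2⟩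
    have e2 := hn2 q ⟨hs.1.trans hq'.1, hq'.2.trans ht.2⟩
    have e3 := hoscw p hp' q hq'
    rw [← dist_eq_norm]
    have e4 := dist_triangle4 (wn n (τ p)) (w p) (w q) (wn n (τ q))
    rw [dist_comm (w q) (wn n (τ q))] at e4
    linarith
  have hν := (h n).measureReal_Ioc_le hρ hη ha₀ he₀ he₁ hτs hτt hlt.le
    (hlen.le.trans (min_le_left _ _)) hβ0.le hβ0.le hoscwn
    ((le_iSup (fun n => timeModulus T (Dn n) (τ t - τ s)) n).trans_lt
      (hsub ⟨sub_pos.2 hlt, hlen.trans_le (min_le_right _ _)⟩)) hβρ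
  rw [← hC] at hν
  refine ⟨by linarith, ?_⟩
  have e1 := (h n).norm_incr_le hτs hτt hlt.le
  have e2 := hoscwn _ ⟨hlt.le, le_rfl⟩ _ ⟨le_rfl, hlt.le⟩
  have e3 : xn n (τ t) - xn n (τ s) =
      (wn n (τ t) - wn n (τ s)) + (lamn n (τ t) - lamn n (τ s)) := by
    rw [(h n).decomp _ hτs, (h n).decomp _ hτt]; abel
  rw [dist_comm, dist_eq_norm, e3]
  refine (norm_add_le _ _).trans ?_
  linarith

/-- The total masses of the reflections are bounded along the sequence. -/
theorem exists_measure_univ_le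
    (h : ∀ n, IsReflectedPath T ρ η a₀ e₀ (Dn n) (Γn n) (wn n) (xn n) (lamn n) (νn n) (γn n))
    (hρ : 0 < ρ) (hη : 0 < η) (ha₀ : 0 < a₀) (he₀ : 0 ≤ e₀) (he₁ : e₀ < 1)
    (hmod : Tendsto (fun r : ℝ => ⨆ n, timeModulus T (Dn n) r) (𝓝[>] 0) (𝓝 0))
    (hw : IsCadlag T w) (hid : ConvergesAlong T θ (fun _ => id) (id : ℝ → ℝ))
    (hwn : ConvergesAlong T θ wn w) (hT : 0 ≤ T) :
    ∃ M : ℝ≥0∞, M ≠ ⊤ ∧ ∀ᶠ n in atTop, νn n univ ≤ M := by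
  classical
  obtain ⟨F, h0F, hF⟩ := exists_finset_measureReal_le h hρ hη ha₀ he₀ he₁ hmod hw hid hwn one_pos
  obtain ⟨R, hR0, hR⟩ := hw.exists_norm_le
  set J : ℝ := 2 * (2 * (R + 1)) / (1 - e₀) with hJ
  refine ⟨F.card * (ENNReal.ofReal J + ENNReal.ofReal 1),
    ENNReal.mul_ne_top (by simp) (by simp), ?_⟩
  filter_upwards [hF, hwn 1 one_pos] with n hn hwn1
  have hfin := (h n).finite
  have hbd : ∀ v ∈ Icc 0 T, ‖wn n v‖ ≤ R + 1 := by
    intro v hv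
    obtain ⟨t, ht, rfl⟩ := exists_invTime_eq (θ n) hv
    have e1 := hwn1 t ht
    rw [dist_eq_norm] at e1
    have e2 := hR t ht
    have e3 := norm_le_norm_add_norm_sub (w t) (wn n (invTime (θ n) t))
    rw [norm_sub_rev] at e3
    linarith
  set G : Finset ℝ := (F.filter (· ∈ Icc 0 T)).image (invTime (θ n)) with hG
  have hGcard : G.card ≤ F.card :=
    Finset.card_image_le.trans (Finset.card_filter_le _ _)
  have h0G : (0 : ℝ) ∈ G :=
    Finset.mem_image.2 ⟨0, Finset.mem_filter.2 ⟨h0F, le_rfl, hT⟩, invTime_zero _ hT⟩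
  refine (measure_univ_le_of_pieces (T := T) h0G ?_ (J := ENNReal.ofReal J) (K := ENNReal.ofReal 1) ?_
    ?_).trans (by gcongr)
  · exact measure_mono_null (compl_subset_compl.2 Ioc_subset_Icc_self) (h n).compl
  · intro v hv
    rcases hv.1.eq_or_lt with rfl | hv0
    · rw [measure_mono_null (t := (Ioc 0 T)ᶜ) (by simp) (h n).compl]
      exact zero_le
    · rw [← ofReal_measureReal]
      refine ENNReal.ofReal_le_ofReal ((h n).measureReal_singleton_le hρ hη ha₀ he₀ he₁
        ⟨hv0, hv.2⟩ ?_)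
      filter_upwards [Ioo_mem_nhdsLT hv0] with s hs
      have e1 := hbd v hv
      have e2 := hbd s ⟨hs.1.le, hs.2.le.trans hv.2⟩
      linarith [norm_sub_le (wn n v) (wn n s)]
  · intro s hs t ht hst hfree
    obtain ⟨s, hs', rfl⟩ := exists_invTime_eq (θ n) hs
    obtain ⟨t, ht', rfl⟩ := exists_invTime_eq (θ n) ht
    have hst' := ((strictMonoOn_invTime (θ n)).lt_iff_lt hs' ht').1 hst
    rw [← ofReal_measureReal]
    refine ENNReal.ofReal_le_ofReal (hn s hs' t ht' hst' fun f hf hfst => ?_).1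
    have hfT : f ∈ Icc 0 T := ⟨hs'.1.trans hfst.1.le, hfst.2.trans ht'.2⟩
    refine hfree (invTime (θ n) f)
      (Finset.mem_image_of_mem _ (Finset.mem_filter.2 ⟨hf, hfT⟩)) ⟨?_, ?_⟩
    · exact strictMonoOn_invTime (θ n) hs' hfT hfst.1
    · exact (strictMonoOn_invTime (θ n)).monotoneOn hfT ht' hfst.2

/-- Compactness: a subsequence of the reflected paths converges along the time changes of the driving
paths. -/
theorem exists_subseq_convergesAlong
    (h : ∀ n, IsReflectedPath T ρ η a₀ e₀ (Dn n) (Γn n) (wn n) (xn n) (lamn n) (νn n) (γn n))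
    (hρ : 0 < ρ) (hη : 0 < η) (ha₀ : 0 < a₀) (he₀ : 0 ≤ e₀) (he₁ : e₀ < 1)
    (hmod : Tendsto (fun r : ℝ => ⨆ n, timeModulus T (Dn n) r) (𝓝[>] 0) (𝓝 0))
    (hw : IsCadlag T w) (hid : ConvergesAlong T θ (fun _ => id) (id : ℝ → ℝ))
    (hwn : ConvergesAlong T θ wn w)
    {R : ℝ} (hR : ∀ n, ∀ t ∈ Icc 0 T, timeSection (Dn n) t ⊆ Metric.ball 0 R) :
    ∃ ψ : ℕ → ℕ, StrictMono ψ ∧ ∃ x lam : ℝ → Euc d, IsCadlag T x ∧ IsCadlag T lam ∧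
      ConvergesAlong T (fun k => θ (ψ k)) (fun k => xn (ψ k)) x ∧
      ConvergesAlong T (fun k => θ (ψ k)) (fun k => lamn (ψ k)) lam := by
  obtain ⟨ψ, hψ, x, hx, hconv⟩ := exists_subseq_uniform (T := T) (R := R)
    (ys := fun n t => xn n (invTime (θ n) t)) (fun n t ht => by
      have hm := invTime_mem (θ n) ht
      have := closure_mono (hR n _ hm) ((h n).mem_closure _ hm)
      exact mem_closedBall_zero_iff.1 (Metric.closure_ball_subset_closedBall this)) fun ε hε => by
        obtain ⟨F, -, hF⟩ :=
          exists_finset_measureReal_le h hρ hη ha₀ he₀ he₁ hmod hw hid hwn hε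
        exact ⟨F, hF.mono fun n hn s hs t ht hst hfree => (hn s hs t ht hst hfree).2⟩
  refine ⟨ψ, hψ, x, fun t => x t - w t, hx, hx.sub hw, hconv, ?_⟩
  have hx' : ConvergesAlong T (fun k => θ (ψ k)) (fun k => xn (ψ k)) x := hconv
  refine (hx'.sub (hwn.comp_strictMono hψ)).congr (fun k t ht => ?_) fun _ _ => rfl
  simp [(h (ψ k)).decomp t ht]

end Sequence

/-! ### Directions of reflection in the limit -/

/-- A closed convex cone without opposite directions is separated from a vector outside it by a
linear functional that is negative on all its unit vectors. -/
theorem IsClosedConvexCone.exists_inner_neg {d : ℕ} {C : Set (Euc d)} (hC : IsClosedConvexCone C)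
    (hopp : ∀ g₁ ∈ C ∩ Metric.sphere 0 1, ∀ g₂ ∈ C ∩ Metric.sphere 0 1, -1 < inner ℝ g₁ g₂)
    {g : Euc d} (hg : g ∉ C) :
    ∃ u : Euc d, (∀ c ∈ C ∩ Metric.sphere 0 1, inner ℝ c u < 0) ∧ 0 < inner ℝ g u := by
  have h0 : (0 : Euc d) ∈ C := by
    obtain ⟨v, hv⟩ := hC.nonempty
    simpa using hC.combo 0 0 le_rfl le_rfl v hv v hv
  have hconv : Convex ℝ C := fun u hu v hv a b ha hb _ => hC.combo a b ha hb u hu v hv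
  have hsep : ∀ y ∉ C, ∃ u₀ : Euc d, (∀ c ∈ C, inner ℝ c u₀ ≤ 0) ∧ 0 < inner ℝ y u₀ := by
    intro y hy
    obtain ⟨f, r, hf, hr⟩ := geometric_hahn_banach_closed_point hconv hC.closed hy
    have hr0 : 0 < r := by simpa using hf 0 h0
    refine ⟨(InnerProductSpace.toDual ℝ (Euc d)).symm f, fun c hc => ?_, ?_⟩
    · rw [real_inner_comm, InnerProductSpace.toDual_symm_apply]
      by_contra hpos
      push Not at hpos
      have h1 := hf ((r / f c) • c) (by
        simpa using hC.combo (r / f c) 0 (by positivity) le_rfl c hc c hc)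
      rw [map_smul, smul_eq_mul, div_mul_cancel₀ _ hpos.ne'] at h1
      exact lt_irrefl _ h1
    · rw [real_inner_comm, InnerProductSpace.toDual_symm_apply]
      exact hr0.trans hr
  obtain ⟨u₀, hu₀C, hu₀g⟩ := hsep g hg
  -- the unit vectors of `C` lie in an open half-space: add up finitely many functionals that
  -- separate `C` from the opposites of its unit vectors
  obtain ⟨u₁, hu₁⟩ : ∃ u₁ : Euc d, ∀ c ∈ C ∩ Metric.sphere 0 1, inner ℝ c u₁ < 0 := by
    have hneg : ∀ c ∈ C ∩ Metric.sphere 0 1, ∃ v : Euc d,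
        (∀ c' ∈ C, inner ℝ c' v ≤ 0) ∧ inner ℝ c v < 0 := by
      intro c hc
      have hc1 : ‖c‖ = 1 := by simpa using hc.2
      obtain ⟨v, hv, hcv⟩ := hsep (-c) fun h => by
        have := hopp c hc (-c) ⟨h, by simpa using hc1⟩
        rw [inner_neg_right, real_inner_self_eq_norm_sq, hc1] at this
        norm_num at this
      rw [inner_neg_left] at hcv
      exact ⟨v, hv, by linarith⟩
    choose! v hvC hv using hneg
    obtain ⟨t, htS, hcov⟩ := ((isCompact_sphere (0 : Euc d) 1).inter_left
      hC.closed).elim_nhds_subcover (fun c => {c' : Euc d | inner ℝ c' (v c) < 0}) fun c hc =>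
        (isOpen_lt (by fun_prop) continuous_const).mem_nhds (hv c hc)
    refine ⟨∑ c ∈ t, v c, fun c hc => ?_⟩
    obtain ⟨c₀, hc₀, hlt⟩ := mem_iUnion₂.1 (hcov hc)
    rw [inner_sum]
    exact Finset.sum_neg' (fun c' hc' => hvC c' (htS c' hc') c hc.1) ⟨c₀, hc₀, hlt⟩
  refine ⟨u₀ + (inner ℝ g u₀ / (2 * (|inner ℝ g u₁| + 1))) • u₁, fun c hc => ?_, ?_⟩
  · rw [inner_add_right, real_inner_smul_right]
    have h1 := hu₀C c hc.1
    have h2 := hu₁ c hc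
    have h3 : 0 < inner ℝ g u₀ / (2 * (|inner ℝ g u₁| + 1)) := by positivity
    linarith [mul_neg_of_pos_of_neg h3 h2]
  · rw [inner_add_right, real_inner_smul_right]
    have h1 : inner ℝ g u₀ / (2 * (|inner ℝ g u₁| + 1)) * |inner ℝ g u₁| ≤ inner ℝ g u₀ / 2 := by
      rw [div_mul_eq_mul_div, div_le_div_iff₀ (by positivity) two_pos]
      nlinarith
    have h2 : 0 ≤ inner ℝ g u₀ / (2 * (|inner ℝ g u₁| + 1)) := by positivity
    have h3 := mul_le_mul_of_nonneg_left (neg_abs_le (inner ℝ g u₁)) h2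
    linarith

theorem isClosed_unitGraph {d : ℕ} {T : ℝ} {D : Set (ℝ × Euc d)} {Γ : ℝ → Euc d → Set (Euc d)}
    (h : IsClosed (coneGraph T D Γ)) : IsClosed (unitGraph T D Γ) :=
  h.inter (isClosed_eq (by fun_prop) continuous_const)

/-- A unit vector `g` that is not in the graph over `(s, z)` is separated from the graph over
`(s, z)`, whether or not `z` is on the boundary. -/
theorem exists_inner_neg_of_notMem_unitGraph {d : ℕ} {T : ℝ} {D : Set (ℝ × Euc d)}
    {Γ : ℝ → Euc d → Set (Euc d)} (hΓ : IsConeField T D Γ) (hopp : NoOppositeDirections T D Γ)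
    {s : ℝ} {z g : Euc d} (hg1 : ‖g‖ = 1) (hg : (s, z, g) ∉ unitGraph T D Γ) :
    ∃ u : Euc d, (∀ c, (s, z, c) ∈ unitGraph T D Γ → inner ℝ c u < 0) ∧ 0 < inner ℝ g u := by
  by_cases hsz : s ∈ Icc 0 T ∧ z ∈ frontier (timeSection D s)
  · obtain ⟨u, hu, hgu⟩ := (hΓ s hsz.1 z hsz.2).exists_inner_neg (hopp s hsz.1 z hsz.2)
      fun h => hg ⟨⟨hsz.1, hsz.2, h⟩, hg1⟩
    exact ⟨u, fun c hc => hu c ⟨hc.1.2.2, by simpa using hc.2⟩, hgu⟩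
  · refine ⟨g, fun c hc => absurd ⟨hc.1.1, hc.1.2.1⟩ hsz, ?_⟩
    rw [real_inner_self_eq_norm_sq, hg1]
    norm_num

/-- By compactness of the unit sphere, a functional that is negative on the graph over one point is
uniformly negative on the graph over a neighbourhood. -/
theorem exists_forall_inner_le_neg {d : ℕ} {T : ℝ} {D : Set (ℝ × Euc d)}
    {Γ : ℝ → Euc d → Set (Euc d)} (hclosed : IsClosed (unitGraph T D Γ)) {s : ℝ} {z u : Euc d}
    (hu : ∀ c, (s, z, c) ∈ unitGraph T D Γ → inner ℝ c u < 0) :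
    ∃ ε > 0, ∀ q ∈ unitGraph T D Γ, dist q.1 s < ε → dist q.2.1 z < ε →
      inner ℝ q.2.2 u ≤ -ε := by
  by_contra hn
  push Not at hn
  choose q hq hq1 hq2 hq3 using fun n : ℕ => hn _ (Nat.one_div_pos_of_nat (α := ℝ) (n := n))
  obtain ⟨c, -, φ, hφ, hlim⟩ := (isCompact_sphere (0 : Euc d) 1).tendsto_subseq
    (x := fun n => (q n).2.2) fun n => by simpa using (hq n).2
  have h0 := (tendsto_one_div_add_atTop_nhds_zero_nat (𝕜 := ℝ)).comp hφ.tendsto_atTop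
  have e1 : Tendsto (fun k => (q (φ k)).1) atTop (𝓝 s) := by
    rw [tendsto_iff_dist_tendsto_zero]
    exact squeeze_zero (fun _ => dist_nonneg) (fun k => (hq1 (φ k)).le) h0
  have e2 : Tendsto (fun k => (q (φ k)).2.1) atTop (𝓝 z) := by
    rw [tendsto_iff_dist_tendsto_zero]
    exact squeeze_zero (fun _ => dist_nonneg) (fun k => (hq2 (φ k)).le) h0
  have hmem := hclosed.mem_of_tendsto (e1.prodMk_nhds (e2.prodMk_nhds hlim))
    (Eventually.of_forall fun k => hq (φ k))
  have hge : 0 ≤ inner ℝ c u := by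
    have h1 : Tendsto (fun k => inner ℝ ((fun n => (q n).2.2) (φ k)) u) atTop (𝓝 (inner ℝ c u)) :=
      hlim.inner tendsto_const_nhds
    have h2 := h0.neg
    rw [neg_zero] at h2
    exact le_of_tendsto_of_tendsto' h2 h1 fun k => (hq3 (φ k)).le
  exact absurd (hu c hmem) (not_lt.2 hge)

section Limit

variable {d : ℕ} {T : ℝ} {D : Set (ℝ × Euc d)} {Γ : ℝ → Euc d → Set (Euc d)}
  {Dn : ℕ → Set (ℝ × Euc d)} {Γn : ℕ → ℝ → Euc d → Set (Euc d)}
  {xn lamn : ℕ → ℝ → Euc d} {νn : ℕ → Measure ℝ} {γn : ℕ → ℝ → Euc d}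
  {θ : ℕ → (Icc (0 : ℝ) T ≃o Icc (0 : ℝ) T)} {x lam : ℝ → Euc d}

theorem eventually_exists_dist_lt
    (hG : Tendsto (fun n => graphHausdorff (unitGraph T (Dn n) (Γn n)) (unitGraph T D Γ))
      atTop (𝓝 0)) {δ : ℝ} (hδ : 0 < δ) :
    ∀ᶠ n in atTop, ∀ p ∈ unitGraph T (Dn n) (Γn n), ∃ q ∈ unitGraph T D Γ,
      dist p.1 q.1 < δ ∧ dist p.2.1 q.2.1 < δ ∧ dist p.2.2 q.2.2 < δ := by
  filter_upwards [hG.eventually (gt_mem_nhds (ENNReal.ofReal_pos.2 hδ))] with n hn p hp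
  have h1 : ⨅ q ∈ unitGraph T D Γ, graphEDist p q < ENNReal.ofReal δ :=
    lt_of_le_of_lt ((le_iSup₂ (f := fun p (_ : p ∈ unitGraph T (Dn n) (Γn n)) =>
      ⨅ q ∈ unitGraph T D Γ, graphEDist p q) p hp).trans (le_max_left _ _)) hn
  obtain ⟨q, h1⟩ := iInf_lt_iff.1 h1
  obtain ⟨hq, h1⟩ := iInf_lt_iff.1 h1
  have hd : ∀ {E : Type} [PseudoMetricSpace E] {a b : E}, edist a b < ENNReal.ofReal δ →
      dist a b < δ := fun h => by
    rw [edist_dist] at h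
    exact (ENNReal.ofReal_lt_ofReal_iff hδ).1 h
  refine ⟨q, hq, hd (lt_of_le_of_lt ?_ h1), hd (lt_of_le_of_lt ?_ h1), hd (lt_of_le_of_lt ?_ h1)⟩
  · exact le_self_add.trans le_self_add
  · exact le_add_self.trans le_self_add
  · exact le_add_self

theorem mem_unitGraph_of_tendsto (hclosed : IsClosed (unitGraph T D Γ))
    (hG : Tendsto (fun n => graphHausdorff (unitGraph T (Dn n) (Γn n)) (unitGraph T D Γ))
      atTop (𝓝 0)) {p : ℕ → ℝ × Euc d × Euc d} {q : ℝ × Euc d × Euc d}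
    (hp : ∀ᶠ n in atTop, p n ∈ unitGraph T (Dn n) (Γn n)) (hpq : Tendsto p atTop (𝓝 q)) :
    q ∈ unitGraph T D Γ := by
  rw [← hclosed.closure_eq, Metric.mem_closure_iff]
  intro ε hε
  obtain ⟨n, h1, h2, h3⟩ := (hp.and ((eventually_exists_dist_lt hG (half_pos hε)).and
    (hpq.eventually (Metric.ball_mem_nhds _ (half_pos hε))))).exists
  obtain ⟨q', hq', e1, e2, e3⟩ := h2 _ h1
  refine ⟨q', hq', ?_⟩
  have e4 : dist (p n) q' < ε / 2 := by
    rw [Prod.dist_eq, Prod.dist_eq]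
    exact max_lt e1 (max_lt e2 e3)
  have e5 : dist (p n) q < ε / 2 := h3
  linarith [dist_triangle_left q q' (p n)]

/-- At a continuity point of `x`, the increments of the limit of the reflection terms inherit every
linear bound that holds on the graph over that point. -/
theorem exists_forall_inner_incr_nonpos (hclosed : IsClosed (unitGraph T D Γ))
    (hG : Tendsto (fun n => graphHausdorff (unitGraph T (Dn n) (Γn n)) (unitGraph T D Γ))
      atTop (𝓝 0))
    (h : ∀ n, IsReflection T (Dn n) (Γn n) (xn n) (lamn n) (νn n) (γn n))
    (hid : ConvergesAlong T θ (fun _ => id) (id : ℝ → ℝ)) (hx : ConvergesAlong T θ xn x)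
    (hlam : ConvergesAlong T θ lamn lam) {s : ℝ} (hs : s ∈ Ioo 0 T) (hxs : ContinuousAt x s)
    {u : Euc d} (hu : ∀ c, (s, x s, c) ∈ unitGraph T D Γ → inner ℝ c u < 0) :
    ∃ p q, s ∈ Ioo p q ∧ 0 ≤ p ∧ q ≤ T ∧ ∀ a b, p < a → a < b → b < q →
      inner ℝ (lam b - lam a) u ≤ 0 := by
  obtain ⟨ε, hε, hneg⟩ := exists_forall_inner_le_neg hclosed hu
  set δ := ε / (4 * (‖u‖ + 1)) with hδ
  have hδ0 : 0 < δ := by positivity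
  have hδε : δ ≤ ε / 4 := by
    rw [hδ]
    refine div_le_div_of_nonneg_left hε.le (by norm_num) ?_
    linarith [norm_nonneg u]
  have hδu : δ * ‖u‖ ≤ ε := by
    rw [hδ, div_mul_eq_mul_div, div_le_iff₀ (by positivity)]
    nlinarith [norm_nonneg u]
  obtain ⟨r, hr, hxr⟩ := Metric.continuousAt_iff.1 hxs (ε / 4) (by positivity)
  set ρ := min (min r (ε / 4)) (min s (T - s)) with hρ
  have hρ0 : 0 < ρ := lt_min (lt_min hr (by positivity)) (lt_min hs.1 (sub_pos.2 hs.2))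
  have h1 : ρ ≤ r := (min_le_left _ _).trans (min_le_left _ _)
  have h2 : ρ ≤ ε / 4 := (min_le_left _ _).trans (min_le_right _ _)
  have h3 : ρ ≤ s := (min_le_right _ _).trans (min_le_left _ _)
  have h4 : ρ ≤ T - s := (min_le_right _ _).trans (min_le_right _ _)
  refine ⟨s - ρ, s + ρ, ⟨by linarith, by linarith⟩, by linarith, by linarith,
    fun a b ha hab hb => ?_⟩
  have haT : a ∈ Icc 0 T := ⟨by linarith, by linarith⟩
  have hbT : b ∈ Icc 0 T := ⟨by linarith, by linarith⟩
  have hconst : Tendsto (fun _ : ℕ => u) atTop (𝓝 u) := tendsto_const_nhds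
  have hlim := ((hlam.tendsto hbT).sub (hlam.tendsto haT)).inner (𝕜 := ℝ) hconst
  refine le_of_tendsto hlim ?_
  filter_upwards [eventually_exists_dist_lt hG hδ0, hid δ hδ0, hx δ hδ0] with n hn1 hn2 hn3
  have hfin := (h n).finite
  have hτ := strictMonoOn_invTime (θ n)
  rw [(h n).incr _ (invTime_mem _ haT) _ (invTime_mem _ hbT) (hτ haT hbT hab).le, real_inner_comm,
    ← integral_inner (h n).integrable.integrableOn]
  refine integral_nonpos_of_ae ?_
  rw [EventuallyLE, ae_restrict_iff' measurableSet_Ioc]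
  filter_upwards [(h n).graph] with v hv hvab
  obtain ⟨q, hq, e1, e2, e3⟩ := hn1 _ hv
  obtain ⟨v, hvT, rfl⟩ := exists_invTime_eq (θ n) hv.1.1
  have hva : a < v := (hτ.lt_iff_lt haT hvT).1 hvab.1
  have hvb : v ≤ b := (hτ.le_iff_le hvT hbT).1 hvab.2
  have hvs : dist v s < ρ := by
    rw [Real.dist_eq, abs_lt]
    constructor <;> linarith
  have e4 := hn2 v hvT
  have e5 := hn3 v hvT
  have e6 := hxr (hvs.trans_le h1)
  simp only [id] at e1 e2 e3 e4
  have e7 := hneg q hq (by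
    have := dist_triangle4 q.1 (invTime (θ n) v) v s
    rw [dist_comm q.1 (invTime (θ n) v)] at this
    linarith) (by
    have := dist_triangle4 q.2.1 (xn n (invTime (θ n) v)) (x v) (x s)
    rw [dist_comm q.2.1 (xn n (invTime (θ n) v))] at this
    linarith)
  have e8 : inner ℝ u (γn n (invTime (θ n) v)) =
      inner ℝ q.2.2 u + inner ℝ (γn n (invTime (θ n) v) - q.2.2) u := by
    rw [← inner_add_left, real_inner_comm, add_sub_cancel]
  have e9 : inner ℝ (γn n (invTime (θ n) v) - q.2.2) u ≤ δ * ‖u‖ := by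
    refine (real_inner_le_norm _ _).trans ?_
    rw [← dist_eq_norm]
    gcongr
  change inner ℝ u (γn n (invTime (θ n) v)) ≤ 0
  linarith

theorem tendsto_invTime_left (σ : Icc (0 : ℝ) T ≃o Icc (0 : ℝ) T) {s : ℝ} (hs : s ∈ Ioc 0 T) :
    Tendsto (invTime σ) (𝓝[<] s) (𝓝[<] (invTime σ s)) := by
  have hsT : s ∈ Icc 0 T := ⟨hs.1.le, hs.2⟩
  have hT : (0 : ℝ) ∈ Icc 0 T := ⟨le_rfl, hs.1.le.trans hs.2⟩
  have hτ := strictMonoOn_invTime σ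
  have hpos : 0 < invTime σ s := by
    have := hτ hT hsT hs.1
    exact (invTime_mem σ hT).1.trans_lt this
  intro U hU
  obtain ⟨l, hl, hsub⟩ := mem_nhdsLT_iff_exists_Ioo_subset.1 hU
  have hl' : max l 0 < invTime σ s := max_lt hl hpos
  obtain ⟨l', hl'T, hl'eq⟩ := exists_invTime_eq σ
    (⟨le_max_right _ _, hl'.le.trans (invTime_mem σ hsT).2⟩ : max l 0 ∈ Icc 0 T)
  have hl's : l' < s := (hτ.lt_iff_lt hl'T hsT).1 (hl'eq ▸ hl')
  rw [mem_map]
  filter_upwards [Ioo_mem_nhdsLT hl's] with v hv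
  have hvT : v ∈ Icc 0 T := ⟨hl'T.1.trans hv.1.le, hv.2.le.trans hs.2⟩
  refine hsub ⟨?_, hτ hvT hsT hv.2⟩
  have := hτ hl'T hvT hv.1
  rw [hl'eq] at this
  exact (le_max_left _ _).trans_lt this

/-- The jumps of the reflection terms converge, and with them their directions. -/
theorem mem_unitGraph_of_jump (hclosed : IsClosed (unitGraph T D Γ))
    (hG : Tendsto (fun n => graphHausdorff (unitGraph T (Dn n) (Γn n)) (unitGraph T D Γ))
      atTop (𝓝 0))
    (h : ∀ n, IsReflection T (Dn n) (Γn n) (xn n) (lamn n) (νn n) (γn n))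
    (hid : ConvergesAlong T θ (fun _ => id) (id : ℝ → ℝ)) (hx : ConvergesAlong T θ xn x)
    (hlam : ConvergesAlong T θ lamn lam) {s m : ℝ} (hs : s ∈ Ioc 0 T) (hm : 0 < m)
    {g : Euc d} (hg : ‖g‖ = 1)
    (hjump : Tendsto (fun r => lam s - lam r) (𝓝[<] s) (𝓝 (m • g))) :
    (s, x s, g) ∈ unitGraph T D Γ := by
  have hsT : s ∈ Icc 0 T := ⟨hs.1.le, hs.2⟩
  set τ : ℕ → ℝ := fun n => invTime (θ n) s with hτ
  have hτmem : ∀ n, τ n ∈ Ioc 0 T := by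
    intro n
    have h0 : (0 : ℝ) ∈ Icc 0 T := ⟨le_rfl, hs.1.le.trans hs.2⟩
    have h1 : invTime (θ n) 0 < invTime (θ n) s := strictMonoOn_invTime (θ n) h0 hsT hs.1
    exact ⟨(invTime_mem (θ n) h0).1.trans_lt h1, (invTime_mem (θ n) hsT).2⟩
  have hconv : Tendsto (fun n => (νn n).real {τ n} • γn n (τ n)) atTop (𝓝 (m • g)) := by
    rw [Metric.tendsto_nhds]
    intro ε hε
    filter_upwards [hlam (ε / 3) (by positivity)] with n hn
    have h1 := ((h n).tendsto_incr (hτmem n)).comp (tendsto_invTime_left (θ n) hs)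
    have h2 := h1.dist hjump
    refine lt_of_le_of_lt (le_of_tendsto h2 (b := 2 * (ε / 3)) ?_) (by linarith)
    filter_upwards [Ioo_mem_nhdsLT hs.1] with r hr
    refine (dist_sub_sub_le _ _ _ _).trans ?_
    have e1 := hn s hsT
    have e2 := hn r ⟨hr.1.le, hr.2.le.trans hs.2⟩
    linarith
  have hnorm : Tendsto (fun n => ‖(νn n).real {τ n} • γn n (τ n)‖) atTop (𝓝 m) := by
    have := hconv.norm
    rwa [norm_smul, hg, mul_one, Real.norm_of_nonneg hm.le] at this
  have hgraph : ∀ᶠ n in atTop, (τ n, xn n (τ n), γn n (τ n)) ∈ unitGraph T (Dn n) (Γn n) ∧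
      ‖(νn n).real {τ n} • γn n (τ n)‖⁻¹ • ((νn n).real {τ n} • γn n (τ n)) = γn n (τ n) := by
    filter_upwards [hnorm.eventually (lt_mem_nhds hm)] with n hn
    have h0 : (νn n).real {τ n} ≠ 0 := fun h0 => by simp [h0] at hn
    have hmem := (h n).graph_of_atom fun h1 => h0 (by rw [measureReal_def, h1]; rfl)
    refine ⟨hmem, ?_⟩
    have h1 : ‖γn n (τ n)‖ = 1 := hmem.2
    rw [norm_smul, h1, mul_one, Real.norm_of_nonneg measureReal_nonneg, smul_smul,
      inv_mul_cancel₀ h0, one_smul]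
  have hdir : Tendsto (fun n => γn n (τ n)) atTop (𝓝 g) := by
    have h1 := (hnorm.inv₀ hm.ne').smul hconv
    rw [smul_smul, inv_mul_cancel₀ hm.ne', one_smul] at h1
    exact h1.congr' (hgraph.mono fun n hn => hn.2)
  exact mem_unitGraph_of_tendsto hclosed hG (hgraph.mono fun n hn => hn.1)
    ((hid.tendsto hsT).prodMk_nhds ((hx.tendsto hsT).prodMk_nhds hdir))

end Limit

/-! ### The limit is a solution -/

section Limit

variable {d : ℕ} {T : ℝ} {D : Set (ℝ × Euc d)} {Γ : ℝ → Euc d → Set (Euc d)}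
  {Dn : ℕ → Set (ℝ × Euc d)} {Γn : ℕ → ℝ → Euc d → Set (Euc d)}
  {xn lamn : ℕ → ℝ → Euc d} {νn : ℕ → Measure ℝ} {γn : ℕ → ℝ → Euc d}
  {θ : ℕ → (Icc (0 : ℝ) T ≃o Icc (0 : ℝ) T)} {w x lam : ℝ → Euc d}

theorem IsReflection.eVariationOn_le {ν : Measure ℝ} {γ : ℝ → Euc d}
    (h : IsReflection T D Γ x lam ν γ) : eVariationOn lam (Icc 0 T) ≤ ν univ := by
  have := h.finite
  refine (eVariationOn_le_of_increments h.integrable h.incr).trans ?_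
  have h1 : ∫ v in Ioc 0 T, ‖γ v‖ ∂ν = ν.real (Ioc 0 T) := by
    rw [setIntegral_congr_ae (g := fun _ => (1 : ℝ)) measurableSet_Ioc
      (h.graph.mono fun v hv _ => hv.2)]
    simp
  rw [h1, ofReal_measureReal]
  exact measure_mono (subset_univ _)

/-- The limit is of bounded variation: time changes do not increase the variation, which is lower
semicontinuous under pointwise convergence. -/
theorem boundedVariationOn_of_convergesAlong {M : ℝ≥0∞}
    (h : ∀ n, IsReflection T (Dn n) (Γn n) (xn n) (lamn n) (νn n) (γn n)) (hM : M ≠ ⊤)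
    (hνM : ∀ᶠ n in atTop, νn n univ ≤ M) (hlam : ConvergesAlong T θ lamn lam) :
    BoundedVariationOn lam (Icc 0 T) := by
  refine ne_top_of_le_ne_top hM ?_
  by_contra hlt
  obtain ⟨n, h1, h2⟩ := ((eVariationOn.lowerSemicontinuous_aux
    (F := fun n => lamn n ∘ invTime (θ n)) (fun t ht => hlam.tendsto ht)
    (not_le.1 hlt)).and hνM).exists
  refine absurd h1 (not_lt.2 ?_)
  exact (eVariationOn.comp_le_of_monotoneOn _ _ (strictMonoOn_invTime (θ n)).monotoneOn
    fun t ht => invTime_mem (θ n) ht).trans ((h n).eVariationOn_le.trans h2)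

theorem mem_closure_of_convergesAlong
    (hmod : Tendsto (fun r : ℝ => ⨆ n, timeModulus T (Dn n) r) (𝓝[>] 0) (𝓝 0))
    (hconv : Tendsto (fun n => ⨆ t ∈ Icc 0 T,
      Metric.hausdorffEDist (timeSection (Dn n) t) (timeSection D t)) atTop (𝓝 0))
    (hmem : ∀ n, ∀ t ∈ Icc 0 T, xn n t ∈ closure (timeSection (Dn n) t))
    (hid : ConvergesAlong T θ (fun _ => id) (id : ℝ → ℝ)) (hx : ConvergesAlong T θ xn x)
    {t : ℝ} (ht : t ∈ Icc 0 T) : x t ∈ closure (timeSection D t) := by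
  rw [Metric.mem_closure_iff_infEDist_zero, ← nonpos_iff_eq_zero]
  have hx' := tendsto_iff_edist_tendsto_0.1 (hx.tendsto ht)
  have key : ∀ᶠ r in 𝓝[>] (0 : ℝ), Metric.infEDist (x t) (timeSection D t) ≤
      ⨆ n, timeModulus T (Dn n) r := by
    filter_upwards [self_mem_nhdsWithin] with r hr
    have hlim : Tendsto (fun n => (⨆ n, timeModulus T (Dn n) r) + (⨆ t ∈ Icc 0 T,
        Metric.hausdorffEDist (timeSection (Dn n) t) (timeSection D t)) +
        edist (xn n (invTime (θ n) t)) (x t)) atTop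
        (𝓝 ((⨆ n, timeModulus T (Dn n) r) + 0 + 0)) :=
      (tendsto_const_nhds.add hconv).add hx'
    rw [add_zero, add_zero] at hlim
    refine ge_of_tendsto hlim ?_
    filter_upwards [hid r hr] with n hn
    have hτ := invTime_mem (θ n) ht
    refine Metric.infEDist_le_infEDist_add_edist (y := xn n (invTime (θ n) t)) |>.trans ?_
    rw [edist_comm (x t)]
    refine add_le_add_left (Metric.infEDist_le_infEDist_add_hausdorffEDist
      (s := timeSection (Dn n) t) |>.trans (add_le_add ?_ ?_)) _
    · exact (infEDist_le_timeModulus hτ ht (hn t ht) (hmem n _ hτ)).trans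
        (le_iSup (fun n => timeModulus T (Dn n) r) n)
    · exact le_iSup₂ (f := fun t (_ : t ∈ Icc 0 T) =>
        Metric.hausdorffEDist (timeSection (Dn n) t) (timeSection D t)) t ht
  exact ge_of_tendsto hmod key

/-- Jump sizes pass to the limit: by uniform convergence the left limits converge as well. -/
theorem jumpSup_le_of_convergesAlong {K : ℝ≥0∞} (hxn : ∀ n, IsCadlag T (xn n))
    (hxc : IsCadlag T x) (hK : ∀ n, jumpSup T (xn n) ≤ K) (hx : ConvergesAlong T θ xn x) :
    jumpSup T x ≤ K := by
  refine iSup₂_le fun s hs => ?_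
  have hsT : s ∈ Icc 0 T := ⟨hs.1.le, hs.2⟩
  have h0 : (0 : ℝ) ∈ Icc 0 T := ⟨le_rfl, hs.1.le.trans hs.2⟩
  obtain ⟨y, hy⟩ := hxc.2 s hs
  have hτ : ∀ n, invTime (θ n) s ∈ Ioc 0 T := fun n =>
    ⟨(invTime_mem (θ n) h0).1.trans_lt (strictMonoOn_invTime (θ n) h0 hsT hs.1),
      (invTime_mem (θ n) hsT).2⟩
  choose yn hyn using fun n => (hxn n).2 _ (hτ n)
  have hylim : Tendsto yn atTop (𝓝 y) := by
    rw [Metric.tendsto_nhds]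
    intro ε hε
    filter_upwards [hx (ε / 2) (half_pos hε)] with n hn
    refine lt_of_le_of_lt (le_of_tendsto
      (((hyn n).comp (tendsto_invTime_left (θ n) hs)).dist hy) (b := ε / 2) ?_) (by linarith)
    filter_upwards [Ioo_mem_nhdsLT hs.1] with r hr
    exact hn r ⟨hr.1.le, hr.2.le.trans hs.2⟩
  rw [leftLim_eq_of_tendsto hy]
  refine le_of_tendsto ((hx.tendsto hsT).sub hylim).enorm (Eventually.of_forall fun n => ?_)
  have h1 := (le_iSup₂ (f := fun t (_ : t ∈ Ioc 0 T) => ‖xn n t - Function.leftLim (xn n) t‖ₑ)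
    _ (hτ n)).trans (hK n)
  rwa [leftLim_eq_of_tendsto (hyn n)] at h1

/-- The polar decomposition of the limiting reflection term is directed along the cones. Atoms come
from jumps. Countably many times that are not atoms do not matter. At any other time `x` is
continuous and the density is a limit of averages, which satisfy every linear bound that holds on
the graph nearby. -/
theorem isReflection_of_convergesAlong (hT : 0 ≤ T) (hΓ : IsConeField T D Γ)
    (hopp : NoOppositeDirections T D Γ) (hclosed : IsClosed (unitGraph T D Γ))
    (hG : Tendsto (fun n => graphHausdorff (unitGraph T (Dn n) (Γn n)) (unitGraph T D Γ))
      atTop (𝓝 0))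
    (h : ∀ n, IsReflection T (Dn n) (Γn n) (xn n) (lamn n) (νn n) (γn n))
    (hid : ConvergesAlong T θ (fun _ => id) (id : ℝ → ℝ)) (hx : ConvergesAlong T θ xn x)
    (hlam : ConvergesAlong T θ lamn lam) (hxc : IsCadlag T x) (hlamc : IsCadlag T lam)
    (hbv : BoundedVariationOn lam (Icc 0 T)) :
    ∃ γ, IsReflection T D Γ x lam (variationMeasure T lam hbv) γ := by
  obtain ⟨γ, hγm, hγ1, hincr⟩ := exists_polar hT hbv hlamc
  set ν := variationMeasure T lam hbv with hν
  have hfin : IsFiniteMeasure ν := isFiniteMeasure_variationMeasure hbv hlamc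
  have hcompl : ν (Ioc 0 T)ᶜ = 0 := variationMeasure_compl_Ioc hbv hlamc
  have hint : Integrable γ ν :=
    Integrable.of_bound hγm.aestronglyMeasurable 1 (hγ1.mono fun v hv => hv.le)
  refine ⟨γ, hfin, hcompl, hγm, ?_, hincr⟩
  obtain ⟨Q, hQ, hcont⟩ := hxc.exists_countable_continuousAt
  have hnull : ∀ᵐ s ∂ν, s ∈ insert T Q → ν {s} ≠ 0 := by
    have hc : {s ∈ insert T Q | ν {s} = 0}.Countable := (hQ.insert T).mono fun s hs => hs.1
    have h0 : ν {s ∈ insert T Q | ν {s} = 0} = 0 := by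
      rw [← biUnion_of_singleton {s ∈ insert T Q | ν {s} = 0}]
      exact (measure_biUnion_null_iff hc).2 fun s hs => hs.2
    filter_upwards [measure_eq_zero_iff_ae_notMem.1 h0] with s hs hsQ hs0 using hs ⟨hsQ, hs0⟩
  have hIoc : ∀ᵐ v ∂ν, v ∈ Ioc 0 T := by rw [ae_iff]; exact hcompl
  filter_upwards [hnull, hIoc, hγ1, ae_inner_le hint] with s h1 h2 h3 h4
  have hsT : s ∈ Icc 0 T := ⟨h2.1.le, h2.2⟩
  by_cases hsQ : s ∈ insert T Q
  · refine mem_unitGraph_of_jump hclosed hG h hid hx hlam h2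
      (ENNReal.toReal_pos (h1 hsQ) (measure_ne_top _ _)) h3 ?_
    refine (tendsto_setIntegral_Ioc_left hint s).congr' ?_
    filter_upwards [Ioo_mem_nhdsLT h2.1] with r hr
    rw [hincr r ⟨hr.1.le, hr.2.le.trans h2.2⟩ s hsT hr.2.le]
  · by_contra hns
    obtain ⟨u, hu, hgu⟩ := exists_inner_neg_of_notMem_unitGraph hΓ hopp h3 hns
    have hsIoo : s ∈ Ioo 0 T := ⟨h2.1, h2.2.lt_of_ne fun e => hsQ (Or.inl e)⟩
    obtain ⟨p, q, hpq, hp, hq, hle⟩ := exists_forall_inner_incr_nonpos hclosed hG h hid hx hlam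
      hsIoo (hcont s ⟨hsIoo, fun e => hsQ (Or.inr e)⟩) hu
    refine absurd (h4 u 0 p q hpq fun a b ha hab hb => ?_) (not_le.2 hgu)
    rw [zero_mul, ← hincr a ⟨hp.trans ha.le, (hab.le.trans hb.le).trans hq⟩ b
      ⟨hp.trans (ha.le.trans hab.le), hb.le.trans hq⟩ hab.le]
    exact hle a b ha hab hb

theorem isSkorohodSolution_of_isReflection (hD : IsTimeDependentDomain T D) (hT : 0 ≤ T)
    (hw : IsCadlag T w) (hxc : IsCadlag T x) (hbv : BoundedVariationOn lam (Icc 0 T))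
    {γ : ℝ → Euc d} (h : IsReflection T D Γ x lam (variationMeasure T lam hbv) γ)
    (h0 : lam 0 = 0) (hdecomp : ∀ t ∈ Icc 0 T, x t = w t + lam t)
    (hmem : ∀ t ∈ Icc 0 T, x t ∈ closure (timeSection D t)) : IsSkorohodSolution T D Γ w x lam where
  w_cadlag := hw
  w_zero_mem := by
    have h1 : (0 : ℝ) ∈ Icc 0 T := ⟨le_rfl, hT⟩
    have h2 := hdecomp 0 h1
    rw [h0, add_zero] at h2
    exact h2 ▸ hmem 0 h1
  x_cadlag := hxc
  lam_bv := hbv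
  decomp := hdecomp
  mem_closure := hmem
  direction := by
    refine ⟨γ, h.meas, fun t ht => ?_, ?_⟩
    · have h1 := h.incr 0 ⟨le_rfl, hT⟩ t ht ht.1
      rw [h0, sub_zero] at h1
      rw [h1]
      refine setIntegral_congr_set ?_
      have h2 : variationMeasure T lam hbv {0} = 0 := by
        refine measure_mono_null ?_ h.compl
        rintro _ rfl
        simp
      filter_upwards [measure_eq_zero_iff_ae_notMem.1 h2] with s hs
      refine propext ⟨fun hs' => ⟨hs'.1.le, hs'.2⟩, fun hs' => ⟨hs'.1.lt_of_ne ?_, hs'.2⟩⟩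
      exact fun e => hs e.symm
    · filter_upwards [h.graph] with s hs _ _
      exact ⟨hs.1.2.2, by simpa using hs.2⟩
  support := by
    rw [measure_eq_zero_iff_ae_notMem]
    filter_upwards [h.graph] with s hs hsD
    have := hs.1.2.1
    rw [(hD.isOpen_timeSection hsD.1).frontier_eq] at this
    exact this.2 hsD.2

end Limit

/-! ### Stability of the Skorohod problem -/

theorem tendsto_iSup_timeModulus_comp {d : ℕ} {T : ℝ} {Dn : ℕ → Set (ℝ × Euc d)}
    (hmod : Tendsto (fun r : ℝ => ⨆ n, timeModulus T (Dn n) r) (𝓝[>] 0) (𝓝 0)) (φ : ℕ → ℕ) :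
    Tendsto (fun r : ℝ => ⨆ n, timeModulus T (Dn (φ n)) r) (𝓝[>] 0) (𝓝 0) :=
  tendsto_of_tendsto_of_tendsto_of_le_of_le tendsto_const_nhds hmod (fun _ => zero_le)
    fun r => iSup_comp_le (fun n => timeModulus T (Dn n) r) φ

/-- A limit in the Skorohod topology is a uniform limit along any time changes that make a
subsequence converge. -/
theorem SkorohodTendsto.convergesAlong {d : ℕ} {T : ℝ} (hT : 0 ≤ T) {xs : ℕ → ℝ → Euc d}
    {x y : ℝ → Euc d} (h : SkorohodTendsto T xs x) (hx : IsCadlag T x) {ψ : ℕ → ℕ}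
    (hψ : StrictMono ψ) {θ : ℕ → (Icc (0 : ℝ) T ≃o Icc (0 : ℝ) T)}
    (hid : ConvergesAlong T θ (fun _ => id) (id : ℝ → ℝ)) (hy : IsCadlag T y)
    (hxy : ConvergesAlong T θ (fun k => xs (ψ k)) y) :
    ConvergesAlong T θ (fun k => xs (ψ k)) x := by
  obtain ⟨θ', hid', hx'⟩ := skorohodTendsto_iff.1 h
  exact hxy.congr (fun _ => eqOn_refl _ _) (eqOn_of_convergesAlong hT hy hx hid
    (hid'.comp_strictMono hψ) hxy (hx'.comp_strictMono hψ))

theorem isSkorohodSolution_of_convergesAlong {d : ℕ} {T ρ η a₀ e₀ : ℝ} (hT : 0 ≤ T)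
    {D : Set (ℝ × Euc d)} (hD : IsTimeDependentDomain T D) {Γ : ℝ → Euc d → Set (Euc d)}
    (hΓ : IsConeField T D Γ) (hopp : NoOppositeDirections T D Γ)
    (hclosed : IsClosed (unitGraph T D Γ))
    {Dn : ℕ → Set (ℝ × Euc d)} {Γn : ℕ → ℝ → Euc d → Set (Euc d)}
    {wn xn lamn : ℕ → ℝ → Euc d} {νn : ℕ → Measure ℝ} {γn : ℕ → ℝ → Euc d}
    {θ : ℕ → (Icc (0 : ℝ) T ≃o Icc (0 : ℝ) T)} {w x lam : ℝ → Euc d}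
    (h : ∀ n, IsReflectedPath T ρ η a₀ e₀ (Dn n) (Γn n) (wn n) (xn n) (lamn n) (νn n) (γn n))
    (hlam0 : ∀ n, lamn n 0 = 0)
    (hρ : 0 < ρ) (hη : 0 < η) (ha₀ : 0 < a₀) (he₀ : 0 ≤ e₀) (he₁ : e₀ < 1)
    (hmod : Tendsto (fun r : ℝ => ⨆ n, timeModulus T (Dn n) r) (𝓝[>] 0) (𝓝 0))
    (hconv : Tendsto (fun n => ⨆ t ∈ Icc 0 T,
      Metric.hausdorffEDist (timeSection (Dn n) t) (timeSection D t)) atTop (𝓝 0))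
    (hG : Tendsto (fun n => graphHausdorff (unitGraph T (Dn n) (Γn n)) (unitGraph T D Γ))
      atTop (𝓝 0))
    (hid : ConvergesAlong T θ (fun _ => id) (id : ℝ → ℝ)) (hwn : ConvergesAlong T θ wn w)
    (hxn : ConvergesAlong T θ xn x) (hlamn : ConvergesAlong T θ lamn lam)
    (hw : IsCadlag T w) (hx : IsCadlag T x) (hlam : IsCadlag T lam) :
    IsSkorohodSolution T D Γ w x lam := by
  have hν := fun n => (h n).toIsReflection
  have h0 : (0 : ℝ) ∈ Icc 0 T := ⟨le_rfl, hT⟩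
  obtain ⟨M, hM, hνM⟩ := exists_measure_univ_le h hρ hη ha₀ he₀ he₁ hmod hw hid hwn hT
  have hbv := boundedVariationOn_of_convergesAlong hν hM hνM hlamn
  obtain ⟨γ, hγ⟩ := isReflection_of_convergesAlong hT hΓ hopp hclosed hG hν hid hxn hlamn hx hlam
    hbv
  refine isSkorohodSolution_of_isReflection hD hT hw hx hbv hγ ?_ (fun t ht => ?_) fun t ht =>
    mem_closure_of_convergesAlong hmod hconv (fun n => (h n).mem_closure) hid hxn ht
  · have h1 := hlamn.tendsto h0
    simp only [invTime_zero _ hT, hlam0] at h1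
    exact tendsto_nhds_unique h1 tendsto_const_nhds
  · exact tendsto_nhds_unique (hxn.tendsto ht) (((hwn.tendsto ht).add (hlamn.tendsto ht)).congr
      fun n => ((h n).decomp _ (invTime_mem _ ht)).symm)

theorem mainTheorem6 (d : ℕ) (hd : 1 ≤ d) (T : ℝ) (hT : 0 < T)
    -- the limiting domain and cones
    (D : Set (ℝ × Euc d)) (hD : IsTimeDependentDomain T D)
    (Γ : ℝ → Euc d → Set (Euc d)) (hΓ : IsConeField T D Γ)
    (hΓopp : NoOppositeDirections T D Γ) (hΓclosed : IsClosed (coneGraph T D Γ))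
    -- the sequence of domains and cones
    (Dn : ℕ → Set (ℝ × Euc d)) (hDn : ∀ n, IsTimeDependentDomain T (Dn n))
    (Γn : ℕ → ℝ → Euc d → Set (Euc d)) (hΓn : ∀ n, IsConeField T (Dn n) (Γn n))
    (r₀ ρ₀ η₀ δ₀ h₀ : ℝ) (hρ₀ : 0 < ρ₀) (hρr : ρ₀ < r₀) (hη₀ : 0 < η₀)
    (hδ₀ : 0 < δ₀) (hδρ : δ₀ < ρ₀) (hh₀ : 1 < h₀)
    (hsphere : ∀ n, ExteriorSphere T r₀ (Dn n))
    (ha : 0 < ⨅ n, ⨅ s ∈ Icc 0 T, ⨅ z ∈ frontier (timeSection (Dn n) s),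
      aCoeff (Dn n) (Γn n) ρ₀ η₀ s z)
    (he : (⨆ n, ⨆ s ∈ Icc 0 T, ⨆ z ∈ frontier (timeSection (Dn n) s),
      eCoeff (Dn n) (Γn n) ρ₀ η₀ s z) < 1)
    (hproj : ∀ n, GoodProjections T δ₀ h₀ (Dn n) (Γn n))
    (hmod : Tendsto (fun r : ℝ => ⨆ n, timeModulus T (Dn n) r) (𝓝[>] 0) (𝓝 0))
    (hbdd : ∃ R : ℝ, ∀ t ∈ Icc 0 T, timeSection D t ⊆ Metric.ball 0 R ∧
      ∀ n, timeSection (Dn n) t ⊆ Metric.ball 0 R)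
    -- convergence of the domains and cones
    (hconv : Tendsto (fun n => ⨆ t ∈ Icc 0 T,
      Metric.hausdorffEDist (timeSection (Dn n) t) (timeSection D t)) atTop (𝓝 0))
    (hconvfr : Tendsto (fun n => ⨆ t ∈ Icc 0 T,
      Metric.hausdorffEDist (frontier (timeSection (Dn n) t)) (frontier (timeSection D t)))
      atTop (𝓝 0))
    (hconvG : Tendsto (fun n => graphHausdorff (unitGraph T (Dn n) (Γn n)) (unitGraph T D Γ))
      atTop (𝓝 0))
    -- the driving paths and the solutions
    (wn : ℕ → ℝ → Euc d) (w : ℝ → Euc d) (hwn : ∀ n, IsCadlag T (wn n)) (hw : IsCadlag T w)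
    (hwconv : SkorohodTendsto T wn w)
    (xn lamn : ℕ → ℝ → Euc d)
    (hsol : ∀ n, IsSkorohodSolution T (Dn n) (Γn n) (wn n) (xn n) (lamn n))
    (hjump : ∀ n, IsCadlagJumpLT T ρ₀ (xn n)) :
    -- every subsequence has a convergent subsequence
    (∀ φ : ℕ → ℕ, StrictMono φ → ∃ ψ : ℕ → ℕ, StrictMono ψ ∧ ∃ x lam : ℝ → Euc d,
      IsCadlag T x ∧ IsCadlag T lam ∧
      SkorohodTendsto T (fun k => xn (φ (ψ k))) x ∧
      SkorohodTendsto T (fun k => lamn (φ (ψ k))) lam) ∧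
    -- every subsequential limit is a solution, with the bound on its jumps
    (∀ φ : ℕ → ℕ, StrictMono φ → ∀ x lam : ℝ → Euc d, IsCadlag T x → IsCadlag T lam →
      SkorohodTendsto T (fun k => xn (φ k)) x →
      SkorohodTendsto T (fun k => lamn (φ k)) lam →
      IsSkorohodSolution T D Γ w x lam ∧
      jumpSup T x ≤ ENNReal.ofReal ρ₀ ∧
      ((⨆ n, jumpSup T (xn n)) < ENNReal.ofReal ρ₀ → IsCadlagJumpLT T ρ₀ x)) := by
  obtain ⟨R, hR⟩ := hbdd
  obtain ⟨a₀, e₀, ha₀, he₀, he₁, hcoeff⟩ := exists_coeffBound ha he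
  obtain ⟨θ, hid, hwθ⟩ := skorohodTendsto_iff.1 hwconv
  have hrefl := fun n => (hsol n).exists_isReflection hT.le (hDn n)
  choose hlam0 νn γn hν using hrefl
  have hpath : ∀ n, IsReflectedPath T ρ₀ η₀ a₀ e₀ (Dn n) (Γn n) (wn n) (xn n) (lamn n) (νn n)
      (γn n) := fun n =>
    { hν n with
      domain := hDn n
      x_cadlag := (hsol n).x_cadlag
      decomp := (hsol n).decomp
      mem_closure := (hsol n).mem_closure
      jump := (hjump n).2
      coeff := hcoeff n
      modulus := tendsto_of_tendsto_of_tendsto_of_le_of_le tendsto_const_nhds hmod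
        (fun _ => zero_le) fun r => le_iSup (fun n => timeModulus T (Dn n) r) n }
  have hsub : ∀ φ : ℕ → ℕ, StrictMono φ → ∃ ψ : ℕ → ℕ, StrictMono ψ ∧ ∃ x lam : ℝ → Euc d,
      IsCadlag T x ∧ IsCadlag T lam ∧
      ConvergesAlong T (fun k => θ (φ (ψ k))) (fun k => xn (φ (ψ k))) x ∧
      ConvergesAlong T (fun k => θ (φ (ψ k))) (fun k => lamn (φ (ψ k))) lam := fun φ hφ =>
    exists_subseq_convergesAlong (θ := fun n => θ (φ n)) (xn := fun n => xn (φ n))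
      (lamn := fun n => lamn (φ n)) (fun n => hpath (φ n)) hρ₀ hη₀ ha₀ he₀ he₁
      (tendsto_iSup_timeModulus_comp hmod φ) hw (hid.comp_strictMono hφ) (hwθ.comp_strictMono hφ)
      fun n t ht => (hR t ht).2 (φ n)
  refine ⟨fun φ hφ => ?_, fun φ hφ x lam hxc hlamc hx hlam => ?_⟩
  · obtain ⟨ψ, hψ, x, lam, hxc, hlamc, hx, hlam⟩ := hsub φ hφ
    have hid' := hid.comp_strictMono (hφ.comp hψ)
    exact ⟨ψ, hψ, x, lam, hxc, hlamc, skorohodTendsto_iff.2 ⟨_, hid', hx⟩,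
      skorohodTendsto_iff.2 ⟨_, hid', hlam⟩⟩
  · obtain ⟨ψ, hψ, x', lam', hxc', hlamc', hx', hlam'⟩ := hsub φ hφ
    have hχ := hφ.comp hψ
    have hid' := hid.comp_strictMono hχ
    have hx'' := hx.convergesAlong hT.le hxc hψ hid' hxc' hx'
    have hlam'' := hlam.convergesAlong hT.le hlamc hψ hid' hlamc' hlam'
    have hjumpK : ∀ K, (∀ n, jumpSup T (xn n) ≤ K) → jumpSup T x ≤ K := fun K hK =>
      jumpSup_le_of_convergesAlong (fun k => (hsol (φ (ψ k))).x_cadlag) hxc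
        (fun k => hK (φ (ψ k))) hx''
    exact ⟨isSkorohodSolution_of_convergesAlong hT.le hD hΓ hΓopp (isClosed_unitGraph hΓclosed)
        (fun k => hpath (φ (ψ k))) (fun k => hlam0 (φ (ψ k))) hρ₀ hη₀ ha₀ he₀ he₁
        (tendsto_iSup_timeModulus_comp hmod (φ ∘ ψ)) (hconv.comp hχ.tendsto_atTop)
        (hconvG.comp hχ.tendsto_atTop) hid' (hwθ.comp_strictMono hχ) hx'' hlam'' hw hxc hlamc,
      hjumpK _ fun n => (hjump n).2.le,
      fun hlt => ⟨hxc, (hjumpK _ fun n => le_iSup (fun n => jumpSup T (xn n)) n).trans_lt hlt⟩⟩
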